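/- Setting. Let $d\ge 1$, $r>0$, and let $D\subseteq[0,r]^d$ be nonempty, compact and convex. Let $V:\mathbb R^d\times\mathbb R\to\mathbb R$ be a known function and $t_1,t_2,\dots$ sampling times. Assume the following. 1. Uniformly in $n$, $-V(\cdot;t_n)$ is convex and $L$-strongly smooth over $D$ (differentiable at the points of $D$, with gradient $L$-Lipschitz on $D$ in the Euclidean norm), and $D_g:=\sup_{n\ge1}\max_{y\in D}\|\nabla V(y;t_n)\|_\infty<\infty$. 2. On $D$, $U$ is a Gaussian process with mean zero and covariance function $k$, with $k(x,x)\le 1$; its sample paths are differentiable at the points of $D$ and, for some $a,b>0$, $\Pr\{\sup_{x\in D}|\partial U/\partial x_j|>M\}\le a e^{-(M/b)^2}$ for all $M>0$ and $j=1,\dots,d$. 3. $\Delta_n:=\max_{x\in D}|V(x;t_n)-V(x;t_{n-1})|\le\Delta<\infty$ for all $n\ge2$. Let $\delta\in(0,1)$ with $\delta<2da$ (automatic if $U$ is almost surely not constant on $D$; it makes the logarithms below positive), and for $n\ge1$ put $$\beta_n=2\log\!\big(2n^2\pi^2/(3\delta)\big)+2d\log\!\big(dn^2br\sqrt{\log(4da/\delta)}\big).$$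 Algorithm (AGP-UCB, feedback at every step). At step $n\ge1$ a point $x_n\in D$ is computed as a measurable function of the past feedback $y_1,\dots,y_{n-1}$; then $y_n=U(x_n)+\varepsilon_n$ is observed, where $\varepsilon_1,\varepsilon_2,\dots$ are i.i.d. $N(0,\sigma^2)$, $\sigma>0$, independent of $U$. Let $\mu_{n-1}$ and $\sigma_{n-1}^2$ be the posterior mean and variance of the Gaussian process given $y_1,\dots,y_{n-1}$, namely, with $m=n-1$, $K_m=[k(x_i,x_j)]_{i,j\le m}$ and $k_m(x)=(k(x_1,x),\dots,k(x_m,x))^{\mathsf T}$, $$\mu_m(x)=k_m(x)^{\mathsf T}(K_m+\sigma^2I)^{-1}(y_1,\dots,y_m)^{\mathsf T},\qquad \sigma_m^2(x)=k(x,x)-k_m(x)^{\mathsf T}(K_m+\sigma^2I)^{-1}k_m(x),$$ and let $\varphi_n(x)=V(x;t_n)+\mu_{n-1}(x)+\sqrt{\beta_n}\,\sigma_{n-1}(x)$ (the square root of a negative number is read as $0$). 4. The approximate maximization of $\varphi_n$ converges linearly: for some $\eta\in[0,1)$, almost surely, for all $n\ge2$, $\ \max_D\varphi_n-\varphi_n(x_n)\le\eta\,\big(\max_D\varphi_n-\varphi_n(x_{n-1})\big)$.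 Let $f(x;t)=V(x;t)+U(x)$, let $R_T=\sum_{n=1}^T\big(\max_D f(\cdot;t_n)-f(x_n;t_n)\big)$ be the cumulative regret, and let $\gamma_T=\sup_{p_1,\dots,p_T\in D}\tfrac12\log\det\big(I+\sigma^{-2}[k(p_i,p_j)]_{i,j\le T}\big)$ be the maximum information gain. Write $F=O^*(G)$ if $F(T)=O(G(T)(\log T)^p)$ as $T\to\infty$ for some $p$. Theorem. Set $$C_1=\frac{8}{\log(1+\sigma^{-2})},\qquad C_2=\frac{2D_g}{b\sqrt{\log(2da/\delta)}}+\frac{2L}{2db^2\log(2da/\delta)}+2,\qquad G_T=2\sum_{n=1}^T\sum_{z=1}^{n-1}\eta^z\Delta_{n-z+1}.$$ There is a deterministic sequence $E_T=O^*(1)$, the same for all runs of the algorithm, such that for every run $$\Pr\Big\{\forall T\ge1:\ R_T\le\sqrt{C_1T\beta_T\gamma_T}+C_2+E_T+G_T\Big\}\ge1-\delta .$$ Moreover $G_T\le 2\Delta\eta T/(1-\eta)$ for all $T\ge1$, $\sqrt{C_1T\beta_T\gamma_T}=O^*(\sqrt{dT\gamma_T})$ and $C_2+E_T+G_T=O(T)$,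 so that the regret is $O^*(\sqrt{dT\gamma_T})+O(T)$ with probability at least $1-\delta$. -/

import Mathlib

open MeasureTheory ProbabilityTheory Filter
open scoped Matrix

noncomputable section

namespace AGPUCB

/-! ### Gaussian process regression -/

section Posterior

variable {E : Type*} {m : ℕ}

/-- The kernel matrix `K = [k(pᵢ, pⱼ)]` of the points `p₁, …, pₘ` (repetitions allowed). -/
def kernelMatrix (k : E → E → ℝ) (p : Fin m → E) : Matrix (Fin m) (Fin m) ℝ :=
  Matrix.of fun i j => k (p i) (p j)

/-- The vector `(k(p₁, x), …, k(pₘ, x))`. -/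
def kernelVec (k : E → E → ℝ) (p : Fin m → E) (x : E) : Fin m → ℝ :=
  fun i => k (p i) x

/-- Posterior mean `k(x)ᵀ (K + σ² I)⁻¹ y` after the observations `y` at the points `p`.
It is `0` if there are no observations. -/
def postMean (k : E → E → ℝ) (σ : ℝ) (p : Fin m → E) (y : Fin m → ℝ) (x : E) : ℝ :=
  kernelVec k p x ⬝ᵥ ((kernelMatrix k p + σ ^ 2 • (1 : Matrix (Fin m) (Fin m) ℝ))⁻¹ *ᵥ y)

/-- Posterior covariance `k(x, x') - k(x)ᵀ (K + σ² I)⁻¹ k(x')`. -/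
def postCov (k : E → E → ℝ) (σ : ℝ) (p : Fin m → E) (x x' : E) : ℝ :=
  k x x' - kernelVec k p x ⬝ᵥ
    ((kernelMatrix k p + σ ^ 2 • (1 : Matrix (Fin m) (Fin m) ℝ))⁻¹ *ᵥ kernelVec k p x')

/-- Posterior standard deviation. -/
def postSd (k : E → E → ℝ) (σ : ℝ) (p : Fin m → E) (x : E) : ℝ :=
  √(postCov k σ p x x)

/-- Information gain `½ log det (I + σ⁻² K)` of the points `p`. -/
def infoGain (k : E → E → ℝ) (σ : ℝ) (p : Fin m → E) : ℝ :=
  (1 / 2) * Real.log ((1 : Matrix (Fin m) (Fin m) ℝ) + (σ ^ 2)⁻¹ • kernelMatrix k p).det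

/-- The maximum information gain `γ_T` over `T` points of `D`. -/
def maxInfoGain (k : E → E → ℝ) (σ : ℝ) (D : Set E) (T : ℕ) : ℝ :=
  ⨆ p : Fin T → D, infoGain k σ (fun i => (p i : E))

end Posterior

/-! ### Parameters -/

/-- The confidence parameter
`β_n = 2 log(2 n² π² / (3δ)) + 2 d log(d n² b r √(log(4 d a / δ)))`. -/
def beta (d : ℕ) (a b r δ : ℝ) (n : ℕ) : ℝ :=
  2 * Real.log (2 * (n : ℝ) ^ 2 * Real.pi ^ 2 / (3 * δ)) +
    2 * d * Real.log (d * (n : ℝ) ^ 2 * b * r * √(Real.log (4 * d * a / δ)))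

/-- `C₁ = 8 / log(1 + σ⁻²)`. -/
def C₁ (σ : ℝ) : ℝ := 8 / Real.log (1 + (σ ^ 2)⁻¹)

/-- `C₂ = 2 D_g / (b √(log(2da/δ))) + 2 L / (2 d b² log(2da/δ)) + 2`. -/
def C₂ (d : ℕ) (a b δ L Dg : ℝ) : ℝ :=
  2 * Dg / (b * √(Real.log (2 * d * a / δ))) +
    2 * L / (2 * d * b ^ 2 * Real.log (2 * d * a / δ)) + 2

/-! ### The time-varying known function -/

section Known

variable {d : ℕ}

/-- The `j`-th partial derivative of `f` at `x`. -/
def partialDeriv (f : EuclideanSpace ℝ (Fin d) → ℝ) (j : Fin d)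
    (x : EuclideanSpace ℝ (Fin d)) : ℝ :=
  fderiv ℝ f x (EuclideanSpace.single j 1)

/-- The absolute values of the partial derivatives of `V(·; t_n)`, `n ≥ 1`, at the points
of `D`. -/
def gradEntries (V : EuclideanSpace ℝ (Fin d) → ℝ → ℝ) (t : ℕ → ℝ)
    (D : Set (EuclideanSpace ℝ (Fin d))) : Set ℝ :=
  {g | ∃ n : ℕ, 1 ≤ n ∧ ∃ y ∈ D, ∃ j : Fin d, g = |partialDeriv (fun x => V x (t n)) j y|}

/-- `D_g`, the maximum of `‖∇V(y; t_n)‖_∞` over `y ∈ D`, uniformly in time. -/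
def gradBound (V : EuclideanSpace ℝ (Fin d) → ℝ → ℝ) (t : ℕ → ℝ)
    (D : Set (EuclideanSpace ℝ (Fin d))) : ℝ :=
  sSup (gradEntries V t D)

/-- `g` is concave on `D`, and differentiable at the points of `D` with a gradient that is
`L`-Lipschitz on `D` for the Euclidean norm. -/
structure ConcaveSmoothOn (L : ℝ) (D : Set (EuclideanSpace ℝ (Fin d)))
    (g : EuclideanSpace ℝ (Fin d) → ℝ) : Prop where
  concave : ConcaveOn ℝ D g
  differentiable : ∀ x ∈ D, DifferentiableAt ℝ g x
  smooth : ∀ x ∈ D, ∀ y ∈ D, ‖gradient g x - gradient g y‖ ≤ L * ‖x - y‖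

/-- `Δ_n = max_{x ∈ D} |V(x; t_n) - V(x; t_{n-1})|` (used for `n ≥ 2`). -/
def drift (V : EuclideanSpace ℝ (Fin d) → ℝ → ℝ) (t : ℕ → ℝ)
    (D : Set (EuclideanSpace ℝ (Fin d))) (n : ℕ) : ℝ :=
  ⨆ x : D, |V x (t n) - V x (t (n - 1))|

/-- `G_T = 2 ∑_{n=1}^T ∑_{z=1}^{n-1} η^z Δ_{n-z+1}`. -/
def driftTerm (V : EuclideanSpace ℝ (Fin d) → ℝ → ℝ) (t : ℕ → ℝ)
    (D : Set (EuclideanSpace ℝ (Fin d))) (η : ℝ) (T : ℕ) : ℝ :=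
  2 * ∑ n ∈ Finset.Icc 1 T, ∑ z ∈ Finset.Icc 1 (n - 1), η ^ z * drift V t D (n - z + 1)

end Known

/-! ### The unknown function and the feedback -/

section Model

variable {d : ℕ} {Ω : Type*} [MeasurableSpace Ω]

/-- On `D`, `U` is a Gaussian process with mean zero and covariance function `k`. -/
structure IsCenteredGP (P : Measure Ω) (D : Set (EuclideanSpace ℝ (Fin d)))
    (k : EuclideanSpace ℝ (Fin d) → EuclideanSpace ℝ (Fin d) → ℝ)
    (U : EuclideanSpace ℝ (Fin d) → Ω → ℝ) : Prop where
  measurable : ∀ x ∈ D, Measurable (U x)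
  gaussian : IsGaussianProcess (fun (x : D) ω => U x ω) P
  mean_eq : ∀ x ∈ D, ∫ ω, U x ω ∂P = 0
  cov_eq : ∀ x ∈ D, ∀ y ∈ D, covariance (U x) (U y) P = k x y

/-- The sample paths are differentiable at the points of `D`, and
`Pr{sup_{x ∈ D} |∂U/∂x_j| > M} ≤ a e^{-(M/b)²}` for all `j` and all `M > 0`. -/
structure HasDerivTails (P : Measure Ω) (D : Set (EuclideanSpace ℝ (Fin d))) (a b : ℝ)
    (U : EuclideanSpace ℝ (Fin d) → Ω → ℝ) : Prop where
  differentiable : ∀ ω, ∀ x ∈ D, DifferentiableAt ℝ (fun x' => U x' ω) x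
  tail : ∀ (j : Fin d) (M : ℝ), 0 < M →
    P {ω | ∃ x ∈ D, M < |partialDeriv (fun x' => U x' ω) j x|} ≤
      ENNReal.ofReal (a * Real.exp (-(M / b) ^ 2))

/-- `ε₁, ε₂, …` are i.i.d. `N(0, σ²)` and independent of `(U(x))_{x ∈ D}`. -/
structure IsNoise (P : Measure Ω) (D : Set (EuclideanSpace ℝ (Fin d))) (σ : ℝ)
    (U : EuclideanSpace ℝ (Fin d) → Ω → ℝ) (ε : ℕ → Ω → ℝ) : Prop where
  measurable : ∀ n, Measurable (ε n)
  law : ∀ n, P.map (ε n) = gaussianReal 0 (Real.toNNReal (σ ^ 2))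
  indep : iIndepFun ε P
  indep_U : IndepFun (fun ω (x : D) => U x ω) (fun ω n => ε n ω) P

/-- The feedback `y_n = U(x_n) + ε_n`. -/
def feedback (U : EuclideanSpace ℝ (Fin d) → Ω → ℝ) (ε : ℕ → Ω → ℝ)
    (X : ℕ → Ω → EuclideanSpace ℝ (Fin d)) (n : ℕ) (ω : Ω) : ℝ :=
  U (X n ω) ω + ε n ω

/-- The upper confidence bound `Û_n(x) = μ_{n-1}(x) + √β_n σ_{n-1}(x)`, for `n ≥ 1`, where
`μ_{n-1}, σ_{n-1}` come from the feedback `y₁, …, y_{n-1}` at the points `x₁, …, x_{n-1}`. -/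
def ucb (k : EuclideanSpace ℝ (Fin d) → EuclideanSpace ℝ (Fin d) → ℝ) (σ : ℝ) (β : ℕ → ℝ)
    (U : EuclideanSpace ℝ (Fin d) → Ω → ℝ) (ε : ℕ → Ω → ℝ)
    (X : ℕ → Ω → EuclideanSpace ℝ (Fin d)) (n : ℕ) (ω : Ω)
    (x : EuclideanSpace ℝ (Fin d)) : ℝ :=
  postMean k σ (fun i : Fin (n - 1) => X (i + 1) ω)
      (fun i : Fin (n - 1) => feedback U ε X (i + 1) ω) x +
    √(β n) * postSd k σ (fun i : Fin (n - 1) => X (i + 1) ω) x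

/-- The surrogate objective `φ_n(x) = V(x; t_n) + Û_n(x)`. -/
def surrogate (V : EuclideanSpace ℝ (Fin d) → ℝ → ℝ) (t : ℕ → ℝ)
    (k : EuclideanSpace ℝ (Fin d) → EuclideanSpace ℝ (Fin d) → ℝ) (σ : ℝ) (β : ℕ → ℝ)
    (U : EuclideanSpace ℝ (Fin d) → Ω → ℝ) (ε : ℕ → Ω → ℝ)
    (X : ℕ → Ω → EuclideanSpace ℝ (Fin d)) (n : ℕ) (ω : Ω)
    (x : EuclideanSpace ℝ (Fin d)) : ℝ :=
  V x (t n) + ucb k σ β U ε X n ω x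

/-- `x₁, x₂, …` are the points of a run of AGP-UCB with feedback at every step.
The point `x_n` is computed, by any rule, from the feedback `y₁, …, y_{n-1}` only (so `x₁` is
deterministic), and the approximate maximization of `φ_n` started at `x_{n-1}` converges
linearly: `φ_n^* - φ_n(x_n) ≤ η (φ_n^* - φ_n(x_{n-1}))`. In particular `x_n` may be the result of
finitely many iterations, from `x_{n-1}`, of an optimization method applied to `φ_n`. -/
structure IsRun (P : Measure Ω) (D : Set (EuclideanSpace ℝ (Fin d)))
    (V : EuclideanSpace ℝ (Fin d) → ℝ → ℝ) (t : ℕ → ℝ)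
    (k : EuclideanSpace ℝ (Fin d) → EuclideanSpace ℝ (Fin d) → ℝ) (σ : ℝ) (β : ℕ → ℝ) (η : ℝ)
    (U : EuclideanSpace ℝ (Fin d) → Ω → ℝ) (ε : ℕ → Ω → ℝ)
    (X : ℕ → Ω → EuclideanSpace ℝ (Fin d)) : Prop where
  mem : ∀ n, 1 ≤ n → ∀ ω, X n ω ∈ D
  predictable : ∀ n, 1 ≤ n →
    Measurable[⨆ i ∈ Finset.Icc 1 (n - 1),
      MeasurableSpace.comap (feedback U ε X i) (borel ℝ)] (X n)
  linear_convergence : ∀ᵐ ω ∂P, ∀ n, 2 ≤ n →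
    (⨆ x : D, surrogate V t k σ β U ε X n ω x) - surrogate V t k σ β U ε X n ω (X n ω) ≤
      η * ((⨆ x : D, surrogate V t k σ β U ε X n ω x) -
        surrogate V t k σ β U ε X n ω (X (n - 1) ω))

/-- The cumulative regret `R_T = ∑_{n=1}^T (f_n^* - f(x_n; t_n))`, where
`f(x; t) = V(x; t) + U(x)` and `f_n^*` is the maximum of `f(·; t_n)` on `D`. -/
def regret (D : Set (EuclideanSpace ℝ (Fin d)))
    (V : EuclideanSpace ℝ (Fin d) → ℝ → ℝ) (t : ℕ → ℝ)
    (U : EuclideanSpace ℝ (Fin d) → Ω → ℝ)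
    (X : ℕ → Ω → EuclideanSpace ℝ (Fin d)) (T : ℕ) (ω : Ω) : ℝ :=
  ∑ n ∈ Finset.Icc 1 T,
    ((⨆ x : D, (V x (t n) + U x ω)) - (V (X n ω) (t n) + U (X n ω) ω))

end Model

/-- `f = O^*(g)`: big-`O` as `T → ∞`, up to a polylogarithmic factor. -/
def IsBigOStar (f g : ℕ → ℝ) : Prop :=
  ∃ p : ℕ, f =O[atTop] fun T => g T * Real.log T ^ p

end AGPUCB

end

/-!
The constants of the bound leave room in one place: the regret of a step is usually charged twice
for the width `√β_n σ_{n-1}` of the confidence band, once for the upper bound at the maximizer and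
once for the lower bound at `x_n`, and `C₁` is the constant for two charges. Here
`√β_n σ_{n-1}(x_n)` is paid only once. At the single point `x_n`, which is a function of the past, the
error `U(x_n) - μ_{n-1}(x_n)` is `σ_{n-1}(x_n)` times a standard Gaussian variable, without the
factor `√β_n`. So half of the main term is left over, and since `β_n` grows like `log n`, it
absorbs every other error of this kind; what remains is `O(log T)`.

*Algebra.* A new observation is a rank one update of the posterior (`postMean_succ`,
`postCov_succ`), and adds `½ log (1 + s_n² / σ²)` to the information gain, where
`s_n = σ_{n-1}(x_n)` (`infoGain_succ`). This gives `4 ∑ s_n² ≤ C₁ γ_T` (`four_mul_sum_sq_predSd_le`). As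
the kernel is the Gram kernel of the totally bounded set `{U(x) : x ∈ D}` in `L²`, for each `e > 0`
the number of steps with `s_n > e` is bounded uniformly over all sequences of points
(`exists_card_filter_lt_predSd_le`).

*Approximate maximization.* By linear convergence and the drift bound, the gaps
`max φ_n - φ_n(x_n)` obey a linear recursion with factor `η` (`IsGoodPath.surrogateGap_succ_le`). The drift
contributes exactly `G_T`. The rest of the input consists of the increments of `√β_n`, which
telescope, and, due to the last observation, of terms `s_n · |y_n - μ_{n-1}(x_n)|` and `√β_n s_n³`.
Except for a bounded number of steps `s_n` is small, so these terms are dominated by the unused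
half of `√β_n s_n`, once the sizes of the normalized errors and of the noise are controlled by the
sums of their eighth powers with the summable weights `logWeight n`. The outcome is the
deterministic bound `exists_forall_isGoodPath_sum_regret_le` for all realizations with the
properties `IsGoodPath`, with a constant independent of the realization.

*Probability.* The points depend on the observations, hence the posterior formulas must be shown to
be valid for an adaptive design. For fixed points this is a Cameron-Martin computation
(`lintegral_exp_mul_likelihood`). A triangular change of variables for the noise
(`lintegral_comp_response`) replaces the adaptive observations by pure noise, weighted with the
likelihood, and reduces the adaptive case to the fixed one: the standardized errors are
sub-Gaussian (`IsAdaptiveDesign.lintegral_exp_stdError_le`). By Chernoff's bound the confidence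
bounds hold from some step on at all points of grids of width `r / n`, and by Lipschitz continuity
of the sample path everywhere, up to errors of order `1 / n`; by Markov's inequality the weighted
sums of eighth powers are bounded. So a run is good with probability at least `1 - δ`
(`exists_forall_isRun_le_measure_isGoodPath`), with constants that do not depend on the run.
-/

namespace AGPUCB

/-! ### Bordered symmetric matrices -/

section Bordered

variable {n : ℕ} {A : Matrix (Fin (n + 1)) (Fin (n + 1)) ℝ} {A₀ : Matrix (Fin n) (Fin n) ℝ}
  {κ : Fin n → ℝ} {a : ℝ}

lemma dotProduct_inv_mulVec_comm {m : ℕ} {B : Matrix (Fin m) (Fin m) ℝ} (hB : B.IsSymm)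
    (f g : Fin m → ℝ) : f ⬝ᵥ (B⁻¹ *ᵥ g) = g ⬝ᵥ (B⁻¹ *ᵥ f) := by
  have h : (B⁻¹)ᵀ = B⁻¹ := by rw [Matrix.transpose_nonsing_inv, hB.eq]
  rw [Matrix.dotProduct_mulVec, ← Matrix.mulVec_transpose, h, dotProduct_comm]

lemma mulVec_inv_mulVec_of_isUnit {m : ℕ} {B : Matrix (Fin m) (Fin m) ℝ} (hB : IsUnit B.det)
    (g : Fin m → ℝ) : B *ᵥ (B⁻¹ *ᵥ g) = g := by
  rw [Matrix.mulVec_mulVec, Matrix.mul_nonsing_inv _ hB, Matrix.one_mulVec]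

lemma inv_mulVec_eq_of_mulVec_eq {m : ℕ} {B : Matrix (Fin m) (Fin m) ℝ} (hB : IsUnit B.det)
    {g v : Fin m → ℝ} (h : B *ᵥ v = g) : B⁻¹ *ᵥ g = v := by
  rw [← h, Matrix.mulVec_mulVec, Matrix.nonsing_inv_mul _ hB, Matrix.one_mulVec]

/-- The inverse of a symmetric matrix bordered by one row and one column, in the form of the
rank-one update of the associated bilinear form; `S` is the Schur complement. -/
lemma dotProduct_inv_mulVec_bordered (hA : IsUnit A.det) (hA₀ : IsUnit A₀.det)
    (hsymm : A₀.IsSymm) (h₀ : ∀ i j : Fin n, A i.castSucc j.castSucc = A₀ i j)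
    (h₁ : ∀ i : Fin n, A i.castSucc (Fin.last n) = κ i)
    (h₂ : ∀ i : Fin n, A (Fin.last n) i.castSucc = κ i)
    {S : ℝ} (hS : A (Fin.last n) (Fin.last n) - κ ⬝ᵥ (A₀⁻¹ *ᵥ κ) = S) (hS0 : S ≠ 0)
    (f g : Fin (n + 1) → ℝ) :
    f ⬝ᵥ (A⁻¹ *ᵥ g) =
      (fun i : Fin n => f i.castSucc) ⬝ᵥ (A₀⁻¹ *ᵥ fun i : Fin n => g i.castSucc) +
      (f (Fin.last n) - κ ⬝ᵥ (A₀⁻¹ *ᵥ fun i : Fin n => f i.castSucc)) *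
      (g (Fin.last n) - κ ⬝ᵥ (A₀⁻¹ *ᵥ fun i : Fin n => g i.castSucc)) / S := by
  set f₀ : Fin n → ℝ := fun i => f i.castSucc with hf₀
  set g₀ : Fin n → ℝ := fun i => g i.castSucc with hg₀
  set c : ℝ := (g (Fin.last n) - κ ⬝ᵥ (A₀⁻¹ *ᵥ g₀)) / S with hc
  set w : Fin n → ℝ := A₀⁻¹ *ᵥ g₀ - c • (A₀⁻¹ *ᵥ κ) with hw
  have hv : A *ᵥ (Fin.snoc w c : Fin (n + 1) → ℝ) = g := by
    funext i
    refine Fin.lastCases ?_ (fun i => ?_) i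
    · have : (A *ᵥ (Fin.snoc w c : Fin (n + 1) → ℝ)) (Fin.last n) =
          κ ⬝ᵥ w + A (Fin.last n) (Fin.last n) * c := by
        simp [Matrix.mulVec, dotProduct, Fin.sum_univ_castSucc, h₂]
      rw [this, hw, dotProduct_sub, dotProduct_smul, smul_eq_mul]
      have : c * S = g (Fin.last n) - κ ⬝ᵥ (A₀⁻¹ *ᵥ g₀) := by rw [hc]; field_simp
      rw [← hS] at this
      linarith
    · have : (A *ᵥ (Fin.snoc w c : Fin (n + 1) → ℝ)) i.castSucc = (A₀ *ᵥ w) i + κ i * c := by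
        simp [Matrix.mulVec, dotProduct, Fin.sum_univ_castSucc, h₀, h₁]
      rw [this, hw, Matrix.mulVec_sub, Matrix.mulVec_smul, mulVec_inv_mulVec_of_isUnit hA₀,
        mulVec_inv_mulVec_of_isUnit hA₀]
      simp [hg₀]
      ring
  rw [inv_mulVec_eq_of_mulVec_eq hA hv]
  have : f ⬝ᵥ (Fin.snoc w c : Fin (n + 1) → ℝ) = f₀ ⬝ᵥ w + f (Fin.last n) * c := by
    simp [dotProduct, Fin.sum_univ_castSucc, hf₀]
  rw [this, hw, dotProduct_sub, dotProduct_smul, smul_eq_mul,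
    dotProduct_inv_mulVec_comm hsymm f₀ κ, hc]
  ring

lemma det_bordered (hA : IsUnit A.det) (hA₀ : IsUnit A₀.det)
    (hsymm : A₀.IsSymm) (h₀ : ∀ i j : Fin n, A i.castSucc j.castSucc = A₀ i j)
    (h₁ : ∀ i : Fin n, A i.castSucc (Fin.last n) = κ i)
    (h₂ : ∀ i : Fin n, A (Fin.last n) i.castSucc = κ i)
    {S : ℝ} (hS : A (Fin.last n) (Fin.last n) - κ ⬝ᵥ (A₀⁻¹ *ᵥ κ) = S) (hS0 : S ≠ 0) :
    A.det = A₀.det * S := by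
  have h := dotProduct_inv_mulVec_bordered hA hA₀ hsymm h₀ h₁ h₂ hS hS0
    (Pi.single (Fin.last n) 1) (Pi.single (Fin.last n) 1)
  have hz : (fun i : Fin n => (Pi.single (Fin.last n) (1 : ℝ) : Fin (n + 1) → ℝ) i.castSucc) =
      0 := by
    funext i
    simp [Fin.castSucc_ne_last]
  rw [hz] at h
  have hadj : A.adjugate (Fin.last n) (Fin.last n) = A₀.det := by
    rw [Matrix.adjugate_fin_succ_eq_det_submatrix]
    have : A.submatrix (Fin.last n).succAbove (Fin.last n).succAbove = A₀ := by
      ext i j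
      simp [h₀]
    rw [this, Even.neg_one_pow ⟨_, rfl⟩, one_mul]
  simp [Matrix.inv_def, hadj] at h
  have hA' := hA.ne_zero
  field_simp at h
  linarith

end Bordered

/-! ### Algebra of the posterior -/

section PosteriorAlgebra

variable {E H : Type*} [NormedAddCommGroup H] [InnerProductSpace ℝ H]
  {k : E → E → ℝ} {Φ : E → H} {σ : ℝ} {m : ℕ}

/-- The regularized kernel matrix `K + σ² I`. -/
noncomputable def regMatrix (k : E → E → ℝ) (σ : ℝ) (p : Fin m → E) :
    Matrix (Fin m) (Fin m) ℝ :=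
  kernelMatrix k p + σ ^ 2 • (1 : Matrix (Fin m) (Fin m) ℝ)

/-- The weights `(K + σ² I)⁻¹ k(x)` of the observations in the posterior mean at `x`. -/
noncomputable def weights (k : E → E → ℝ) (σ : ℝ) (p : Fin m → E) (x : E) : Fin m → ℝ :=
  (regMatrix k σ p)⁻¹ *ᵥ kernelVec k p x

lemma regMatrix_apply (p : Fin m → E) (i j : Fin m) :
    regMatrix k σ p i j = k (p i) (p j) + if i = j then σ ^ 2 else 0 := by
  simp [regMatrix, kernelMatrix, Matrix.one_apply]

lemma dotProduct_regMatrix_mulVec (hk : ∀ x y, k x y = inner ℝ (Φ x) (Φ y)) (p : Fin m → E)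
    (v w : Fin m → ℝ) :
    v ⬝ᵥ (regMatrix k σ p *ᵥ w) =
      inner ℝ (∑ i, v i • Φ (p i)) (∑ i, w i • Φ (p i)) + σ ^ 2 * (v ⬝ᵥ w) := by
  have hg : kernelMatrix k p = Matrix.gram ℝ (fun i => Φ (p i)) := by
    ext i j; simp [kernelMatrix, hk, Matrix.gram_apply]
  have := Matrix.star_dotProduct_gram_mulVec (𝕜 := ℝ) (fun i => Φ (p i)) v w
  simp only [star_trivial] at this
  rw [regMatrix, Matrix.add_mulVec, dotProduct_add, hg, this, Matrix.smul_mulVec,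
    Matrix.one_mulVec, dotProduct_smul, smul_eq_mul]

lemma regMatrix_isSymm (hk : ∀ x y, k x y = inner ℝ (Φ x) (Φ y)) (p : Fin m → E) :
    (regMatrix k σ p).IsSymm := by
  ext i j
  simp [regMatrix_apply, hk, real_inner_comm, eq_comm]

lemma regMatrix_isUnit_det (hk : ∀ x y, k x y = inner ℝ (Φ x) (Φ y)) (hσ : 0 < σ)
    (p : Fin m → E) : IsUnit (regMatrix k σ p).det := by
  refine (Matrix.isUnit_iff_isUnit_det _).mp (Matrix.PosDef.isUnit ?_)
  refine .of_dotProduct_mulVec_pos ?_ fun v hv => ?_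
  · rw [Matrix.IsHermitian, Matrix.conjTranspose_eq_transpose_of_trivial]
    exact regMatrix_isSymm hk p
  · rw [star_trivial, dotProduct_regMatrix_mulVec hk]
    have h1 : 0 < v ⬝ᵥ v := by
      have := (Matrix.dotProduct_star_self_pos_iff (v := v)).2 hv
      simpa using this
    have h2 := real_inner_self_nonneg (x := ∑ i, v i • Φ (p i))
    positivity

lemma regMatrix_mulVec_weights (hk : ∀ x y, k x y = inner ℝ (Φ x) (Φ y)) (hσ : 0 < σ)
    (p : Fin m → E) (x : E) : regMatrix k σ p *ᵥ weights k σ p x = kernelVec k p x :=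
  mulVec_inv_mulVec_of_isUnit (regMatrix_isUnit_det hk hσ p) _

lemma postMean_eq_weights (hk : ∀ x y, k x y = inner ℝ (Φ x) (Φ y)) (p : Fin m → E)
    (y : Fin m → ℝ) (x : E) : postMean k σ p y x = weights k σ p x ⬝ᵥ y := by
  rw [postMean, ← regMatrix, dotProduct_inv_mulVec_comm (regMatrix_isSymm hk p), dotProduct_comm,
    weights]

lemma postCov_eq_weights (p : Fin m → E) (x x' : E) :
    postCov k σ p x x' = k x x' - kernelVec k p x ⬝ᵥ weights k σ p x' := rfl

lemma kernelVec_dotProduct (hk : ∀ x y, k x y = inner ℝ (Φ x) (Φ y)) (p : Fin m → E) (x : E)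
    (v : Fin m → ℝ) : kernelVec k p x ⬝ᵥ v = inner ℝ (Φ x) (∑ i, v i • Φ (p i)) := by
  simp [dotProduct, kernelVec, hk, inner_sum, inner_smul_right, real_inner_comm, mul_comm]

/-- The feature vector of `x` for the posterior covariance: the residual of the regression of
`Φ x` on the observed features, together with the noise carried by the weights. -/
noncomputable def postFeature (k : E → E → ℝ) (Φ : E → H) (σ : ℝ) (p : Fin m → E) (x : E) :
    WithLp 2 (H × EuclideanSpace ℝ (Fin m)) :=
  WithLp.toLp 2 (Φ x - ∑ i, weights k σ p x i • Φ (p i), WithLp.toLp 2 (σ • weights k σ p x))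

lemma postCov_eq_inner (hk : ∀ x y, k x y = inner ℝ (Φ x) (Φ y)) (hσ : 0 < σ)
    (p : Fin m → E) (x x' : E) :
    postCov k σ p x x' = inner ℝ (postFeature k Φ σ p x) (postFeature k Φ σ p x') := by
  have h1 := dotProduct_regMatrix_mulVec (σ := σ) hk p (weights k σ p x) (weights k σ p x')
  rw [regMatrix_mulVec_weights hk hσ, dotProduct_comm, kernelVec_dotProduct hk] at h1
  rw [postCov_eq_weights, kernelVec_dotProduct hk, hk]
  simp only [postFeature, WithLp.prod_inner_apply, inner_sub_left, inner_sub_right,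
    EuclideanSpace.inner_toLp_toLp, star_trivial, dotProduct_smul, smul_dotProduct, smul_eq_mul]
  rw [dotProduct_comm (weights k σ p x')]
  have h2 := real_inner_comm (Φ x') (∑ i, weights k σ p x i • Φ (p i))
  linarith

lemma postCov_comm (hk : ∀ x y, k x y = inner ℝ (Φ x) (Φ y)) (hσ : 0 < σ)
    (p : Fin m → E) (x x' : E) : postCov k σ p x x' = postCov k σ p x' x := by
  rw [postCov_eq_inner hk hσ, postCov_eq_inner hk hσ, real_inner_comm]

lemma postCov_self_nonneg (hk : ∀ x y, k x y = inner ℝ (Φ x) (Φ y)) (hσ : 0 < σ)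
    (p : Fin m → E) (x : E) : 0 ≤ postCov k σ p x x := by
  rw [postCov_eq_inner hk hσ]
  exact real_inner_self_nonneg

lemma postSd_nonneg (p : Fin m → E) (x : E) : 0 ≤ postSd k σ p x := Real.sqrt_nonneg _

lemma postSd_sq (hk : ∀ x y, k x y = inner ℝ (Φ x) (Φ y)) (hσ : 0 < σ)
    (p : Fin m → E) (x : E) : postSd k σ p x ^ 2 = postCov k σ p x x :=
  Real.sq_sqrt (postCov_self_nonneg hk hσ p x)

lemma abs_postCov_le (hk : ∀ x y, k x y = inner ℝ (Φ x) (Φ y)) (hσ : 0 < σ)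
    (p : Fin m → E) (x x' : E) :
    |postCov k σ p x x'| ≤ postSd k σ p x * postSd k σ p x' := by
  rw [postSd, postSd, postCov_eq_inner hk hσ, postCov_eq_inner hk hσ, postCov_eq_inner hk hσ,
    ← norm_eq_sqrt_real_inner, ← norm_eq_sqrt_real_inner]
  exact abs_real_inner_le_norm _ _

/-- Among all linear predictors of the value at `x` from the noisy observations, the posterior
mean has the least mean square error. -/
lemma postCov_self_le (hk : ∀ x y, k x y = inner ℝ (Φ x) (Φ y)) (hσ : 0 < σ)
    (p : Fin m → E) (x : E) (v : Fin m → ℝ) :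
    postCov k σ p x x ≤ ‖Φ x - ∑ i, v i • Φ (p i)‖ ^ 2 + σ ^ 2 * (v ⬝ᵥ v) := by
  set w := weights k σ p x with hw
  have h0 := dotProduct_regMatrix_mulVec (σ := σ) hk p (v - w) (v - w)
  have h1 : 0 ≤ (v - w) ⬝ᵥ (regMatrix k σ p *ᵥ (v - w)) := by
    rw [h0]
    have h1 : 0 ≤ (v - w) ⬝ᵥ (v - w) := by
      exact Finset.sum_nonneg fun i _ => mul_self_nonneg _
    have h2 := real_inner_self_nonneg (x := ∑ i, (v - w) i • Φ (p i))
    positivity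
  have h2 := dotProduct_regMatrix_mulVec (σ := σ) hk p v v
  have hsym : w ⬝ᵥ (regMatrix k σ p *ᵥ v) = v ⬝ᵥ (regMatrix k σ p *ᵥ w) := by
    rw [Matrix.dotProduct_mulVec, ← Matrix.mulVec_transpose, regMatrix_isSymm hk p,
      dotProduct_comm]
  rw [Matrix.mulVec_sub, sub_dotProduct, dotProduct_sub, dotProduct_sub, hsym,
    regMatrix_mulVec_weights hk hσ, h2, dotProduct_comm v (kernelVec k p x),
    dotProduct_comm w (kernelVec k p x), kernelVec_dotProduct hk, kernelVec_dotProduct hk] at h1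
  rw [postCov_eq_weights, kernelVec_dotProduct hk, hk, ← hw, @norm_sub_sq_real,
    ← real_inner_self_eq_norm_sq,
    ← real_inner_self_eq_norm_sq]
  linarith

lemma postCov_self_le_prior (hk : ∀ x y, k x y = inner ℝ (Φ x) (Φ y)) (hσ : 0 < σ)
    (p : Fin m → E) (x : E) : postCov k σ p x x ≤ k x x := by
  have := postCov_self_le hk hσ p x 0
  rw [hk, real_inner_self_eq_norm_sq]
  simpa using this

lemma postSd_le_one (hk : ∀ x y, k x y = inner ℝ (Φ x) (Φ y)) (hσ : 0 < σ)
    (hk1 : ∀ x, k x x ≤ 1) (p : Fin m → E) (x : E) : postSd k σ p x ≤ 1 :=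
  Real.sqrt_le_one.2 ((postCov_self_le_prior hk hσ p x).trans (hk1 x))

/-- The restriction of the list of points `p` to its first `m` entries. -/
def initPts (p : Fin (m + 1) → E) : Fin m → E := fun i => p i.castSucc

lemma regMatrix_schur (p : Fin (m + 1) → E) :
    regMatrix k σ p (Fin.last m) (Fin.last m) - kernelVec k (initPts p) (p (Fin.last m)) ⬝ᵥ
      ((regMatrix k σ (initPts p))⁻¹ *ᵥ kernelVec k (initPts p) (p (Fin.last m))) =
      σ ^ 2 + postCov k σ (initPts p) (p (Fin.last m)) (p (Fin.last m)) := by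
  rw [regMatrix_apply, if_pos rfl, postCov, ← regMatrix]
  ring

lemma dotProduct_inv_regMatrix_succ (hk : ∀ x y, k x y = inner ℝ (Φ x) (Φ y)) (hσ : 0 < σ)
    (p : Fin (m + 1) → E) (f g : Fin (m + 1) → ℝ) :
    f ⬝ᵥ ((regMatrix k σ p)⁻¹ *ᵥ g) =
      (fun i : Fin m => f i.castSucc) ⬝ᵥ
        ((regMatrix k σ (initPts p))⁻¹ *ᵥ fun i : Fin m => g i.castSucc) +
      (f (Fin.last m) - kernelVec k (initPts p) (p (Fin.last m)) ⬝ᵥ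
        ((regMatrix k σ (initPts p))⁻¹ *ᵥ fun i : Fin m => f i.castSucc)) *
      (g (Fin.last m) - kernelVec k (initPts p) (p (Fin.last m)) ⬝ᵥ
        ((regMatrix k σ (initPts p))⁻¹ *ᵥ fun i : Fin m => g i.castSucc)) /
      (σ ^ 2 + postCov k σ (initPts p) (p (Fin.last m)) (p (Fin.last m))) := by
  have h0 := postCov_self_nonneg hk hσ (initPts p) (p (Fin.last m))
  refine dotProduct_inv_mulVec_bordered (regMatrix_isUnit_det hk hσ p)
    (regMatrix_isUnit_det hk hσ _) (regMatrix_isSymm hk _) ?_ ?_ ?_ (regMatrix_schur p)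
    (by positivity) f g
  · intro i j; simp [regMatrix_apply, initPts]
  · intro i; simp [regMatrix_apply, initPts, kernelVec, Fin.castSucc_ne_last]
  · intro i
    simp [regMatrix_apply, initPts, kernelVec, (Fin.castSucc_ne_last _).symm, hk, real_inner_comm]

lemma postMean_succ (hk : ∀ x y, k x y = inner ℝ (Φ x) (Φ y)) (hσ : 0 < σ)
    (p : Fin (m + 1) → E) (y : Fin (m + 1) → ℝ) (x : E) :
    postMean k σ p y x = postMean k σ (initPts p) (fun i => y i.castSucc) x +
      postCov k σ (initPts p) x (p (Fin.last m)) /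
        (σ ^ 2 + postCov k σ (initPts p) (p (Fin.last m)) (p (Fin.last m))) *
      (y (Fin.last m) -
        postMean k σ (initPts p) (fun i => y i.castSucc) (p (Fin.last m))) := by
  have h := dotProduct_inv_regMatrix_succ hk hσ p (kernelVec k p x) y
  have hx : (fun i : Fin m => kernelVec k p x i.castSucc) = kernelVec k (initPts p) x := rfl
  rw [hx] at h
  rw [postMean, ← regMatrix, h, postMean, ← regMatrix, postMean, ← regMatrix,
    postCov_comm hk hσ _ x]
  have : postCov k σ (initPts p) (p (Fin.last m)) x = kernelVec k p x (Fin.last m) -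
      kernelVec k (initPts p) (p (Fin.last m)) ⬝ᵥ
        ((regMatrix k σ (initPts p))⁻¹ *ᵥ kernelVec k (initPts p) x) := rfl
  rw [← this]
  ring

lemma postCov_succ (hk : ∀ x y, k x y = inner ℝ (Φ x) (Φ y)) (hσ : 0 < σ)
    (p : Fin (m + 1) → E) (x x' : E) :
    postCov k σ p x x' = postCov k σ (initPts p) x x' -
      postCov k σ (initPts p) x (p (Fin.last m)) * postCov k σ (initPts p) x' (p (Fin.last m)) /
        (σ ^ 2 + postCov k σ (initPts p) (p (Fin.last m)) (p (Fin.last m))) := by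
  have h := dotProduct_inv_regMatrix_succ hk hσ p (kernelVec k p x) (kernelVec k p x')
  have hx : ∀ x, (fun i : Fin m => kernelVec k p x i.castSucc) = kernelVec k (initPts p) x :=
    fun _ => rfl
  rw [hx, hx] at h
  rw [postCov_comm hk hσ _ x (p (Fin.last m)), postCov_comm hk hσ _ x' (p (Fin.last m))]
  have (x : E) : postCov k σ (initPts p) (p (Fin.last m)) x = kernelVec k p x (Fin.last m) -
      kernelVec k (initPts p) (p (Fin.last m)) ⬝ᵥ
        ((regMatrix k σ (initPts p))⁻¹ *ᵥ kernelVec k (initPts p) x) := rfl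
  rw [← this, ← this] at h
  rw [postCov, ← regMatrix, h, postCov_eq_weights (initPts p) x x', weights]
  ring

lemma infoGain_eq (hσ : 0 < σ) (p : Fin m → E) :
    infoGain k σ p = (1 / 2) * Real.log (((σ ^ 2)⁻¹) ^ m * (regMatrix k σ p).det) := by
  have : (1 : Matrix (Fin m) (Fin m) ℝ) + (σ ^ 2)⁻¹ • kernelMatrix k p =
      (σ ^ 2)⁻¹ • regMatrix k σ p := by
    rw [regMatrix, smul_add, smul_smul, inv_mul_cancel₀ (by positivity), one_smul, add_comm]
  rw [infoGain, this, Matrix.det_smul, Fintype.card_fin]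

lemma infoGain_zero (p : Fin 0 → E) : infoGain k σ p = 0 := by
  simp [infoGain]

/-- The chain rule for the information gain. -/
lemma infoGain_succ (hk : ∀ x y, k x y = inner ℝ (Φ x) (Φ y)) (hσ : 0 < σ)
    (p : Fin (m + 1) → E) :
    infoGain k σ p = infoGain k σ (initPts p) + (1 / 2) *
      Real.log (1 + (σ ^ 2)⁻¹ *
        postSd k σ (initPts p) (p (Fin.last m)) ^ 2) := by
  have h0 := postCov_self_nonneg hk hσ (initPts p) (p (Fin.last m))
  have hdet := det_bordered (regMatrix_isUnit_det hk hσ p)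
    (regMatrix_isUnit_det hk hσ (initPts p)) (regMatrix_isSymm hk _)
    (κ := kernelVec k (initPts p) (p (Fin.last m)))
    (by intro i j; simp [regMatrix_apply, initPts])
    (by intro i; simp [regMatrix_apply, initPts, kernelVec, Fin.castSucc_ne_last])
    (by
      intro i
      simp [regMatrix_apply, initPts, kernelVec, (Fin.castSucc_ne_last _).symm, hk,
        real_inner_comm]) (regMatrix_schur p) (by positivity)
  have h1 := (regMatrix_isUnit_det hk hσ (initPts p)).ne_zero
  rw [infoGain_eq hσ, infoGain_eq hσ, hdet, postSd_sq hk hσ, ← mul_add, ← Real.log_mul]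
  · congr 2
    rw [pow_succ]
    field_simp
  · positivity
  · positivity

end PosteriorAlgebra

/-! ### Information gain and the size of posterior variances -/

section InformationGain

variable {E H : Type*} [NormedAddCommGroup H] [InnerProductSpace ℝ H]
  {k : E → E → ℝ} {Φ : E → H} {σ : ℝ}

/-- The standard deviation at the point `x n` after noisy observations at `x 0, …, x (n - 1)`. -/
noncomputable def predSd (k : E → E → ℝ) (σ : ℝ) (x : ℕ → E) (n : ℕ) : ℝ :=
  postSd k σ (fun i : Fin n => x i) (x n)

lemma predSd_nonneg (x : ℕ → E) (n : ℕ) : 0 ≤ predSd k σ x n := postSd_nonneg _ _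

lemma predSd_le_one (hk : ∀ x y, k x y = inner ℝ (Φ x) (Φ y)) (hσ : 0 < σ)
    (hk1 : ∀ x, k x x ≤ 1) (x : ℕ → E) (n : ℕ) : predSd k σ x n ≤ 1 :=
  postSd_le_one hk hσ hk1 _ _

lemma infoGain_nonneg (hk : ∀ x y, k x y = inner ℝ (Φ x) (Φ y)) (hσ : 0 < σ) :
    ∀ {m : ℕ} (p : Fin m → E), 0 ≤ infoGain k σ p
  | 0, p => (infoGain_zero p).ge
  | m + 1, p => by
    rw [infoGain_succ hk hσ]
    have h := infoGain_nonneg hk hσ (initPts p)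
    have : 0 ≤ Real.log (1 + (σ ^ 2)⁻¹ * postSd k σ (initPts p) (p (Fin.last m)) ^ 2) :=
      Real.log_nonneg (by have : 0 ≤ (σ ^ 2)⁻¹ * postSd k σ (initPts p) (p (Fin.last m)) ^ 2 := by
                            positivity
                          linarith)
    linarith

lemma infoGain_le (hk : ∀ x y, k x y = inner ℝ (Φ x) (Φ y)) (hσ : 0 < σ)
    (hk1 : ∀ x, k x x ≤ 1) :
    ∀ {m : ℕ} (p : Fin m → E), infoGain k σ p ≤ m * ((1 / 2) * Real.log (1 + (σ ^ 2)⁻¹))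
  | 0, p => by simp [infoGain_zero]
  | m + 1, p => by
    rw [infoGain_succ hk hσ]
    have h := infoGain_le hk hσ hk1 (initPts p)
    have h1 : postSd k σ (initPts p) (p (Fin.last m)) ^ 2 ≤ 1 :=
      pow_le_one₀ (postSd_nonneg _ _) (postSd_le_one hk hσ hk1 _ _)
    have h2 : Real.log (1 + (σ ^ 2)⁻¹ * postSd k σ (initPts p) (p (Fin.last m)) ^ 2) ≤
        Real.log (1 + (σ ^ 2)⁻¹) := by
      apply Real.log_le_log (by positivity)
      have := mul_le_mul_of_nonneg_left h1 (by positivity : 0 ≤ (σ ^ 2)⁻¹)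
      linarith
    push_cast
    linarith

lemma infoGain_eq_sum (hk : ∀ x y, k x y = inner ℝ (Φ x) (Φ y)) (hσ : 0 < σ) (x : ℕ → E) :
    ∀ T : ℕ, infoGain k σ (fun i : Fin T => x i) =
      ∑ n ∈ Finset.range T, (1 / 2) * Real.log (1 + (σ ^ 2)⁻¹ * predSd k σ x n ^ 2)
  | 0 => by simp [infoGain_zero]
  | T + 1 => by
    rw [infoGain_succ hk hσ, Finset.sum_range_succ, ← infoGain_eq_sum hk hσ x T]
    rfl

lemma log_one_add_inv_sq_pos (hσ : 0 < σ) : 0 < Real.log (1 + (σ ^ 2)⁻¹) :=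
  Real.log_pos (by have : 0 < (σ ^ 2)⁻¹ := by positivity
                   linarith)

lemma C₁_pos (hσ : 0 < σ) : 0 < C₁ σ := div_pos (by norm_num) (log_one_add_inv_sq_pos hσ)

/-- The squared predictive deviations are controlled by the information gain, since
`v log (1 + σ⁻²) ≤ log (1 + σ⁻² v)` for `0 ≤ v ≤ 1`. -/
lemma four_mul_sum_sq_predSd_le (hk : ∀ x y, k x y = inner ℝ (Φ x) (Φ y)) (hσ : 0 < σ)
    (hk1 : ∀ x, k x x ≤ 1) (x : ℕ → E) (T : ℕ) :
    4 * ∑ n ∈ Finset.range T, predSd k σ x n ^ 2 ≤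
      C₁ σ * infoGain k σ (fun i : Fin T => x i) := by
  have hl := log_one_add_inv_sq_pos hσ
  rw [infoGain_eq_sum hk hσ, Finset.mul_sum, Finset.mul_sum]
  refine Finset.sum_le_sum fun n _ => ?_
  have h0 := predSd_nonneg (k := k) (σ := σ) x n
  have h1 : predSd k σ x n ^ 2 ≤ 1 := pow_le_one₀ h0 (predSd_le_one hk hσ hk1 x n)
  have h2 : 0 ≤ (σ ^ 2)⁻¹ := by positivity
  have h3 := _root_.rpow_one_add_le_one_add_mul_self (by linarith : -1 ≤ (σ ^ 2)⁻¹)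
    (sq_nonneg (predSd k σ x n)) h1
  have h4 := Real.log_le_log (by positivity) h3
  rw [Real.log_rpow (by positivity), mul_comm (predSd k σ x n ^ 2) (σ ^ 2)⁻¹] at h4
  rw [C₁, div_mul_eq_mul_div, le_div_iff₀ hl]
  linarith

lemma sum_fin_ite_mem {M : Type*} [AddCommMonoid M] {n : ℕ} {B : Finset ℕ}
    (hB : ∀ i ∈ B, i < n) (g : ℕ → M) :
    ∑ i : Fin n, (if (i : ℕ) ∈ B then g i else 0) = ∑ i ∈ B, g i := by
  rw [Fin.sum_univ_eq_sum_range (fun i => if i ∈ B then g i else 0) n, ← Finset.sum_filter]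
  congr 1
  ext i
  simp only [Finset.mem_filter, Finset.mem_range]
  exact ⟨fun h => h.2, fun h => ⟨hB i h, h⟩⟩

/-- After `j` observations at points whose features are `ρ`-close to that of `x n`, the variance
at `x n` is at most `ρ² + σ² / j`. Hence in a cell of features of diameter `ρ ≤ ε / √2` only
boundedly many points can have a predictive deviation above `ε`. -/
lemma card_filter_lt_predSd_le_of_cells {ι : Type*} [Fintype ι]
    (hk : ∀ x y, k x y = inner ℝ (Φ x) (Φ y)) (hσ : 0 < σ) {ρ e : ℝ} (he : 0 < e)
    (hρe : ρ ^ 2 ≤ e ^ 2 / 2) (cell : E → ι)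
    (hcell : ∀ x y, cell x = cell y → ‖Φ x - Φ y‖ ≤ ρ) (x : ℕ → E) (T : ℕ) :
    ((Finset.range T).filter fun n => e < predSd k σ x n).card ≤
      (⌈2 * σ ^ 2 / e ^ 2⌉₊ + 1) * Fintype.card ι := by
  classical
  refine Finset.card_le_mul_card_image_of_maps_to (f := fun n => cell (x n))
    (t := Finset.univ) (fun _ _ => Finset.mem_univ _) _ fun c _ => ?_
  by_contra! hcard
  set B := ((Finset.range T).filter fun n => e < predSd k σ x n).filter
    fun n => cell (x n) = c with hB
  have hne : B.Nonempty := Finset.card_pos.1 (by omega)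
  set n := B.max' hne with hn
  have hnB : n ∈ B := B.max'_mem hne
  set B' := B.erase n with hB'
  have hcard' : ⌈2 * σ ^ 2 / e ^ 2⌉₊ + 1 ≤ B'.card := by
    rw [hB', Finset.card_erase_of_mem hnB]; omega
  have hlt : ∀ i ∈ B', i < n := fun i hi =>
    lt_of_le_of_ne (B.le_max' i (Finset.mem_of_mem_erase hi)) (Finset.ne_of_mem_erase hi)
  set j : ℝ := (B'.card : ℝ) with hj
  have hj1 : 2 * σ ^ 2 / e ^ 2 + 1 ≤ j := by
    have h1 := Nat.le_ceil (2 * σ ^ 2 / e ^ 2)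
    have h2 : ((⌈2 * σ ^ 2 / e ^ 2⌉₊ + 1 : ℕ) : ℝ) ≤ j := Nat.cast_le.2 hcard'
    push_cast at h2
    linarith
  have hj0 : 0 < j := by
    have : 0 ≤ 2 * σ ^ 2 / e ^ 2 := by positivity
    linarith
  -- the average of the earlier observations from the same cell as a linear predictor
  set v : Fin n → ℝ := fun i => if (i : ℕ) ∈ B' then j⁻¹ else 0 with hv
  have hvv : v ⬝ᵥ v = j⁻¹ := by
    have : v ⬝ᵥ v = ∑ i : Fin n, (if (i : ℕ) ∈ B' then j⁻¹ * j⁻¹ else 0) := by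
      refine Finset.sum_congr rfl fun i _ => ?_
      simp only [hv]
      split_ifs <;> simp
    rw [this, sum_fin_ite_mem hlt (fun _ => j⁻¹ * j⁻¹), Finset.sum_const, nsmul_eq_mul, ← hj]
    field_simp
  have hnorm : ‖Φ (x n) - ∑ i : Fin n, v i • Φ (x i)‖ ≤ ρ := by
    have h1 : ∑ i : Fin n, v i • Φ (x i) = ∑ i ∈ B', j⁻¹ • Φ (x i) := by
      rw [← sum_fin_ite_mem hlt]
      refine Finset.sum_congr rfl fun i _ => ?_
      simp only [hv]
      split_ifs <;> simp
    have h2 : Φ (x n) = ∑ i ∈ B', j⁻¹ • Φ (x n) := by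
      rw [Finset.sum_const, ← Nat.cast_smul_eq_nsmul ℝ, smul_smul, ← hj,
        mul_inv_cancel₀ hj0.ne', one_smul]
    rw [h1]
    nth_rewrite 1 [h2]
    rw [← Finset.sum_sub_distrib]
    calc ‖∑ i ∈ B', (j⁻¹ • Φ (x n) - j⁻¹ • Φ (x i))‖
        ≤ ∑ i ∈ B', ‖j⁻¹ • Φ (x n) - j⁻¹ • Φ (x i)‖ := norm_sum_le _ _
      _ ≤ ∑ i ∈ B', j⁻¹ * ρ := by
          refine Finset.sum_le_sum fun i hi => ?_
          rw [← smul_sub, norm_smul, Real.norm_of_nonneg (by positivity)]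
          refine mul_le_mul_of_nonneg_left (hcell _ _ ?_) (by positivity)
          rw [(Finset.mem_filter.1 hnB).2,
            (Finset.mem_filter.1 (Finset.mem_of_mem_erase hi)).2]
      _ = ρ := by
          rw [Finset.sum_const, nsmul_eq_mul, ← hj]
          field_simp
  have hle := postCov_self_le hk hσ (fun i : Fin n => x i) (x n) v
  rw [hvv, ← postSd_sq hk hσ] at hle
  have hgt : e < predSd k σ x n :=
    (Finset.mem_filter.1 (Finset.mem_filter.1 hnB).1).2
  have h1 : e ^ 2 < predSd k σ x n ^ 2 := by gcongr
  have h2 : ‖Φ (x n) - ∑ i : Fin n, v i • Φ (x i)‖ ^ 2 ≤ ρ ^ 2 := by gcongr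
  have h3 : σ ^ 2 * j⁻¹ ≤ e ^ 2 / 2 := by
    rw [← div_eq_mul_inv, div_le_iff₀ hj0]
    have : 2 * σ ^ 2 / e ^ 2 * e ^ 2 = 2 * σ ^ 2 := by field_simp
    nlinarith [sq_pos_of_pos he]
  rw [predSd] at h1
  linarith

/-- If the features form a relatively compact set, then the number of steps with a predictive
deviation above a given level is bounded, uniformly over all sequences of points. -/
lemma exists_card_filter_lt_predSd_le (hk : ∀ x y, k x y = inner ℝ (Φ x) (Φ y)) (hσ : 0 < σ)
    (hΦ : TotallyBounded (Set.range Φ)) {e : ℝ} (he : 0 < e) :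
    ∃ N : ℕ, ∀ (x : ℕ → E) (T : ℕ),
      ((Finset.range T).filter fun n => e < predSd k σ x n).card ≤ N := by
  obtain ⟨t, htf, ht⟩ := Metric.totallyBounded_iff.1 hΦ (e / 4) (by positivity)
  have hex : ∀ x : E, ∃ c : t, dist (Φ x) c < e / 4 := fun x => by
    have := ht (Set.mem_range_self x)
    simp only [Set.mem_iUnion, Metric.mem_ball] at this
    obtain ⟨c, hc, h⟩ := this
    exact ⟨⟨c, hc⟩, h⟩
  choose cell hcell using hex
  have := htf.fintype
  refine ⟨_, card_filter_lt_predSd_le_of_cells hk hσ he (ρ := e / 2)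
    (by nlinarith [sq_nonneg e]) cell fun x y hxy => ?_⟩
  have h1 := hcell x
  have h2 := hcell y
  rw [← hxy] at h2
  rw [← dist_eq_norm]
  have := dist_triangle_right (Φ x) (Φ y) (cell x)
  linarith

end InformationGain

section MaxInformationGain

variable {F H : Type*} [NormedAddCommGroup H] [InnerProductSpace ℝ H] {D : Set F}
  {k : F → F → ℝ} {Φ : D → H} {σ : ℝ}

lemma infoGain_le_maxInfoGain (hk : ∀ x y : D, k x y = inner ℝ (Φ x) (Φ y)) (hσ : 0 < σ)
    (hk1 : ∀ x : D, k x x ≤ 1) {T : ℕ} (p : Fin T → D) :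
    infoGain (fun x y : D => k x y) σ p ≤ maxInfoGain k σ D T :=
  le_ciSup (f := fun p : Fin T → D => infoGain k σ (fun i => (p i : F)))
    ⟨_, Set.forall_mem_range.2 fun p =>
      infoGain_le (k := fun x y : D => k x y) hk hσ hk1 p⟩ p

lemma maxInfoGain_nonneg (hk : ∀ x y : D, k x y = inner ℝ (Φ x) (Φ y)) (hσ : 0 < σ) (T : ℕ) :
    0 ≤ maxInfoGain k σ D T :=
  Real.iSup_nonneg fun p => infoGain_nonneg (k := fun x y : D => k x y) hk hσ p

end MaxInformationGain

/-! ### Translation of Gaussian variables -/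

section CameronMartin

open scoped ENNReal NNReal

lemma lintegral_gaussianReal_add (v : ℝ≥0) (hv : v ≠ 0) (c : ℝ) {g : ℝ → ℝ≥0∞}
    (hg : Measurable g) :
    ∫⁻ x, g (c + x) ∂gaussianReal 0 v =
      ∫⁻ x, ENNReal.ofReal (Real.exp ((c * x - c ^ 2 / 2) / v)) * g x ∂gaussianReal 0 v := by
  have hv' : (0 : ℝ) < v := by exact_mod_cast pos_iff_ne_zero.2 hv
  rw [gaussianReal_of_var_ne_zero _ hv,
    lintegral_withDensity_eq_lintegral_mul _ (measurable_gaussianPDF _ _) (by fun_prop),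
    lintegral_withDensity_eq_lintegral_mul _ (measurable_gaussianPDF _ _) (by fun_prop),
    ← lintegral_add_left_eq_self (fun x => (gaussianPDF 0 v * fun x =>
      ENNReal.ofReal (Real.exp ((c * x - c ^ 2 / 2) / v)) * g x) x) c]
  refine lintegral_congr fun x => ?_
  simp only [Pi.mul_apply, gaussianPDF, gaussianPDFReal]
  rw [← mul_assoc, ← ENNReal.ofReal_mul (by positivity),
    mul_assoc _ (Real.exp _) (Real.exp _), ← Real.exp_add]
  congr 4
  field_simp
  ring

variable {Ω : Type*} [MeasurableSpace Ω] {P : Measure Ω} {m : ℕ}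

/-- The Cameron-Martin formula for a finite Gaussian vector: weighting with `exp L`, for a centred
`L` jointly Gaussian with `Y`, translates `Y` by its covariance with `L`. -/
lemma lintegral_exp_mul_comp_gaussian [IsProbabilityMeasure P] {L : Ω → ℝ} {Y : Fin m → Ω → ℝ}
    (hLm : Measurable L) (hYm : ∀ i, Measurable (Y i))
    (hLY : HasGaussianLaw (fun ω => (L ω, fun i => Y i ω)) P) (hL : ∫ ω, L ω ∂P = 0)
    {G : (Fin m → ℝ) → ℝ≥0∞} (hG : Measurable G) :
    ∫⁻ ω, ENNReal.ofReal (Real.exp (L ω)) * G (fun i => Y i ω) ∂P =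
      ENNReal.ofReal (Real.exp (cov[L, L; P] / 2)) *
        ∫⁻ ω, G (fun i => Y i ω + cov[L, Y i; P]) ∂P := by
  have hL2 : MemLp L 2 P := hLY.fst.memLp_two
  have hY2 : ∀ i, MemLp (Y i) 2 P := fun i => (hLY.snd.eval i).memLp_two
  have hvar : cov[L, L; P] = Var[L; P] := covariance_self hL2.aemeasurable
  have hv0 : 0 ≤ cov[L, L; P] := hvar ▸ variance_nonneg L P
  set v := cov[L, L; P] with hv
  rcases hv0.eq_or_lt with h0 | hvpos
  · have hL0 : L =ᵐ[P] 0 := by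
      have := ae_eq_integral_of_variance_eq_zero hL2 (hvar.symm.trans h0.symm)
      rw [hL] at this
      exact this
    have hc : ∀ i, cov[L, Y i; P] = 0 := fun i => by
      rw [covariance, hL]
      refine integral_eq_zero_of_ae ?_
      filter_upwards [hL0] with ω h
      simp [h]
    rw [← h0]
    simp only [hc]
    simp
    refine lintegral_congr_ae ?_
    filter_upwards [hL0] with ω h
    simp [h]
  · set c : Fin m → ℝ := fun i => cov[L, Y i; P] / v with hc
    have hlaw : P.map L = gaussianReal 0 v.toNNReal := by
      rw [hLY.fst.map_eq_gaussianReal, hL, ← hvar]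
    have hR : HasGaussianLaw (fun ω => (fun _ : Unit => L ω, fun i => Y i ω - c i * L ω)) P := by
      let K : ℝ × (Fin m → ℝ) →L[ℝ] (Unit → ℝ) × (Fin m → ℝ) :=
        (ContinuousLinearMap.pi fun _ => ContinuousLinearMap.fst ℝ ℝ (Fin m → ℝ)).prod
          (ContinuousLinearMap.pi fun i =>
            (ContinuousLinearMap.proj i).comp (ContinuousLinearMap.snd ℝ ℝ (Fin m → ℝ)) -
              c i • ContinuousLinearMap.fst ℝ ℝ (Fin m → ℝ))
      exact hLY.map_fun K
    have hind := hR.indepFun_of_covariance_eval (X := fun _ : Unit => L)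
      (Y := fun i ω => Y i ω - c i * L ω) (by
        intro _ i
        rw [covariance_fun_sub_right hL2 (hY2 i) (hL2.const_mul _), covariance_const_mul_right,
          ← hv, hc]
        field_simp
        ring)
    have hind' : IndepFun L (fun ω i => Y i ω - c i * L ω) P :=
      hind.comp (φ := fun f : Unit → ℝ => f ()) (measurable_pi_apply _) measurable_id
    have hmR : Measurable (fun ω i => Y i ω - c i * L ω) :=
      measurable_pi_lambda _ fun i => (hYm i).sub (hLm.const_mul _)
    have hprod := (indepFun_iff_map_prod_eq_prod_map_map hLm.aemeasurable hmR.aemeasurable).1 hind'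
    have key : ∀ F : ℝ × (Fin m → ℝ) → ℝ≥0∞, Measurable F →
        ∫⁻ ω, F (L ω, fun i => Y i ω - c i * L ω) ∂P =
          ∫⁻ r, ∫⁻ l, F (l, r) ∂gaussianReal 0 v.toNNReal
            ∂(P.map fun ω i => Y i ω - c i * L ω) := by
      intro F hF
      rw [← lintegral_map hF (hLm.prodMk hmR), hprod, hlaw]
      have : IsProbabilityMeasure (P.map fun ω i => Y i ω - c i * L ω) :=
        Measure.isProbabilityMeasure_map hmR.aemeasurable
      rw [lintegral_prod_symm' _ hF]
    have h1 := key (fun q => ENNReal.ofReal (Real.exp q.1) * G (fun i => q.2 i + c i * q.1))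
      (by fun_prop)
    have h2 := key (fun q => G (fun i => q.2 i + c i * q.1 + cov[L, Y i; P])) (by fun_prop)
    simp only [sub_add_cancel] at h1 h2
    rw [h1, h2, ← lintegral_const_mul _ ?_]
    · refine lintegral_congr fun r => ?_
      have hvn : v.toNNReal ≠ 0 := by simpa using hvpos
      have h3 := lintegral_gaussianReal_add v.toNNReal hvn v
        (g := fun l => G (fun i => r i + c i * l)) (by fun_prop)
      have h4 : ∀ l, (fun i => r i + c i * l + cov[L, Y i; P]) =
          fun i => r i + c i * (v + l) := fun l => by
        funext i
        simp only [hc]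
        field_simp
        ring
      simp only [h4]
      rw [h3, ← lintegral_const_mul _ (by fun_prop)]
      refine lintegral_congr fun l => ?_
      rw [← mul_assoc, ← ENNReal.ofReal_mul (Real.exp_pos _).le, ← Real.exp_add,
        Real.coe_toNNReal _ hvpos.le]
      congr 4
      field_simp
      ring
    · exact Measurable.lintegral_prod_left' (f := fun q : ℝ × (Fin m → ℝ) =>
        G (fun i => q.2 i + c i * q.1 + cov[L, Y i; P])) (by fun_prop)

end CameronMartin

/-! ### The posterior for a fixed design -/

section FixedDesign

open scoped ENNReal

variable {Ω E H : Type*} [MeasurableSpace Ω] {P : Measure Ω} [IsProbabilityMeasure P]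
  [NormedAddCommGroup H] [InnerProductSpace ℝ H]
  {k : E → E → ℝ} {Φ : E → H} {σ : ℝ} {m : ℕ} {Z : E → Ω → ℝ}

/-- The density of the observations `y` of the values `u` with respect to the law of the pure
noise `N(0, σ²)`. -/
noncomputable def likelihood (σ : ℝ) (u y : Fin m → ℝ) : ℝ :=
  ∏ i, Real.exp ((u i * y i - u i ^ 2 / 2) / σ ^ 2)

lemma likelihood_eq_exp (u y : Fin m → ℝ) :
    likelihood σ u y = Real.exp (∑ i, (u i * y i - u i ^ 2 / 2) / σ ^ 2) :=
  (Real.exp_sum _ _).symm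

lemma covariance_residual (hZ : IsGaussianProcess Z P) (hcov : ∀ x y, cov[Z x, Z y; P] = k x y)
    (p : Fin m → E) (w : Fin m → ℝ) (lam : ℝ) (x z : E) :
    cov[fun ω => lam * (Z x ω - ∑ i, w i * Z (p i) ω), Z z; P] =
      lam * (k x z - ∑ i, w i * k (p i) z) := by
  have h2 : ∀ x, MemLp (Z x) 2 P := fun x => (hZ.hasGaussianLaw_eval x).memLp_two
  have hs : MemLp (fun ω => ∑ i, w i * Z (p i) ω) 2 P :=
    memLp_finsetSum _ fun i _ => (h2 (p i)).const_mul _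
  rw [covariance_const_mul_left, covariance_fun_sub_left (h2 x) hs (h2 z),
    covariance_fun_sum_left (fun i => (h2 (p i)).const_mul _) (h2 z), hcov]
  simp only [covariance_const_mul_left, hcov]

/-- Bayes' formula for a fixed design, tested against exponentials: under the density
`likelihood`, the value `Z x` has the Laplace transform of a normal variable with the posterior
mean and variance. -/
lemma lintegral_exp_mul_likelihood (hk : ∀ x y, k x y = inner ℝ (Φ x) (Φ y)) (hσ : 0 < σ)
    (hZm : ∀ x, Measurable (Z x)) (hZ : IsGaussianProcess Z P) (hmean : ∀ x, ∫ ω, Z x ω ∂P = 0)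
    (hcov : ∀ x y, cov[Z x, Z y; P] = k x y) (p : Fin m → E) (y : Fin m → ℝ) (x : E) (lam : ℝ) :
    ∫⁻ ω, ENNReal.ofReal (Real.exp (lam * (Z x ω - postMean k σ p y x) -
        lam ^ 2 * postCov k σ p x x / 2)) *
        ENNReal.ofReal (likelihood σ (fun i => Z (p i) ω) y) ∂P =
      ∫⁻ ω, ENNReal.ofReal (likelihood σ (fun i => Z (p i) ω) y) ∂P := by
  set w := weights k σ p x with hw
  set L : Ω → ℝ := fun ω => lam * (Z x ω - ∑ i, w i * Z (p i) ω) with hL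
  have hint : ∀ x, Integrable (Z x) P := fun x => (hZ.hasGaussianLaw_eval x).integrable
  have hL0 : ∫ ω, L ω ∂P = 0 := by
    rw [hL, integral_const_mul, integral_sub (hint x)
      (integrable_finsetSum _ fun i _ => (hint (p i)).const_mul _),
      integral_finsetSum _ fun i _ => (hint (p i)).const_mul _]
    simp [integral_const_mul, hmean]
  have hLm : Measurable L := by
    refine ((hZm x).sub (Finset.measurable_sum _ fun i _ => ?_)).const_mul _
    exact (hZm (p i)).const_mul _
  have hcovL : ∀ i, cov[L, Z (p i); P] = lam * σ ^ 2 * w i := fun i => by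
    rw [covariance_residual hZ hcov]
    have h := congrFun (regMatrix_mulVec_weights hk hσ p x) i
    simp only [regMatrix, Matrix.add_mulVec, Matrix.smul_mulVec, Matrix.one_mulVec, Pi.add_apply,
      Pi.smul_apply, smul_eq_mul, kernelVec, ← hw] at h
    have h1 : (kernelMatrix k p *ᵥ w) i = ∑ j, w j * k (p j) (p i) :=
by
      rw [Matrix.mulVec, dotProduct]
      exact Finset.sum_congr rfl fun j _ => by simp [kernelMatrix, hk, real_inner_comm, mul_comm]
    have h2 : k x (p i) = k (p i) x := by rw [hk, hk, real_inner_comm]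
    rw [h2, ← h, h1]
    ring
  have hvarL : cov[L, L; P] = lam ^ 2 * (postCov k σ p x x - σ ^ 2 * ∑ i, w i ^ 2) := by
    have h2 : ∀ x, MemLp (Z x) 2 P := fun x => (hZ.hasGaussianLaw_eval x).memLp_two
    have hs : MemLp (fun ω => ∑ i, w i * Z (p i) ω) 2 P :=
      memLp_finsetSum _ fun i _ => (h2 (p i)).const_mul _
    have hL2 : MemLp L 2 P := ((h2 x).sub hs).const_mul _
    have h1 : cov[L, L; P] = lam * (cov[L, Z x; P] - ∑ i, w i * cov[L, Z (p i); P]) := by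
      conv_lhs => rw [hL, covariance_const_mul_right]
      rw [covariance_fun_sub_right hL2 (h2 x) hs,
        covariance_fun_sum_right (fun i => (h2 (p i)).const_mul _) hL2]
      simp only [covariance_const_mul_right]
    rw [h1]
    simp only [hcovL]
    rw [covariance_residual hZ hcov, postCov_eq_weights, ← hw, Finset.mul_sum]
    have h3 : kernelVec k p x ⬝ᵥ w = ∑ i, w i * k (p i) x :=
      Finset.sum_congr rfl fun i _ => by simp [kernelVec, mul_comm]
    have h4 : ∑ i, w i * (lam * σ ^ 2 * w i) = lam * ∑ i, σ ^ 2 * w i ^ 2 := by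
      rw [Finset.mul_sum]
      exact Finset.sum_congr rfl fun i _ => by ring
    rw [h3, h4]
    ring
  have hjoint : HasGaussianLaw (fun ω => (L ω, fun i => Z (p i) ω)) P := by
    classical
    let q : Option (Fin m) → E := fun o => o.elim x p
    let I : Finset (Option (Fin m)) := Finset.univ
    have h1 := (hZ.comp_right q).hasGaussianLaw I
    let c : Option (Fin m) → (I → ℝ) →L[ℝ] ℝ := fun o =>
      ContinuousLinearMap.proj (R := ℝ) (φ := fun _ => ℝ) ⟨o, Finset.mem_univ o⟩
    let K : (I → ℝ) →L[ℝ] ℝ × (Fin m → ℝ) :=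
      (lam • (c none - ∑ i, w i • c (some i))).prod
        (ContinuousLinearMap.pi fun i => c (some i))
    have h2 := h1.map_fun K
    have h3 : (fun ω => K (I.restrict fun o => (Z ∘ q) o ω)) =
        fun ω => (L ω, fun i => Z (p i) ω) := by
      funext ω
      simp [K, c, q, hL]
    rwa [h3] at h2
  set G : (Fin m → ℝ) → ℝ≥0∞ := fun u => ENNReal.ofReal (Real.exp (lam * ∑ i, w i * u i -
    lam * ∑ i, w i * y i - lam ^ 2 * postCov k σ p x x / 2 +
    ∑ i, (u i * y i - u i ^ 2 / 2) / σ ^ 2)) with hG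
  have hGm : Measurable G := by fun_prop
  have hμ : postMean k σ p y x = ∑ i, w i * y i := postMean_eq_weights hk p y x
  have h1 := lintegral_exp_mul_comp_gaussian hLm (fun i => hZm (p i)) hjoint hL0 hGm
  calc _ = ∫⁻ ω, ENNReal.ofReal (Real.exp (L ω)) * G (fun i => Z (p i) ω) ∂P := by
        refine lintegral_congr fun ω => ?_
        rw [hG, ← ENNReal.ofReal_mul (Real.exp_pos _).le, ← ENNReal.ofReal_mul (Real.exp_pos _).le,
          likelihood_eq_exp, ← Real.exp_add, ← Real.exp_add, hμ, hL]
        congr 2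
        ring
    _ = _ := h1
    _ = _ := by
        rw [← lintegral_const_mul _ (by fun_prop)]
        refine lintegral_congr fun ω => ?_
        rw [hG, ← ENNReal.ofReal_mul (Real.exp_pos _).le, likelihood_eq_exp, ← Real.exp_add]
        congr 2
        have h2 : ∀ i, ((Z (p i) ω + cov[L, Z (p i); P]) * y i -
            (Z (p i) ω + cov[L, Z (p i); P]) ^ 2 / 2) / σ ^ 2 =
            (Z (p i) ω * y i - Z (p i) ω ^ 2 / 2) / σ ^ 2 + lam * (w i * y i) -
              lam * (w i * Z (p i) ω) - lam ^ 2 * σ ^ 2 / 2 * w i ^ 2 := fun i => by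
          rw [hcovL]
          field_simp
          ring
        have h3 : ∀ i, w i * (Z (p i) ω + cov[L, Z (p i); P]) =
            w i * Z (p i) ω + lam * σ ^ 2 * w i ^ 2 := fun i => by
          rw [hcovL]
          ring
        simp only [h2, h3]
        rw [hvarL]
        simp only [Finset.sum_add_distrib, Finset.sum_sub_distrib, ← Finset.mul_sum]
        ring

end FixedDesign

/-! ### Sequential observations with Gaussian noise -/

section Sequential

open scoped ENNReal NNReal

/-- The entries of `v` before the `i`-th one. -/
def past {m : ℕ} (v : Fin m → ℝ) (i : Fin m) : Fin i → ℝ := fun j => v ⟨j, j.2.trans i.2⟩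

/-- The first `m` observations as a function of the noise, if the `n`-th noiseless value `g n` is
a function of the earlier observations. -/
def response (g : ∀ n : ℕ, (Fin n → ℝ) → ℝ) : ∀ m : ℕ, (Fin m → ℝ) → Fin m → ℝ
  | 0, _ => Fin.elim0
  | m + 1, e => Fin.snoc (α := fun _ => ℝ) (response g m fun i => e i.castSucc)
      (g m (response g m fun i => e i.castSucc) + e (Fin.last m))

lemma measurable_snoc {m : ℕ} :
    Measurable fun q : (Fin m → ℝ) × ℝ => (Fin.snoc q.1 q.2 : Fin (m + 1) → ℝ) := by
  refine measurable_pi_lambda _ fun i => ?_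
  refine Fin.lastCases ?_ (fun i => ?_) i
  · simpa using measurable_snd
  · simp only [Fin.snoc_castSucc]
    exact (measurable_pi_apply i).comp measurable_fst

lemma measurable_past {m : ℕ} (i : Fin m) : Measurable fun v : Fin m → ℝ => past v i :=
  measurable_pi_lambda _ fun _ => measurable_pi_apply _

lemma measurable_likelihood {α : Type*} [MeasurableSpace α] {σ : ℝ} {m : ℕ}
    {u y : α → Fin m → ℝ} (hu : ∀ i, Measurable fun a => u a i)
    (hy : ∀ i, Measurable fun a => y a i) : Measurable fun a => likelihood σ (u a) (y a) :=
  Finset.measurable_fun_prod _ fun i _ => by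
    have h1 := hu i
    have h2 := hy i
    fun_prop

lemma measurable_response {S : Type*} [MeasurableSpace S] {g : S → ∀ n : ℕ, (Fin n → ℝ) → ℝ}
    (hg : ∀ n, Measurable fun q : S × (Fin n → ℝ) => g q.1 n q.2) :
    ∀ m : ℕ, Measurable fun q : S × (Fin m → ℝ) => response (g q.1) m q.2
  | 0 => measurable_pi_lambda _ fun i => i.elim0
  | m + 1 => by
    have h1 : Measurable fun q : S × (Fin (m + 1) → ℝ) =>
        response (g q.1) m fun i => q.2 i.castSucc :=
      (measurable_response hg m).comp (measurable_fst.prodMk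
        (measurable_pi_lambda _ fun i => (measurable_pi_apply _).comp measurable_snd))
    have h2 : Measurable fun q : S × (Fin (m + 1) → ℝ) =>
        g q.1 m (response (g q.1) m fun i => q.2 i.castSucc) + q.2 (Fin.last m) :=
      ((hg m).comp (measurable_fst.prodMk h1)).add
        ((measurable_pi_apply _).comp measurable_snd)
    exact measurable_snoc.comp (h1.prodMk h2)

lemma lintegral_pi_fin_succ (μ : Measure ℝ) [SigmaFinite μ] {m : ℕ}
    {F : (Fin (m + 1) → ℝ) → ℝ≥0∞} (hF : Measurable F) :
    ∫⁻ e, F e ∂Measure.pi (fun _ : Fin (m + 1) => μ) =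
      ∫⁻ e, ∫⁻ t, F (Fin.snoc e t) ∂μ ∂Measure.pi (fun _ : Fin m => μ) := by
  have h := (measurePreserving_piFinSuccAbove (fun _ : Fin (m + 1) => μ) (Fin.last m)).symm
  rw [← h.lintegral_comp hF, lintegral_prod_symm' (fun q : ℝ × (Fin m → ℝ) =>
    F ((MeasurableEquiv.piFinSuccAbove (fun _ => ℝ) (Fin.last m)).symm q))
    (hF.comp (MeasurableEquiv.measurable _))]
  simp [MeasurableEquiv.piFinSuccAbove, Fin.snocEquiv]

/-- Girsanov's formula: the observations are absolutely continuous with respect to the noise, and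
the density is the likelihood. -/
lemma lintegral_comp_response {σ : ℝ} (hσ : 0 < σ) {g : ∀ n : ℕ, (Fin n → ℝ) → ℝ}
    (hg : ∀ n, Measurable (g n)) :
    ∀ {m : ℕ} {F : (Fin m → ℝ) → ℝ≥0∞}, Measurable F →
      ∫⁻ e, F (response g m e)
        ∂Measure.pi (fun _ : Fin m => gaussianReal 0 (σ ^ 2).toNNReal) =
      ∫⁻ v, F v * ENNReal.ofReal (likelihood σ (fun i => g i (past v i)) v)
        ∂Measure.pi (fun _ : Fin m => gaussianReal 0 (σ ^ 2).toNNReal)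
  | 0, F, hF => by
    refine lintegral_congr fun v => ?_
    simp [likelihood, Subsingleton.elim (response g 0 v) v]
  | m + 1, F, hF => by
    have hv : (σ ^ 2).toNNReal ≠ 0 := by simpa using hσ.ne'
    have hres : Measurable (response g m) :=
      (measurable_response (S := Unit) (g := fun _ => g)
        (fun n => (hg n).comp measurable_snd) m).comp
        (measurable_const.prodMk measurable_id : Measurable fun e : Fin m → ℝ => ((), e))
    have hres' : Measurable (response g (m + 1)) :=
      (measurable_response (S := Unit) (g := fun _ => g)
        (fun n => (hg n).comp measurable_snd) (m + 1)).comp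
        (measurable_const.prodMk measurable_id : Measurable fun e : Fin (m + 1) → ℝ => ((), e))
    have hlik : ∀ n, Measurable fun v : Fin n → ℝ =>
        ENNReal.ofReal (likelihood σ (fun i => g i (past v i)) v) := fun n => by
      exact ENNReal.measurable_ofReal.comp (measurable_likelihood
        (fun i => (hg i).comp (measurable_past i)) fun i => measurable_pi_apply i)
    have hFs : Measurable fun q : (Fin m → ℝ) × ℝ => F (Fin.snoc q.1 q.2) :=
      hF.comp measurable_snoc
    have hgm := hg m
    set F' : (Fin m → ℝ) → ℝ≥0∞ := fun v => ∫⁻ t, F (Fin.snoc v t) *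
      ENNReal.ofReal (Real.exp ((g m v * t - g m v ^ 2 / 2) / σ ^ 2))
        ∂gaussianReal 0 (σ ^ 2).toNNReal with hF'
    have hF'm : Measurable F' := by
      refine Measurable.lintegral_prod_right' (f := fun q : (Fin m → ℝ) × ℝ =>
        F (Fin.snoc q.1 q.2) *
          ENNReal.ofReal (Real.exp ((g m q.1 * q.2 - g m q.1 ^ 2 / 2) / σ ^ 2))) ?_
      fun_prop
    rw [lintegral_pi_fin_succ _ (F := fun e => F (response g (m + 1) e)) (hF.comp hres'),
      lintegral_pi_fin_succ _ (F := fun v => F v * ENNReal.ofReal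
        (likelihood σ (fun i => g i (past v i)) v)) (hF.mul (hlik _))]
    calc _ = ∫⁻ e, F' (response g m e)
          ∂Measure.pi (fun _ : Fin m => gaussianReal 0 (σ ^ 2).toNNReal) := by
          refine lintegral_congr fun e => ?_
          have h1 : ∀ t, F (response g (m + 1) (Fin.snoc e t)) =
              F (Fin.snoc (response g m e) (g m (response g m e) + t)) := fun t => by
            simp [response]
          simp only [h1]
          have h2 := lintegral_gaussianReal_add (σ ^ 2).toNNReal hv (g m (response g m e))
            (g := fun t => F (Fin.snoc (response g m e) t))
            (hFs.comp (measurable_const.prodMk measurable_id))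
          rw [h2, hF']
          refine lintegral_congr fun t => ?_
          rw [mul_comm, Real.coe_toNNReal _ (sq_nonneg σ)]
      _ = _ := lintegral_comp_response hσ hg hF'm
      _ = _ := by
          refine lintegral_congr fun v => ?_
          rw [hF', ← lintegral_mul_const _ ?_]
          · refine lintegral_congr fun t => ?_
            have h1 : likelihood σ (fun i : Fin (m + 1) =>
                g i (past (Fin.snoc v t : Fin (m + 1) → ℝ) i)) (Fin.snoc v t) =
                Real.exp ((g m v * t - g m v ^ 2 / 2) / σ ^ 2) *
                likelihood σ (fun i => g i (past v i)) v := by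
              have h2 : past (Fin.snoc v t : Fin (m + 1) → ℝ) (Fin.last m) = v := by
                funext j
                exact Fin.snoc_castSucc (α := fun _ => ℝ) t v j
              have h3 : ∀ i : Fin m,
                  past (Fin.snoc v t : Fin (m + 1) → ℝ) i.castSucc = past v i := fun i => by
                funext j
                exact Fin.snoc_castSucc (α := fun _ => ℝ) t v ⟨j, j.2.trans i.2⟩
              simp only [likelihood, Fin.prod_univ_castSucc, Fin.snoc_castSucc, Fin.snoc_last]
              rw [mul_comm]
              congr 1
              · simp only [Fin.val_last, h2]
              · refine Finset.prod_congr rfl fun i _ => ?_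
                have := h3 i
                simp only [Fin.val_castSucc, this]
            rw [h1, ENNReal.ofReal_mul (Real.exp_pos _).le, mul_assoc]
          · have : Measurable fun t : ℝ => F (Fin.snoc v t) :=
              hFs.comp (measurable_const.prodMk measurable_id)
            fun_prop

end Sequential

/-! ### Measurability of the posterior -/

section PosteriorMeasurability

variable {α E : Type*} [MeasurableSpace α] [MeasurableSpace E] {k : E → E → ℝ} {σ : ℝ} {m : ℕ}

lemma measurable_det {A : α → Matrix (Fin m) (Fin m) ℝ} (hA : ∀ i j, Measurable fun a => A a i j) :
    Measurable fun a => (A a).det := by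
  simp only [Matrix.det_apply]
  exact Finset.measurable_fun_sum _ fun s _ =>
    (Finset.measurable_fun_prod _ fun i _ => hA _ _).const_smul _

lemma measurable_matrix_inv {A : α → Matrix (Fin m) (Fin m) ℝ}
    (hA : ∀ i j, Measurable fun a => A a i j) (i j : Fin m) :
    Measurable fun a => (A a)⁻¹ i j := by
  have h : ∀ a, (A a)⁻¹ i j = (A a).det⁻¹ * ((A a).updateRow j (Pi.single i 1)).det := fun a => by
    rw [Matrix.inv_def, Matrix.smul_apply, smul_eq_mul, Ring.inverse_eq_inv', Matrix.adjugate_apply]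
  simp only [h]
  refine (measurable_det hA).inv.mul (measurable_det fun i' j' => ?_)
  by_cases hi : i' = j
  · subst hi
    simp
  · simpa [Matrix.updateRow_ne hi] using hA i' j'

lemma measurable_dotProduct_inv_regMatrix (hk : Measurable (Function.uncurry k))
    {p : α → Fin m → E} (hp : ∀ i, Measurable fun a => p a i) {f g : α → Fin m → ℝ}
    (hf : ∀ i, Measurable fun a => f a i) (hg : ∀ i, Measurable fun a => g a i) :
    Measurable fun a => f a ⬝ᵥ ((regMatrix k σ (p a))⁻¹ *ᵥ g a) := by
  simp only [dotProduct, Matrix.mulVec]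
  refine Finset.measurable_fun_sum _ fun i _ => (hf i).mul
    (Finset.measurable_fun_sum _ fun j _ => (measurable_matrix_inv (fun i j => ?_) i j).mul (hg j))
  simp only [regMatrix_apply]
  exact (hk.comp ((hp i).prodMk (hp j))).add measurable_const

lemma measurable_postMean (hk : Measurable (Function.uncurry k)) {p : α → Fin m → E}
    (hp : ∀ i, Measurable fun a => p a i) {y : α → Fin m → ℝ} (hy : ∀ i, Measurable fun a => y a i)
    {x : α → E} (hx : Measurable x) : Measurable fun a => postMean k σ (p a) (y a) (x a) :=
  measurable_dotProduct_inv_regMatrix hk hp (fun i => hk.comp ((hp i).prodMk hx)) hy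

lemma measurable_postCov (hk : Measurable (Function.uncurry k)) {p : α → Fin m → E}
    (hp : ∀ i, Measurable fun a => p a i) {x x' : α → E} (hx : Measurable x)
    (hx' : Measurable x') : Measurable fun a => postCov k σ (p a) (x a) (x' a) :=
  (hk.comp (hx.prodMk hx')).sub (measurable_dotProduct_inv_regMatrix hk hp
    (fun i => hk.comp ((hp i).prodMk hx)) fun i => hk.comp ((hp i).prodMk hx'))

lemma measurable_postSd (hk : Measurable (Function.uncurry k)) {p : α → Fin m → E}
    (hp : ∀ i, Measurable fun a => p a i) {x : α → E} (hx : Measurable x) :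
    Measurable fun a => postSd k σ (p a) (x a) :=
  (measurable_postCov hk hp hx hx).sqrt

end PosteriorMeasurability

/-! ### The posterior for an adaptive design -/

section AdaptiveDesign

open scoped ENNReal NNReal

variable {Ω S E H : Type*} [MeasurableSpace Ω] [MeasurableSpace S] [MeasurableSpace E]
  {P : Measure Ω} [NormedAddCommGroup H] [InnerProductSpace ℝ H]
  {k : E → E → ℝ} {Φ : E → H} {σ : ℝ}

/-- Sequential noisy observations of a random function. The random function is `u (A ω)` for a
random element `A` of some measurable space; the `n`-th observation `y n` is taken at the point
`x n`, which is a measurable function `ξ n` of the earlier observations; the noise variables are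
independent of `A` and i.i.d. `N(0, σ²)`. -/
structure IsAdaptiveDesign (P : Measure Ω) (A : Ω → S) (u : S → E → ℝ) (σ : ℝ)
    (ε y : ℕ → Ω → ℝ) (x : ℕ → Ω → E) (ξ : ∀ n : ℕ, (Fin n → ℝ) → E) : Prop where
  measurable_source : Measurable A
  measurable_fun : Measurable (Function.uncurry u)
  measurable_noise : ∀ n, Measurable (ε n)
  measurable_rule : ∀ n, Measurable (ξ n)
  law : ∀ m : ℕ, P.map (fun ω => (A ω, fun i : Fin m => ε i ω)) =
    (P.map A).prod (Measure.pi fun _ : Fin m => gaussianReal 0 (σ ^ 2).toNNReal)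
  point_eq : ∀ n ω, x n ω = ξ n fun i : Fin n => y i ω
  observation_eq : ∀ n ω, y n ω = u (A ω) (x n ω) + ε n ω

namespace IsAdaptiveDesign

variable {A : Ω → S} {u : S → E → ℝ} {ε y : ℕ → Ω → ℝ} {x : ℕ → Ω → E}
  {ξ : ∀ n : ℕ, (Fin n → ℝ) → E}

lemma observations_eq_response (h : IsAdaptiveDesign P A u σ ε y x ξ) (ω : Ω) :
    ∀ m : ℕ, (fun i : Fin m => y i ω) =
      response (fun n v => u (A ω) (ξ n v)) m fun i => ε i ω
  | 0 => Subsingleton.elim _ _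
  | m + 1 => by
    have ih := observations_eq_response h ω m
    funext i
    refine Fin.lastCases ?_ (fun i => ?_) i
    · simp only [response, Fin.snoc_last, Fin.val_last, Fin.val_castSucc]
      rw [h.observation_eq, h.point_eq, ← ih]
    · simp only [response, Fin.snoc_castSucc, Fin.val_castSucc]
      exact congrFun ih i

lemma measurable_value (h : IsAdaptiveDesign P A u σ ε y x ξ) {n : ℕ} :
    Measurable fun q : S × (Fin n → ℝ) => u q.1 (ξ n q.2) :=
  h.measurable_fun.comp (measurable_fst.prodMk ((h.measurable_rule n).comp measurable_snd))

lemma measurable_observations (h : IsAdaptiveDesign P A u σ ε y x ξ) (m : ℕ) :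
    Measurable fun ω => fun i : Fin m => y i ω := by
  have : (fun ω => fun i : Fin m => y i ω) =
      fun ω => response (fun n v => u (A ω) (ξ n v)) m fun i => ε i ω :=
    funext fun ω => h.observations_eq_response ω m
  rw [this]
  exact (measurable_response (g := fun s n v => u s (ξ n v)) (fun n => h.measurable_value) m).comp
    (h.measurable_source.prodMk (measurable_pi_lambda _ fun i => h.measurable_noise i))

lemma measurable_point (h : IsAdaptiveDesign P A u σ ε y x ξ) (n : ℕ) : Measurable (x n) := by
  have : x n = fun ω => ξ n fun i : Fin n => y i ω := funext fun ω => h.point_eq n ω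
  rw [this]
  exact (h.measurable_rule n).comp (h.measurable_observations n)

/-- The joint law of the random function and the observations, as a mixture over the observations:
for each realization of the observations the design may be treated as fixed. -/
lemma lintegral_source_observations [IsProbabilityMeasure P]
    (h : IsAdaptiveDesign P A u σ ε y x ξ) (hσ : 0 < σ) {m : ℕ}
    {F : S × (Fin m → ℝ) → ℝ≥0∞} (hF : Measurable F) :
    ∫⁻ ω, F (A ω, fun i : Fin m => y i ω) ∂P =
      ∫⁻ v, ∫⁻ ω, F (A ω, v) *
          ENNReal.ofReal (likelihood σ (fun i => u (A ω) (ξ i (past v i))) v) ∂P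
        ∂Measure.pi (fun _ : Fin m => gaussianReal 0 (σ ^ 2).toNNReal) := by
  set N := Measure.pi fun _ : Fin m => gaussianReal 0 (σ ^ 2).toNNReal with hN
  have hA := h.measurable_source
  have : IsProbabilityMeasure (P.map A) := Measure.isProbabilityMeasure_map hA.aemeasurable
  have hres := measurable_response (g := fun s n v => u s (ξ n v)) (fun n => h.measurable_value) m
  have hF' : Measurable fun q : S × (Fin m → ℝ) =>
      F (q.1, response (fun n v => u q.1 (ξ n v)) m q.2) :=
    hF.comp (measurable_fst.prodMk hres)
  have hlik : Measurable fun q : S × (Fin m → ℝ) => F q *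
      ENNReal.ofReal (likelihood σ (fun i => u q.1 (ξ i (past q.2 i))) q.2) := by
    refine hF.mul (ENNReal.measurable_ofReal.comp (measurable_likelihood (fun i => ?_) fun i =>
      (measurable_pi_apply i).comp measurable_snd))
    exact h.measurable_value.comp
      (measurable_fst.prodMk ((measurable_past i).comp measurable_snd))
  have hAε : Measurable fun ω => (A ω, fun i : Fin m => ε i ω) :=
    hA.prodMk (measurable_pi_lambda _ fun i => h.measurable_noise i)
  calc ∫⁻ ω, F (A ω, fun i : Fin m => y i ω) ∂P
      = ∫⁻ ω, F (A ω, response (fun n v => u (A ω) (ξ n v)) m fun i => ε i ω) ∂P := by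
        simp only [h.observations_eq_response _ m]
    _ = ∫⁻ q, F (q.1, response (fun n v => u q.1 (ξ n v)) m q.2) ∂((P.map A).prod N) := by
        rw [← h.law, lintegral_map hF' hAε]
    _ = ∫⁻ s, ∫⁻ e, F (s, response (fun n v => u s (ξ n v)) m e) ∂N ∂(P.map A) :=
        lintegral_prod _ hF'.aemeasurable
    _ = ∫⁻ s, ∫⁻ v, F (s, v) *
          ENNReal.ofReal (likelihood σ (fun i => u s (ξ i (past v i))) v) ∂N ∂(P.map A) := by
        refine lintegral_congr fun s => ?_
        exact lintegral_comp_response hσ (g := fun n v => u s (ξ n v))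
          (fun n => h.measurable_value.comp (measurable_const.prodMk measurable_id))
          (hF.comp (measurable_const.prodMk measurable_id))
    _ = ∫⁻ v, ∫⁻ s, F (s, v) *
          ENNReal.ofReal (likelihood σ (fun i => u s (ξ i (past v i))) v) ∂(P.map A) ∂N :=
        lintegral_lintegral_swap hlik.aemeasurable
    _ = _ := by
        refine lintegral_congr fun v => ?_
        exact lintegral_map (hlik.comp (measurable_id.prodMk measurable_const)) hA

/-- The standardized error of the posterior mean after `m` observations at the point `g y`, where
the standard deviation is increased by `c > 0` to keep the denominator away from `0`. -/
noncomputable def stdError (k : E → E → ℝ) (σ : ℝ) (A : Ω → S) (u : S → E → ℝ) (y : ℕ → Ω → ℝ)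
    (x : ℕ → Ω → E) (m : ℕ) (c : ℝ) (z : Ω → E) (ω : Ω) : ℝ :=
  (u (A ω) (z ω) - postMean k σ (fun i : Fin m => x i ω) (fun i : Fin m => y i ω) (z ω)) /
    (postSd k σ (fun i : Fin m => x i ω) (z ω) + c)

lemma measurable_stdError (h : IsAdaptiveDesign P A u σ ε y x ξ)
    (hkm : Measurable (Function.uncurry k)) {m : ℕ} {c : ℝ} {z : Ω → E} (hz : Measurable z) :
    Measurable (stdError k σ A u y x m c z) :=
  ((h.measurable_fun.comp (h.measurable_source.prodMk hz)).sub
    (measurable_postMean hkm (fun i => h.measurable_point i)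
      (fun i => (measurable_pi_apply i).comp (h.measurable_observations m)) hz)).div
    ((measurable_postSd hkm (fun i => h.measurable_point i) hz).add_const c)

/-- The standardized error of the posterior mean at a predictable point is sub-Gaussian. -/
lemma lintegral_exp_stdError_le [IsProbabilityMeasure P]
    (h : IsAdaptiveDesign P A u σ ε y x ξ) (hσ : 0 < σ)
    (hk : ∀ x y, k x y = inner ℝ (Φ x) (Φ y)) (hkm : Measurable (Function.uncurry k))
    (hZ : IsGaussianProcess (fun x ω => u (A ω) x) P) (hmean : ∀ x, ∫ ω, u (A ω) x ∂P = 0)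
    (hcov : ∀ x y, cov[fun ω => u (A ω) x, fun ω => u (A ω) y; P] = k x y) {m : ℕ} {c : ℝ}
    (hc : 0 < c) {g : (Fin m → ℝ) → E} (hg : Measurable g) (θ : ℝ) :
    ∫⁻ ω, ENNReal.ofReal (Real.exp (θ *
        stdError k σ A u y x m c (fun ω => g fun i => y i ω) ω)) ∂P ≤
      ENNReal.ofReal (Real.exp (θ ^ 2 / 2)) := by
  have hA := h.measurable_source
  set p : (Fin m → ℝ) → Fin m → E := fun v i => ξ i (past v i) with hp
  have hpm : ∀ i, Measurable fun v => p v i := fun i =>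
    (h.measurable_rule i).comp (measurable_past i)
  have hpx : ∀ ω, (fun i : Fin m => x i ω) = p fun i => y i ω := fun ω => by
    funext i
    exact h.point_eq i ω
  set sd : (Fin m → ℝ) → ℝ := fun v => postSd k σ (p v) (g v) with hsd
  have hsdm : Measurable sd := measurable_postSd hkm hpm hg
  have hsd0 : ∀ v, 0 ≤ sd v := fun v => postSd_nonneg _ _
  set lam : (Fin m → ℝ) → ℝ := fun v => θ / (sd v + c) with hlam
  have hlamm : Measurable lam := measurable_const.div (hsdm.add_const c)
  set F : S × (Fin m → ℝ) → ℝ≥0∞ := fun q => ENNReal.ofReal (Real.exp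
    (lam q.2 * (u q.1 (g q.2) - postMean k σ (p q.2) q.2 (g q.2)) -
      lam q.2 ^ 2 * postCov k σ (p q.2) (g q.2) (g q.2) / 2)) with hF
  have hFm : Measurable F := by
    have h1 : Measurable fun q : S × (Fin m → ℝ) => u q.1 (g q.2) :=
      h.measurable_fun.comp (measurable_fst.prodMk (hg.comp measurable_snd))
    have h2 : Measurable fun v : Fin m → ℝ => postMean k σ (p v) v (g v) :=
      measurable_postMean hkm hpm (fun i => measurable_pi_apply i) hg
    have h3 : Measurable fun v : Fin m → ℝ => postCov k σ (p v) (g v) (g v) :=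
      measurable_postCov hkm hpm hg hg
    have h4 := hlamm.comp (measurable_snd : Measurable (Prod.snd : S × (Fin m → ℝ) → _))
    exact ENNReal.measurable_ofReal.comp (Real.measurable_exp.comp
      ((h4.mul (h1.sub (h2.comp measurable_snd))).sub
        (((h4.pow_const 2).mul (h3.comp measurable_snd)).div_const 2)))
  have hone : ∫⁻ ω, F (A ω, fun i : Fin m => y i ω) ∂P = 1 := by
    have h1 := h.lintegral_source_observations hσ (m := m) (F := fun _ => 1) measurable_const
    rw [lintegral_one, measure_univ] at h1
    rw [h.lintegral_source_observations hσ hFm, h1]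
    refine lintegral_congr fun v => ?_
    simp only [one_mul]
    exact lintegral_exp_mul_likelihood hk hσ (fun x => h.measurable_fun.comp
      (hA.prodMk measurable_const)) hZ hmean hcov (p v) v (g v) (lam v)
  calc _ ≤ ∫⁻ ω, ENNReal.ofReal (Real.exp (θ ^ 2 / 2)) * F (A ω, fun i : Fin m => y i ω) ∂P := by
        refine lintegral_mono fun ω => ?_
        rw [hF, ← ENNReal.ofReal_mul (Real.exp_pos _).le, ← Real.exp_add]
        refine ENNReal.ofReal_le_ofReal (Real.exp_le_exp.2 ?_)
        set v : Fin m → ℝ := fun i => y i ω with hv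
        have h2 : stdError k σ A u y x m c (fun ω => g fun i => y i ω) ω =
            (u (A ω) (g v) - postMean k σ (p v) v (g v)) / (sd v + c) := by
          rw [stdError, hpx]
        have h3 := hsd0 v
        have h4 : sd v ^ 2 = postCov k σ (p v) (g v) (g v) := postSd_sq hk hσ _ _
        have h5 : lam v ^ 2 * postCov k σ (p v) (g v) (g v) ≤ θ ^ 2 := by
          rw [← h4, ← mul_pow, hlam, sq_le_sq, abs_mul, abs_div, abs_of_nonneg h3,
            abs_of_pos (by linarith : 0 < sd v + c), div_mul_eq_mul_div,
            div_le_iff₀ (by linarith)]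
          exact mul_le_mul_of_nonneg_left (by linarith) (abs_nonneg θ)
        rw [h2]
        have h6 : θ * ((u (A ω) (g v) - postMean k σ (p v) v (g v)) / (sd v + c)) =
            lam v * (u (A ω) (g v) - postMean k σ (p v) v (g v)) := by
          rw [hlam]; ring
        rw [h6]
        linarith
    _ = _ := by
        rw [lintegral_const_mul' _ _ ENNReal.ofReal_ne_top, hone, mul_one]

end IsAdaptiveDesign

end AdaptiveDesign

/-! ### Logarithmic weights -/

section LogWeights

/-- The summable weights `1 / log (n + 2) - 1 / log (n + 3)`, of order `1 / (n log² n)`. -/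
noncomputable def logWeight (n : ℕ) : ℝ := 1 / Real.log (n + 2) - 1 / Real.log (n + 3)

lemma log_add_two_pos (n : ℕ) : 0 < Real.log ((n : ℝ) + 2) :=
  Real.log_pos (by have : (0 : ℝ) ≤ n := n.cast_nonneg
                   linarith)

lemma log_add_three_pos (n : ℕ) : 0 < Real.log ((n : ℝ) + 3) :=
  Real.log_pos (by have : (0 : ℝ) ≤ n := n.cast_nonneg
                   linarith)

lemma le_logWeight (n : ℕ) : 1 / (((n : ℝ) + 3) * Real.log (n + 3) ^ 2) ≤ logWeight n := by
  have hn : (0 : ℝ) ≤ n := n.cast_nonneg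
  have h2 := log_add_two_pos n
  have h3 := log_add_three_pos n
  have hle : Real.log ((n : ℝ) + 2) ≤ Real.log (n + 3) :=
    Real.log_le_log (by linarith) (by linarith)
  have hdiff : 1 / ((n : ℝ) + 3) ≤ Real.log (n + 3) - Real.log (n + 2) := by
    have := Real.log_le_sub_one_of_pos (x := ((n : ℝ) + 2) / (n + 3)) (by positivity)
    rw [Real.log_div (by positivity) (by positivity)] at this
    have h4 : ((n : ℝ) + 2) / (n + 3) - 1 = -(1 / (n + 3)) := by field_simp; ring
    linarith
  have h5 : logWeight n = (Real.log (n + 3) - Real.log (n + 2)) /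
      (Real.log (n + 2) * Real.log (n + 3)) := by
    rw [logWeight]; field_simp
  rw [h5, ← div_div, div_le_div_iff₀ (by positivity) (by positivity)]
  calc 1 / ((n : ℝ) + 3) * (Real.log (n + 2) * Real.log (n + 3))
      ≤ (Real.log (n + 3) - Real.log (n + 2)) * (Real.log (n + 2) * Real.log (n + 3)) := by
        gcongr
    _ ≤ (Real.log (n + 3) - Real.log (n + 2)) * Real.log (n + 3) ^ 2 := by
        rw [sq]
        gcongr

lemma logWeight_pos (n : ℕ) : 0 < logWeight n :=
  lt_of_lt_of_le (by have := log_add_three_pos n; positivity) (le_logWeight n)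

lemma sum_logWeight_le (T : ℕ) : ∑ n ∈ Finset.range T, logWeight n ≤ 1 / Real.log 2 := by
  have h : ∀ T : ℕ, ∑ n ∈ Finset.range T, logWeight n = 1 / Real.log 2 - 1 / Real.log (T + 2) := by
    intro T
    induction T with
    | zero => simp
    | succ T ih =>
      rw [Finset.sum_range_succ, ih, logWeight]
      push_cast
      ring_nf
  rw [h]
  have := log_add_two_pos T
  have : 0 < 1 / Real.log ((T : ℝ) + 2) := by positivity
  linarith

lemma logWeight_le (n : ℕ) : logWeight n ≤ 1 / Real.log 2 :=
  (Finset.single_le_sum (f := logWeight) (fun i _ => (logWeight_pos i).le)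
    (Finset.self_mem_range_succ n)).trans (sum_logWeight_le (n + 1))

/-- A weighted bound on eighth powers yields a bound on squares with a logarithmic loss of small
order: `∑_{n < T} z_n² = O(T √(log T))`. -/
lemma sum_sq_pow_four_le {A : ℝ} {z : ℕ → ℝ} {T : ℕ}
    (hz : ∑ n ∈ Finset.range T, logWeight n * z n ^ 8 ≤ A) :
    (∑ n ∈ Finset.range T, z n ^ 2) ^ 4 ≤
      (T : ℝ) ^ 3 * (A * ((T + 2) * Real.log (T + 2) ^ 2)) := by
  have hT : (0 : ℝ) ≤ T := T.cast_nonneg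
  have hl := log_add_two_pos T
  have h8 : ∑ n ∈ Finset.range T, z n ^ 8 ≤ A * ((T + 2) * Real.log (T + 2) ^ 2) := by
    calc ∑ n ∈ Finset.range T, z n ^ 8
        ≤ ∑ n ∈ Finset.range T, logWeight n * z n ^ 8 * ((T + 2) * Real.log (T + 2) ^ 2) := by
          refine Finset.sum_le_sum fun n hn => ?_
          have h1 := le_logWeight n
          have h3 := log_add_three_pos n
          have hnT : (n : ℝ) + 1 ≤ T := by exact_mod_cast Finset.mem_range.1 hn
          have hn0 : (0 : ℝ) ≤ n := n.cast_nonneg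
          have h4 : Real.log ((n : ℝ) + 3) ≤ Real.log (T + 2) :=
            Real.log_le_log (by linarith) (by linarith)
          have h5 : 1 ≤ logWeight n * ((T + 2) * Real.log (T + 2) ^ 2) := by
            rw [div_le_iff₀ (by positivity)] at h1
            refine h1.trans (mul_le_mul_of_nonneg_left ?_ (logWeight_pos n).le)
            gcongr ?_ * ?_ ^ 2
            linarith
          have h6 : 0 ≤ z n ^ 8 := by positivity
          nlinarith
      _ ≤ _ := by
          rw [← Finset.sum_mul]
          exact mul_le_mul_of_nonneg_right hz (by positivity)
  have hcs : ∀ w : ℕ → ℝ, (∑ n ∈ Finset.range T, w n) ^ 2 ≤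
      T * ∑ n ∈ Finset.range T, w n ^ 2 := fun w => by
    simpa using sq_sum_le_card_mul_sum_sq (s := Finset.range T) (f := w)
  have h2 := hcs fun n => z n ^ 2
  have h4 := hcs fun n => z n ^ 4
  simp only [← pow_mul] at h2 h4
  norm_num at h2 h4
  have hp4 : 0 ≤ ∑ n ∈ Finset.range T, z n ^ 4 :=
    Finset.sum_nonneg fun n _ => by positivity
  calc (∑ n ∈ Finset.range T, z n ^ 2) ^ 4 = ((∑ n ∈ Finset.range T, z n ^ 2) ^ 2) ^ 2 := by ring
    _ ≤ (T * ∑ n ∈ Finset.range T, z n ^ 4) ^ 2 := by gcongr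
    _ = (T : ℝ) ^ 2 * (∑ n ∈ Finset.range T, z n ^ 4) ^ 2 := by ring
    _ ≤ (T : ℝ) ^ 2 * (T * (A * ((T + 2) * Real.log (T + 2) ^ 2))) := by
        gcongr
        exact h4.trans (mul_le_mul_of_nonneg_left h8 hT)
    _ = _ := by ring

end LogWeights

/-! ### Linear recursions -/

section Recursion

/-- The accumulated effect of the drift: `∑_{z=1}^{n} η^z Δ_{n+1-z}`. -/
def discounted (η : ℝ) (Δ : ℕ → ℝ) : ℕ → ℝ
  | 0 => 0
  | n + 1 => η * (discounted η Δ n + Δ (n + 1))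

lemma discounted_nonneg {η : ℝ} (hη : 0 ≤ η) {Δ : ℕ → ℝ} (hΔ : ∀ n, 0 ≤ Δ n) :
    ∀ n, 0 ≤ discounted η Δ n
  | 0 => le_rfl
  | n + 1 => mul_nonneg hη (add_nonneg (discounted_nonneg hη hΔ n) (hΔ (n + 1)))

lemma sum_le_of_linear_recursion {η E₁ : ℝ} {e Δ W : ℕ → ℝ} (hη : 0 ≤ η) (hη1 : η < 1)
    (hE : 0 ≤ E₁) (h0 : e 0 ≤ E₁) (hW : ∀ n, 0 ≤ W n)
    (hrec : ∀ n, e (n + 1) ≤ η * (e n + 2 * Δ (n + 1) + W n)) (T : ℕ) :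
    ∑ n ∈ Finset.range T, e n ≤
      (E₁ + ∑ n ∈ Finset.range T, W n) / (1 - η) +
        2 * ∑ n ∈ Finset.range T, discounted η Δ n := by
  -- `h n` majorizes `e n - 2 * discounted η Δ n`
  let h : ℕ → ℝ := Nat.rec E₁ fun n a => η * (a + W n)
  have hs : ∀ n, h (n + 1) = η * (h n + W n) := fun n => rfl
  have hnn : ∀ n, 0 ≤ h n := fun n => by
    induction n with
    | zero => exact hE
    | succ n ih =>
      rw [hs]
      have := hW n
      positivity
  have hle : ∀ n, e n ≤ h n + 2 * discounted η Δ n := fun n => by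
    induction n with
    | zero => simpa [discounted, h] using h0
    | succ n ih =>
      rw [hs, discounted]
      have := mul_le_mul_of_nonneg_left ih hη
      have := hrec n
      linarith
  have hsum : ∀ T, (1 - η) * ∑ n ∈ Finset.range T, h n + h T =
      E₁ + η * ∑ n ∈ Finset.range T, W n := fun T => by
    induction T with
    | zero => simp [h]
    | succ T ih =>
      rw [Finset.sum_range_succ, Finset.sum_range_succ, hs]
      linarith
  have h1 : ∑ n ∈ Finset.range T, h n ≤ (E₁ + ∑ n ∈ Finset.range T, W n) / (1 - η) := by
    rw [le_div_iff₀ (by linarith)]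
    have h2 := hsum T
    have h3 := hnn T
    have h4 : 0 ≤ ∑ n ∈ Finset.range T, W n := Finset.sum_nonneg fun n _ => hW n
    nlinarith
  calc ∑ n ∈ Finset.range T, e n ≤ ∑ n ∈ Finset.range T, (h n + 2 * discounted η Δ n) :=
        Finset.sum_le_sum fun n _ => hle n
    _ = ∑ n ∈ Finset.range T, h n + 2 * ∑ n ∈ Finset.range T, discounted η Δ n := by
        rw [Finset.sum_add_distrib, Finset.mul_sum]
    _ ≤ _ := by linarith

end Recursion

/-! ### One step of the algorithm -/

section Step

variable {E H : Type*} [NormedAddCommGroup H] [InnerProductSpace ℝ H]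
  {k : E → E → ℝ} {Φ : E → H} {σ : ℝ}

/-- The posterior mean after the observations `y 0, …, y (n - 1)` at `x 0, …, x (n - 1)`. -/
noncomputable def meanAt (k : E → E → ℝ) (σ : ℝ) (x : ℕ → E) (y : ℕ → ℝ) (n : ℕ) (z : E) : ℝ :=
  postMean k σ (fun i : Fin n => x i) (fun i : Fin n => y i) z

/-- The posterior standard deviation after observations at `x 0, …, x (n - 1)`. -/
noncomputable def sdAt (k : E → E → ℝ) (σ : ℝ) (x : ℕ → E) (n : ℕ) (z : E) : ℝ :=
  postSd k σ (fun i : Fin n => x i) z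

lemma sdAt_self (x : ℕ → E) (n : ℕ) : sdAt k σ x n (x n) = predSd k σ x n := rfl

lemma sdAt_nonneg (x : ℕ → E) (n : ℕ) (z : E) : 0 ≤ sdAt k σ x n z := postSd_nonneg _ _

lemma sdAt_le_one (hk : ∀ x y, k x y = inner ℝ (Φ x) (Φ y)) (hσ : 0 < σ)
    (hk1 : ∀ x, k x x ≤ 1) (x : ℕ → E) (n : ℕ) (z : E) : sdAt k σ x n z ≤ 1 :=
  postSd_le_one hk hσ hk1 _ _

lemma abs_meanAt_succ_sub_le (hk : ∀ x y, k x y = inner ℝ (Φ x) (Φ y)) (hσ : 0 < σ)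
    (hk1 : ∀ x, k x x ≤ 1) (x : ℕ → E) (y : ℕ → ℝ) (n : ℕ) (z : E) :
    |meanAt k σ x y (n + 1) z - meanAt k σ x y n z| ≤
      predSd k σ x n * |y n - meanAt k σ x y n (x n)| / σ ^ 2 := by
  have h := postMean_succ hk hσ (fun i : Fin (n + 1) => x i) (fun i : Fin (n + 1) => y i) z
  set c := postCov k σ (fun i : Fin n => x i) z (x n) with hc
  have hv : postCov k σ (fun i : Fin n => x i) (x n) (x n) = predSd k σ x n ^ 2 :=
    (postSd_sq hk hσ _ _).symm
  have h' : meanAt k σ x y (n + 1) z - meanAt k σ x y n z =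
      c / (σ ^ 2 + predSd k σ x n ^ 2) * (y n - meanAt k σ x y n (x n)) := by
    rw [← hv]
    exact sub_eq_iff_eq_add'.2 h
  have hs := predSd_nonneg (k := k) (σ := σ) x n
  have hcle : |c| ≤ predSd k σ x n := by
    calc |c| ≤ sdAt k σ x n z * predSd k σ x n := abs_postCov_le hk hσ _ _ _
      _ ≤ 1 * predSd k σ x n :=
          mul_le_mul_of_nonneg_right (sdAt_le_one hk hσ hk1 x n z) hs
      _ = _ := one_mul _
  rw [h', abs_mul, abs_div, abs_of_pos (by positivity : 0 < σ ^ 2 + predSd k σ x n ^ 2),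
    mul_div_right_comm]
  refine mul_le_mul_of_nonneg_right ?_ (abs_nonneg _)
  gcongr
  nlinarith

lemma sdAt_succ_sq (hk : ∀ x y, k x y = inner ℝ (Φ x) (Φ y)) (hσ : 0 < σ)
    (x : ℕ → E) (n : ℕ) (z : E) :
    sdAt k σ x (n + 1) z ^ 2 = sdAt k σ x n z ^ 2 -
      postCov k σ (fun i : Fin n => x i) z (x n) ^ 2 / (σ ^ 2 + predSd k σ x n ^ 2) := by
  have h := postCov_succ hk hσ (fun i : Fin (n + 1) => x i) z z
  rw [sdAt, sdAt, predSd, postSd_sq hk hσ, postSd_sq hk hσ, postSd_sq hk hσ, h, ← sq]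
  rfl

lemma sdAt_succ_le (hk : ∀ x y, k x y = inner ℝ (Φ x) (Φ y)) (hσ : 0 < σ)
    (x : ℕ → E) (n : ℕ) (z : E) : sdAt k σ x (n + 1) z ≤ sdAt k σ x n z := by
  refine (pow_le_pow_iff_left₀ (sdAt_nonneg _ _ _) (sdAt_nonneg _ _ _) two_ne_zero).1 ?_
  rw [sdAt_succ_sq hk hσ]
  have : 0 ≤ postCov k σ (fun i : Fin n => x i) z (x n) ^ 2 / (σ ^ 2 + predSd k σ x n ^ 2) := by
    positivity
  linarith

/-- The relative decrease of the variance at a point caused by an observation there. -/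
noncomputable def shrinkage (k : E → E → ℝ) (σ : ℝ) (x : ℕ → E) (n : ℕ) : ℝ :=
  predSd k σ x n ^ 2 / (σ ^ 2 + predSd k σ x n ^ 2)

lemma shrinkage_nonneg (x : ℕ → E) (n : ℕ) : 0 ≤ shrinkage k σ x n := by
  unfold shrinkage; positivity

lemma shrinkage_le_one (x : ℕ → E) (n : ℕ) : shrinkage k σ x n ≤ 1 :=
  div_le_one_of_le₀ (by nlinarith [sq_nonneg σ]) (by positivity)

lemma predSd_mul_le_sdAt_succ (hk : ∀ x y, k x y = inner ℝ (Φ x) (Φ y)) (hσ : 0 < σ)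
    (x : ℕ → E) (n : ℕ) :
    predSd k σ x n * (1 - shrinkage k σ x n) ≤ sdAt k σ x (n + 1) (x n) := by
  have h1 := shrinkage_nonneg (k := k) (σ := σ) x n
  have h2 := shrinkage_le_one (k := k) (σ := σ) x n
  refine (pow_le_pow_iff_left₀ (mul_nonneg (predSd_nonneg x n) (by linarith))
    (sdAt_nonneg _ _ _) two_ne_zero).1 ?_
  have hv : postCov k σ (fun i : Fin n => x i) (x n) (x n) = predSd k σ x n ^ 2 :=
    (postSd_sq hk hσ _ _).symm
  have h3 : sdAt k σ x (n + 1) (x n) ^ 2 = predSd k σ x n ^ 2 * (1 - shrinkage k σ x n) := by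
    rw [sdAt_succ_sq hk hσ, hv, sdAt_self, shrinkage]
    ring
  rw [h3, mul_pow]
  refine mul_le_mul_of_nonneg_left ?_ (sq_nonneg _)
  nlinarith

end Step

/-! ### Regret along a typical path -/

section Path

variable {E H : Type*} [NormedAddCommGroup H] [InnerProductSpace ℝ H]
  {k : E → E → ℝ} {Φ : E → H} {σ η : ℝ}

/-- The surrogate objective of step `n` (counted from `0`), for the exploration parameters `b`. -/
noncomputable def surrogateAt (k : E → E → ℝ) (σ : ℝ) (b : ℕ → ℝ) (V : ℕ → E → ℝ) (x : ℕ → E)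
    (y : ℕ → ℝ) (n : ℕ) (z : E) : ℝ :=
  V n z + (meanAt k σ x y n z + b n * sdAt k σ x n z)

/-- The suboptimality of `x n` for the surrogate objective of step `n`. -/
noncomputable def surrogateGap (k : E → E → ℝ) (σ : ℝ) (b : ℕ → ℝ) (V : ℕ → E → ℝ) (x : ℕ → E)
    (y : ℕ → ℝ) (n : ℕ) : ℝ :=
  (⨆ z, surrogateAt k σ b V x y n z) - surrogateAt k σ b V x y n (x n)

/-- The standardized error of the posterior mean at the point chosen in step `n`; the weight added
to the deviation keeps the denominator positive and is itself summable. -/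
noncomputable def pathError (k : E → E → ℝ) (σ : ℝ) (f : E → ℝ) (x : ℕ → E) (y : ℕ → ℝ)
    (n : ℕ) : ℝ :=
  (f (x n) - meanAt k σ x y n (x n)) / (predSd k σ x n + logWeight n)

/-- The properties of one realization of the algorithm that yield the regret bound. Here `V n` is
the known function of step `n` (counted from `0`), `f` the realization of the unknown function,
`x n` the chosen points and `e n` the noise. The confidence bound is only required from step `N`
on, up to an error of order `1 / n`, and only at suitable points `q` close to `z`. -/
structure IsGoodPath (k : E → E → ℝ) (σ η : ℝ) (b : ℕ → ℝ) (V : ℕ → E → ℝ) (Δ : ℕ → ℝ)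
    (f : E → ℝ) (x : ℕ → E) (e : ℕ → ℝ) (C A : ℝ) (N : ℕ) : Prop where
  osc_objective : ∀ n z z', V n z + f z - (V n z' + f z') ≤ C
  osc_known : ∀ n z z', V n z - V n z' ≤ C
  drift : ∀ n z, |V (n + 1) z - V n z| ≤ Δ (n + 1)
  linear_convergence : ∀ n, surrogateGap k σ b V x (fun i => f (x i) + e i) (n + 1) ≤
    η * ((⨆ z, surrogateAt k σ b V x (fun i => f (x i) + e i) (n + 1) z) -
      surrogateAt k σ b V x (fun i => f (x i) + e i) (n + 1) (x n))
  confidence : ∀ n, N ≤ n → ∀ z, ∃ q, V n z + f z ≤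
    V n q + (meanAt k σ x (fun i => f (x i) + e i) n q +
      b n * (sdAt k σ x n q + logWeight n)) + C / (n + 1)
  mean_error : ∀ T : ℕ, ∑ n ∈ Finset.range T,
    logWeight n * pathError k σ f x (fun i => f (x i) + e i) n ^ 8 ≤ A
  noise : ∀ T : ℕ, ∑ n ∈ Finset.range T, logWeight n * e n ^ 8 ≤ A

variable {b : ℕ → ℝ} {V : ℕ → E → ℝ} {Δ : ℕ → ℝ} {f : E → ℝ} {x : ℕ → E} {e : ℕ → ℝ} {C A : ℝ}
  {N : ℕ}

lemma exists_meanAt_le (hk : ∀ x y, k x y = inner ℝ (Φ x) (Φ y)) (hk1 : ∀ x, k x x ≤ 1)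
    (x : ℕ → E) (y : ℕ → ℝ) (n : ℕ) : ∃ M, ∀ z, meanAt k σ x y n z ≤ M := by
  have hΦ : ∀ z, ‖Φ z‖ ≤ 1 := fun z => by
    have := hk1 z
    rw [hk, real_inner_self_eq_norm_sq] at this
    exact (sq_le_one_iff₀ (norm_nonneg _)).1 this
  set v := (regMatrix k σ fun i : Fin n => x i)⁻¹ *ᵥ fun i : Fin n => y i with hv
  refine ⟨∑ i, |v i|, fun z => ?_⟩
  have : meanAt k σ x y n z = ∑ i, kernelVec k (fun i : Fin n => x i) z i * v i := rfl
  rw [this]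
  refine Finset.sum_le_sum fun i _ => (le_abs_self _).trans ?_
  rw [abs_mul]
  refine mul_le_of_le_one_left (abs_nonneg _) ?_
  rw [kernelVec, hk]
  exact (abs_real_inner_le_norm _ _).trans (mul_le_one₀ (hΦ _) (norm_nonneg _) (hΦ _))

namespace IsGoodPath

lemma bddAbove_surrogateAt (h : IsGoodPath k σ η b V Δ f x e C A N)
    (hk : ∀ x y, k x y = inner ℝ (Φ x) (Φ y)) (hσ : 0 < σ) (hk1 : ∀ x, k x x ≤ 1)
    (hb : ∀ n, 0 ≤ b n) (y : ℕ → ℝ) (n : ℕ) :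
    BddAbove (Set.range (surrogateAt k σ b V x y n)) := by
  obtain ⟨M, hM⟩ := exists_meanAt_le (σ := σ) hk hk1 x y n
  refine ⟨V n (x 0) + C + (M + b n), Set.forall_mem_range.2 fun z => ?_⟩
  have h1 := h.osc_known n z (x 0)
  have h2 := hM z
  have h3 := mul_le_mul_of_nonneg_left (sdAt_le_one hk hσ hk1 x n z) (hb n)
  rw [surrogateAt]
  linarith

lemma surrogateGap_nonneg (h : IsGoodPath k σ η b V Δ f x e C A N)
    (hk : ∀ x y, k x y = inner ℝ (Φ x) (Φ y)) (hσ : 0 < σ) (hk1 : ∀ x, k x x ≤ 1)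
    (hb : ∀ n, 0 ≤ b n) (y : ℕ → ℝ) (n : ℕ) : 0 ≤ surrogateGap k σ b V x y n :=
  sub_nonneg.2 (le_ciSup (h.bddAbove_surrogateAt hk hσ hk1 hb y n) (x n))

lemma surrogateGap_zero_le [Nonempty E] (h : IsGoodPath k σ η b V Δ f x e C A N)
    (hk : ∀ x y, k x y = inner ℝ (Φ x) (Φ y)) (hσ : 0 < σ) (hk1 : ∀ x, k x x ≤ 1)
    (hb : ∀ n, 0 ≤ b n) (y : ℕ → ℝ) : surrogateGap k σ b V x y 0 ≤ C + b 0 := by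
  have h0 : ∀ z, meanAt k σ x y 0 z = 0 := fun z => by simp [meanAt, postMean]
  rw [surrogateGap, sub_le_iff_le_add]
  refine ciSup_le fun z => ?_
  have h1 := h.osc_known 0 z (x 0)
  have h2 := mul_le_mul_of_nonneg_left (sdAt_le_one hk hσ hk1 x 0 z) (hb 0)
  have h3 := mul_nonneg (hb 0) (sdAt_nonneg (k := k) (σ := σ) x 0 (x 0))
  rw [surrogateAt, surrogateAt, h0, h0]
  linarith

/-- One more observation changes the upper confidence bounds by little: the change of the mean is
a multiple of the predictive deviation, and only at the point `x n` itself does a loss of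
deviation matter. -/
lemma surrogateGap_succ_le [Nonempty E] (h : IsGoodPath k σ η b V Δ f x e C A N)
    (hk : ∀ x y, k x y = inner ℝ (Φ x) (Φ y)) (hσ : 0 < σ) (hk1 : ∀ x, k x x ≤ 1)
    (hη : 0 ≤ η) (hb : ∀ n, 0 ≤ b n) (hbm : Monotone b) (n : ℕ) :
    surrogateGap k σ b V x (fun i => f (x i) + e i) (n + 1) ≤
      η * (surrogateGap k σ b V x (fun i => f (x i) + e i) n + 2 * Δ (n + 1) +
        (2 * (predSd k σ x n * |f (x n) + e n -
            meanAt k σ x (fun i => f (x i) + e i) n (x n)| / σ ^ 2) +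
          b n * (predSd k σ x n * shrinkage k σ x n) + (b (n + 1) - b n))) := by
  set y : ℕ → ℝ := fun i => f (x i) + e i with hy
  refine (h.linear_convergence n).trans (mul_le_mul_of_nonneg_left ?_ hη)
  rw [sub_le_iff_le_add]
  refine ciSup_le fun z => ?_
  have hgap : surrogateAt k σ b V x y n z ≤
      surrogateGap k σ b V x y n + surrogateAt k σ b V x y n (x n) := by
    rw [surrogateGap, sub_add_cancel]
    exact le_ciSup (h.bddAbove_surrogateAt hk hσ hk1 hb y n) z
  have hbn := hb n
  have hb' : 0 ≤ b (n + 1) - b n := sub_nonneg.2 (hbm n.le_succ)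
  have hs := predSd_nonneg (k := k) (σ := σ) x n
  have hd1 := (abs_le.1 (h.drift n z)).2
  have hd2 := (abs_le.1 (h.drift n (x n))).1
  have hm1 := (abs_le.1 (abs_meanAt_succ_sub_le hk hσ hk1 x y n z)).2
  have hm2 := (abs_le.1 (abs_meanAt_succ_sub_le hk hσ hk1 x y n (x n))).1
  have hs1 : b (n + 1) * sdAt k σ x (n + 1) z ≤ b n * sdAt k σ x n z + (b (n + 1) - b n) := by
    have h1 := mul_le_mul_of_nonneg_left (sdAt_succ_le hk hσ x n z) (hb (n + 1))
    have h2 := mul_le_mul_of_nonneg_left (sdAt_le_one hk hσ hk1 x n z) hb'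
    linarith
  have hs2 : b n * sdAt k σ x n (x n) - b n * (predSd k σ x n * shrinkage k σ x n) ≤
      b (n + 1) * sdAt k σ x (n + 1) (x n) := by
    have h1 := mul_le_mul_of_nonneg_left (predSd_mul_le_sdAt_succ hk hσ x n) hbn
    have h2 := mul_nonneg hb' (sdAt_nonneg (k := k) (σ := σ) x (n + 1) (x n))
    rw [sdAt_self]
    linarith
  have hyn : y n = f (x n) + e n := rfl
  rw [hyn] at hm1 hm2
  simp only [surrogateAt] at hgap ⊢
  linarith

lemma iSup_objective_sub_le [Nonempty E] (h : IsGoodPath k σ η b V Δ f x e C A N) (n : ℕ) :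
    (⨆ z, (V n z + f z)) - (V n (x n) + f (x n)) ≤ C := by
  rw [sub_le_iff_le_add]
  refine ciSup_le fun z => ?_
  have := h.osc_objective n z (x n)
  linarith

lemma abs_sub_meanAt (_h : IsGoodPath k σ η b V Δ f x e C A N) (y : ℕ → ℝ) (n : ℕ) :
    |f (x n) - meanAt k σ x y n (x n)| =
      (predSd k σ x n + logWeight n) * |pathError k σ f x y n| := by
  have h1 := predSd_nonneg (k := k) (σ := σ) x n
  have h2 := logWeight_pos n
  rw [pathError, abs_div, abs_of_pos (by linarith : 0 < predSd k σ x n + logWeight n)]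
  field_simp

lemma regret_step_le [Nonempty E] (h : IsGoodPath k σ η b V Δ f x e C A N)
    (hk : ∀ x y, k x y = inner ℝ (Φ x) (Φ y)) (hσ : 0 < σ) (hk1 : ∀ x, k x x ≤ 1)
    (hb : ∀ n, 0 ≤ b n) {n : ℕ} (hn : N ≤ n) :
    (⨆ z, (V n z + f z)) - (V n (x n) + f (x n)) ≤
      surrogateGap k σ b V x (fun i => f (x i) + e i) n + b n * predSd k σ x n +
        (predSd k σ x n + logWeight n) *
          |pathError k σ f x (fun i => f (x i) + e i) n| + C / (n + 1) + b n * logWeight n := by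
  set y : ℕ → ℝ := fun i => f (x i) + e i with hy
  rw [sub_le_iff_le_add]
  refine ciSup_le fun z => ?_
  obtain ⟨q, hq⟩ := h.confidence n hn z
  have h1 : surrogateAt k σ b V x y n q ≤
      surrogateGap k σ b V x y n + surrogateAt k σ b V x y n (x n) := by
    rw [surrogateGap, sub_add_cancel]
    exact le_ciSup (h.bddAbove_surrogateAt hk hσ hk1 hb y n) q
  have h2 := (abs_le.1 (h.abs_sub_meanAt y n).le).1
  simp only [surrogateAt, sdAt_self] at h1
  linarith

end IsGoodPath

end Path

/-! ### Growth of the error terms -/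

section Growth

/-- Squares of errors with bounded logarithmically weighted eighth powers sum up to `o(T log T)`. -/
lemma eventually_sum_sq_le {A c β₁ κ : ℝ} (hc : 0 < c) (hκ : 0 < κ) :
    ∀ᶠ T : ℕ in atTop, ∀ z : ℕ → ℝ,
      (∑ n ∈ Finset.range T, logWeight n * z n ^ 8 ≤ A) →
      ∑ n ∈ Finset.range T, z n ^ 2 ≤ κ * (T * (c * Real.log T + β₁)) := by
  have hlog : Tendsto (fun T : ℕ => Real.log T) atTop atTop :=
    Real.tendsto_log_atTop.comp tendsto_natCast_atTop_atTop
  have h1 := hlog.eventually_ge_atTop (max 1 (12 * |A| * 16 / (κ ^ 4 * c ^ 4)))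
  have h2 := hlog.eventually_ge_atTop (2 * |β₁| / c)
  filter_upwards [h1, h2, eventually_ge_atTop 2] with T h1 h2 hT z hz
  have hT' : (2 : ℝ) ≤ T := by exact_mod_cast hT
  set l := Real.log T with hl
  have hl1 : 1 ≤ l := (le_max_left _ _).trans h1
  have hlA : 12 * |A| * 16 / (κ ^ 4 * c ^ 4) ≤ l := (le_max_right _ _).trans h1
  have hβ : c / 2 * l ≤ c * l + β₁ := by
    rw [div_le_iff₀ hc] at h2
    have := neg_abs_le β₁
    linarith
  have hlT : Real.log ((T : ℝ) + 2) ≤ 2 * l := by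
    rw [hl, ← Real.log_rpow (by linarith)]
    refine Real.log_le_log (by linarith) ?_
    norm_num
    nlinarith
  have hl0 := log_add_two_pos T
  have hA : A ≤ |A| := le_abs_self A
  have hA0 := abs_nonneg A
  refine (pow_le_pow_iff_left₀ (Finset.sum_nonneg fun n _ => sq_nonneg _) ?_
    four_ne_zero).1 ((sum_sq_pow_four_le hz).trans ?_)
  · have : 0 ≤ c / 2 * l := by positivity
    have : 0 ≤ c * l + β₁ := this.trans hβ
    positivity
  · have h3 : 12 * |A| * 16 ≤ l ^ 2 * (κ ^ 4 * c ^ 4) := by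
      rw [div_le_iff₀ (by positivity)] at hlA
      refine hlA.trans (mul_le_mul_of_nonneg_right ?_ (by positivity))
      nlinarith
    calc (T : ℝ) ^ 3 * (A * ((T + 2) * Real.log (T + 2) ^ 2))
        ≤ (T : ℝ) ^ 3 * (|A| * ((3 * T) * (2 * l) ^ 2)) := by
          gcongr
          linarith
      _ = 12 * |A| * (l ^ 2 * (T : ℝ) ^ 4) := by ring
      _ ≤ l ^ 2 * (κ ^ 4 * c ^ 4) / 16 * (l ^ 2 * (T : ℝ) ^ 4) := by
          gcongr
          linarith
      _ = (κ * (T * (c / 2 * l))) ^ 4 := by ring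
      _ ≤ (κ * (T * (c * l + β₁))) ^ 4 := by gcongr

lemma sum_one_div_le (T : ℕ) : ∑ n ∈ Finset.range T, 1 / ((n : ℝ) + 1) ≤ 1 + Real.log T := by
  have h := harmonic_le_one_add_log T
  rw [harmonic] at h
  push_cast at h
  simpa [one_div] using h

/-- The exploration parameters of the steps, counted from `0`. -/
noncomputable def exploration (c β₁ : ℝ) (n : ℕ) : ℝ := √(c * Real.log ((n + 1 : ℕ) : ℝ) + β₁)

lemma exploration_nonneg (c β₁ : ℝ) (n : ℕ) : 0 ≤ exploration c β₁ n := Real.sqrt_nonneg _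

lemma exploration_mono {c : ℝ} (hc : 0 < c) (β₁ : ℝ) : Monotone (exploration c β₁) := by
  intro m n hmn
  refine Real.sqrt_le_sqrt ?_
  gcongr

lemma exploration_le {c : ℝ} (hc : 0 < c) (β₁ : ℝ) {T : ℕ} (hT : 1 ≤ T) :
    exploration c β₁ T ≤ (1 + 2 * c + |β₁|) * (1 + Real.log T) := by
  have hT' : (1 : ℝ) ≤ T := by exact_mod_cast hT
  have hl : 0 ≤ Real.log T := Real.log_nonneg hT'
  have h1 : Real.log ((T + 1 : ℕ) : ℝ) ≤ 1 + Real.log T := by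
    have : Real.log ((T + 1 : ℕ) : ℝ) ≤ Real.log (2 * T) := by
      apply Real.log_le_log (by positivity)
      push_cast
      linarith
    rw [Real.log_mul (by norm_num) (by positivity)] at this
    have h2 := Real.log_two_lt_d9
    linarith
  refine Real.sqrt_le_iff.2 ⟨by positivity, ?_⟩
  have h2 : c * Real.log ((T + 1 : ℕ) : ℝ) + β₁ ≤ (1 + 2 * c + |β₁|) * (1 + Real.log T) := by
    have := le_abs_self β₁
    have h3 := mul_le_mul_of_nonneg_left h1 hc.le
    have h4 := mul_nonneg (abs_nonneg β₁) hl
    nlinarith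
  refine h2.trans ?_
  have h5 : 1 ≤ (1 + 2 * c + |β₁|) * (1 + Real.log T) := by
    have := abs_nonneg β₁
    nlinarith [mul_nonneg hc.le hl, mul_nonneg this hl]
  nlinarith

end Growth

/-! ### The cumulative regret along a typical path -/

section CumulativeRegret

variable {E H : Type*} [NormedAddCommGroup H] [InnerProductSpace ℝ H]
  {k : E → E → ℝ} {Φ : E → H} {σ η : ℝ}

/-- A quadratic form of the Cauchy-Schwarz inequality with upper bounds inserted. -/
lemma sum_mul_abs_le {T : ℕ} {s z : ℕ → ℝ} {a b : ℝ} (hs : ∀ n, 0 ≤ s n) (ha : 0 ≤ a) (hb : 0 ≤ b)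
    (h1 : ∑ n ∈ Finset.range T, s n ^ 2 ≤ a ^ 2) (h2 : ∑ n ∈ Finset.range T, z n ^ 2 ≤ b ^ 2) :
    ∑ n ∈ Finset.range T, s n * |z n| ≤ a * b := by
  have h3 := Finset.sum_mul_sq_le_sq_mul_sq (Finset.range T) s fun n => |z n|
  simp only [sq_abs] at h3
  refine (pow_le_pow_iff_left₀ (Finset.sum_nonneg fun n _ => mul_nonneg (hs n) (abs_nonneg _))
    (by positivity) two_ne_zero).1 (h3.trans ?_)
  rw [mul_pow]
  gcongr

/-- All but boundedly many steps have a small predictive deviation, so that the loss of deviation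
at the chosen points is of lower order. -/
lemma sum_predSd_mul_shrinkage_le (hk : ∀ x y, k x y = inner ℝ (Φ x) (Φ y)) (hσ : 0 < σ)
    (hk1 : ∀ x, k x x ≤ 1) {ρ : ℝ} (hρ : 0 < ρ) {x : ℕ → E} {T M : ℕ}
    (hM : ((Finset.range T).filter fun n => ρ < predSd k σ x n).card ≤ M) :
    ∑ n ∈ Finset.range T, predSd k σ x n * shrinkage k σ x n ≤
      ρ ^ 2 / σ ^ 2 * ∑ n ∈ Finset.range T, predSd k σ x n + M := by
  have hle : ∀ n ∈ Finset.range T, predSd k σ x n * shrinkage k σ x n ≤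
      ρ ^ 2 / σ ^ 2 * predSd k σ x n + if ρ < predSd k σ x n then 1 else 0 := fun n _ => by
    have h0 := predSd_nonneg (k := k) (σ := σ) x n
    have h1 := predSd_le_one hk hσ hk1 x n
    have h2 := shrinkage_le_one (k := k) (σ := σ) x n
    have h3 := shrinkage_nonneg (k := k) (σ := σ) x n
    split_ifs with hlt
    · have : 0 ≤ ρ ^ 2 / σ ^ 2 * predSd k σ x n := by positivity
      have := mul_le_one₀ h1 h3 h2
      linarith
    · have h4 : shrinkage k σ x n ≤ ρ ^ 2 / σ ^ 2 := by
        have h5 : predSd k σ x n ^ 2 ≤ ρ ^ 2 := by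
          have := not_lt.1 hlt
          gcongr
        refine div_le_div₀ (sq_nonneg ρ) h5 (by positivity) ?_
        nlinarith [sq_nonneg (predSd k σ x n)]
      rw [add_zero, mul_comm]
      exact mul_le_mul_of_nonneg_right h4 h0
  refine (Finset.sum_le_sum hle).trans ?_
  rw [Finset.sum_add_distrib, ← Finset.mul_sum]
  have : (∑ n ∈ Finset.range T, if ρ < predSd k σ x n then (1 : ℝ) else 0) ≤ M := by
    rw [Finset.sum_boole]
    exact_mod_cast hM
  linarith

variable {V : ℕ → E → ℝ} {Δ : ℕ → ℝ} {f : E → ℝ} {x : ℕ → E} {e : ℕ → ℝ} {C A c β₁ : ℝ}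
  {N : ℕ}

/-- The regret up to a horizon `T` at which the squared errors are small compared to `T β_T`. The
sum of the exploration bonuses accounts for half of the main term `R`, and each of the other
terms of order `R` has a small constant. -/
lemma IsGoodPath.sum_regret_le [Nonempty E]
    (h : IsGoodPath k σ η (exploration c β₁) V Δ f x e C A N)
    (hk : ∀ x y, k x y = inner ℝ (Φ x) (Φ y)) (hσ : 0 < σ) (hk1 : ∀ x, k x x ≤ 1)
    (hη : 0 ≤ η) (hη1 : η < 1) (hc : 0 < c) (hC : 0 ≤ C)
    {ρ κ : ℝ} (hρ : 0 < ρ) (hκ : 0 ≤ κ) {T M : ℕ} (hT : 1 ≤ T)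
    (hM : ((Finset.range T).filter fun n => ρ < predSd k σ x n).card ≤ M)
    (hβ : 0 ≤ c * Real.log T + β₁)
    (hsq : ∀ z : ℕ → ℝ, (∑ n ∈ Finset.range T, logWeight n * z n ^ 8 ≤ A) →
      ∑ n ∈ Finset.range T, z n ^ 2 ≤ κ ^ 2 * (T * (c * Real.log T + β₁)))
    {γ : ℝ} (hγ : infoGain k σ (fun i : Fin T => x i) ≤ γ) :
    ∑ n ∈ Finset.range T, ((⨆ z, (V n z + f z)) - (V n (x n) + f (x n))) ≤
      √(C₁ σ * T * (c * Real.log T + β₁) * γ) * (1 / 2 + κ / 2 +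
        (κ * (2 + 1 / Real.log 2) / σ ^ 2 + ρ ^ 2 / (2 * σ ^ 2)) / (1 - η)) +
      (C * N + 1 / Real.log 2 + A + C * (1 + Real.log T) +
        exploration c β₁ T * (1 / Real.log 2) +
        (C + exploration c β₁ 0 + exploration c β₁ T * M + exploration c β₁ T) / (1 - η)) +
      2 * ∑ n ∈ Finset.range T, discounted η Δ n := by
  set b := exploration c β₁ with hb
  set y : ℕ → ℝ := fun i => f (x i) + e i with hy
  set s : ℕ → ℝ := predSd k σ x with hs
  set ζ : ℕ → ℝ := pathError k σ f x y with hζ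
  set B : ℝ := √(c * Real.log T + β₁) with hB
  set g : ℝ := √(C₁ σ * γ) with hg
  set h0 : ℝ := 1 / Real.log 2 with hh0
  have hb0 : ∀ n, 0 ≤ b n := exploration_nonneg c β₁
  have hbm : Monotone b := exploration_mono hc β₁
  have hs0 : ∀ n, 0 ≤ s n := predSd_nonneg x
  have hs1 : ∀ n, s n ≤ 1 := predSd_le_one hk hσ hk1 x
  have hw0 : ∀ n, 0 < logWeight n := logWeight_pos
  have hwh : ∀ n, logWeight n ≤ h0 := logWeight_le
  have hh0pos : 0 ≤ h0 := (hw0 0).le.trans (hwh 0)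
  have hbB : ∀ n ∈ Finset.range T, b n ≤ B := fun n hn => by
    refine Real.sqrt_le_sqrt ?_
    have : n + 1 ≤ T := Finset.mem_range.1 hn
    gcongr
  have hBT : B ≤ b T := by
    refine Real.sqrt_le_sqrt ?_
    gcongr
    exact Nat.le_succ T
  have hB0 : 0 ≤ B := Real.sqrt_nonneg _
  have hg0 : 0 ≤ g := Real.sqrt_nonneg _
  have hT0 : (0 : ℝ) ≤ T := T.cast_nonneg
  have hηpos : 0 < 1 - η := by linarith
  have hγ0 : 0 ≤ C₁ σ * γ :=
    mul_nonneg (C₁_pos hσ).le ((infoGain_nonneg hk hσ _).trans hγ)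
  set R : ℝ := √T * B * g with hR
  have hReq : √(C₁ σ * T * (c * Real.log T + β₁) * γ) = R := by
    rw [hR, hB, hg, ← Real.sqrt_mul hT0, ← Real.sqrt_mul (by positivity)]
    congr 1
    ring
  have hR0 : 0 ≤ R := by positivity
  -- the basic sums
  have hS2 : ∑ n ∈ Finset.range T, s n ^ 2 ≤ (g / 2) ^ 2 := by
    have h1 := four_mul_sum_sq_predSd_le hk hσ hk1 x T
    have h2 := mul_le_mul_of_nonneg_left hγ (C₁_pos hσ).le
    rw [div_pow, hg, Real.sq_sqrt hγ0]
    linarith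
  have hTsq : √(T : ℝ) ^ 2 = T := Real.sq_sqrt hT0
  have hS1 : ∑ n ∈ Finset.range T, s n ≤ g / 2 * √T := by
    have := sum_mul_abs_le (z := fun _ => 1) (b := √T) hs0 (by positivity) (by positivity) hS2
      (by simp [hTsq])
    simpa using this
  have hsq' : ∀ z : ℕ → ℝ, (∑ n ∈ Finset.range T, logWeight n * z n ^ 8 ≤ A) →
      ∑ n ∈ Finset.range T, s n * |z n| ≤ κ / 2 * R := fun z hz => by
    have h1 := sum_mul_abs_le (b := κ * (√T * B)) hs0 (by positivity) (by positivity) hS2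
      ((hsq z hz).trans_eq (by rw [mul_pow, mul_pow, hTsq, hB, Real.sq_sqrt hβ]))
    refine h1.trans_eq ?_
    rw [hR]
    ring
  have hSζ := hsq' ζ (h.mean_error T)
  have hSe := hsq' e (h.noise T)
  have hwζ : ∑ n ∈ Finset.range T, logWeight n * |ζ n| ≤ h0 + A := by
    calc ∑ n ∈ Finset.range T, logWeight n * |ζ n|
        ≤ ∑ n ∈ Finset.range T, (logWeight n + logWeight n * ζ n ^ 8) := by
          refine Finset.sum_le_sum fun n _ => ?_
          have h1 : |ζ n| ≤ 1 + ζ n ^ 8 := by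
            have h2 : ζ n ^ 8 = |ζ n| ^ 8 := ((by decide : Even 8).pow_abs _).symm
            rw [h2]
            rcases le_total |ζ n| 1 with h3 | h3
            · have : 0 ≤ |ζ n| ^ 8 := by positivity
              linarith
            · have := le_self_pow₀ h3 (by norm_num : 8 ≠ 0)
              linarith
          have := mul_le_mul_of_nonneg_left h1 (hw0 n).le
          linarith
      _ ≤ h0 + A := by
          rw [Finset.sum_add_distrib]
          exact add_le_add (sum_logWeight_le T) (h.mean_error T)
  have hbs : ∑ n ∈ Finset.range T, b n * s n ≤ R / 2 := by
    calc ∑ n ∈ Finset.range T, b n * s n ≤ ∑ n ∈ Finset.range T, B * s n :=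
          Finset.sum_le_sum fun n hn => mul_le_mul_of_nonneg_right (hbB n hn) (hs0 n)
      _ = B * ∑ n ∈ Finset.range T, s n := by rw [Finset.mul_sum]
      _ ≤ B * (g / 2 * √T) := mul_le_mul_of_nonneg_left hS1 hB0
      _ = R / 2 := by rw [hR]; ring
  have hbw : ∑ n ∈ Finset.range T, b n * logWeight n ≤ b T * h0 := by
    calc ∑ n ∈ Finset.range T, b n * logWeight n ≤ ∑ n ∈ Finset.range T, b T * logWeight n :=
          Finset.sum_le_sum fun n hn => mul_le_mul_of_nonneg_right
            (hbm (Finset.mem_range.1 hn).le) (hw0 n).le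
      _ = b T * ∑ n ∈ Finset.range T, logWeight n := by rw [Finset.mul_sum]
      _ ≤ _ := mul_le_mul_of_nonneg_left (sum_logWeight_le T) (hb0 T)
  have hbq : ∑ n ∈ Finset.range T, b n * (s n * shrinkage k σ x n) ≤
      ρ ^ 2 / (2 * σ ^ 2) * R + b T * M := by
    have hsq0 : ∀ n, 0 ≤ s n * shrinkage k σ x n := fun n =>
      mul_nonneg (hs0 n) (shrinkage_nonneg x n)
    calc ∑ n ∈ Finset.range T, b n * (s n * shrinkage k σ x n)
        ≤ ∑ n ∈ Finset.range T, B * (s n * shrinkage k σ x n) :=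
          Finset.sum_le_sum fun n hn => mul_le_mul_of_nonneg_right (hbB n hn) (hsq0 n)
      _ = B * ∑ n ∈ Finset.range T, s n * shrinkage k σ x n := by rw [Finset.mul_sum]
      _ ≤ B * (ρ ^ 2 / σ ^ 2 * (g / 2 * √T) + M) := by
          refine mul_le_mul_of_nonneg_left
            ((sum_predSd_mul_shrinkage_le hk hσ hk1 hρ hM).trans ?_) hB0
          gcongr
      _ = ρ ^ 2 / (2 * σ ^ 2) * R + B * M := by rw [hR]; field_simp
      _ ≤ _ := by gcongr
  -- the gaps of the surrogate objectives
  set W : ℕ → ℝ := fun n => 2 * (s n * |f (x n) + e n - meanAt k σ x y n (x n)| / σ ^ 2) +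
    b n * (s n * shrinkage k σ x n) + (b (n + 1) - b n) with hW
  have hW0 : ∀ n, 0 ≤ W n := fun n => by
    have h1 : 0 ≤ b (n + 1) - b n := sub_nonneg.2 (hbm n.le_succ)
    have h2 := mul_nonneg (hb0 n) (mul_nonneg (hs0 n) (shrinkage_nonneg (k := k) (σ := σ) x n))
    have h3 : 0 ≤ s n * |f (x n) + e n - meanAt k σ x y n (x n)| / σ ^ 2 := by
      have := hs0 n
      positivity
    simp only [hW]
    linarith
  have hWsum : ∑ n ∈ Finset.range T, W n ≤ κ * (2 + h0) / σ ^ 2 * R +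
      (ρ ^ 2 / (2 * σ ^ 2) * R + b T * M) + b T := by
    have h1 : ∑ n ∈ Finset.range T,
        2 * (s n * |f (x n) + e n - meanAt k σ x y n (x n)| / σ ^ 2) ≤
        κ * (2 + h0) / σ ^ 2 * R := by
      calc _ ≤ ∑ n ∈ Finset.range T,
            2 / σ ^ 2 * ((1 + h0) * (s n * |ζ n|) + s n * |e n|) := by
            refine Finset.sum_le_sum fun n _ => ?_
            have h2 : |f (x n) + e n - meanAt k σ x y n (x n)| ≤ (1 + h0) * |ζ n| + |e n| := by
              have h3 : f (x n) + e n - meanAt k σ x y n (x n) =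
                  (f (x n) - meanAt k σ x y n (x n)) + e n := by ring
              rw [h3]
              refine (abs_add_le _ _).trans ?_
              rw [h.abs_sub_meanAt]
              have h4 : predSd k σ x n + logWeight n ≤ 1 + h0 := add_le_add (hs1 n) (hwh n)
              have := mul_le_mul_of_nonneg_right h4 (abs_nonneg (ζ n))
              linarith
            have h3 := mul_le_mul_of_nonneg_left h2 (hs0 n)
            rw [mul_div_assoc', div_mul_eq_mul_div]
            refine div_le_div_of_nonneg_right ?_ (by positivity)
            linarith
        _ = 2 / σ ^ 2 * ((1 + h0) * ∑ n ∈ Finset.range T, s n * |ζ n| +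
              ∑ n ∈ Finset.range T, s n * |e n|) := by
            rw [← Finset.mul_sum, Finset.sum_add_distrib, ← Finset.mul_sum]
        _ ≤ 2 / σ ^ 2 * ((1 + h0) * (κ / 2 * R) + κ / 2 * R) := by gcongr
        _ = _ := by ring
    have h2 : ∑ n ∈ Finset.range T, (b (n + 1) - b n) ≤ b T := by
      rw [Finset.sum_range_sub]
      linarith [hb0 0]
    simp only [hW, Finset.sum_add_distrib]
    linarith
  have hgap := sum_le_of_linear_recursion (e := surrogateGap k σ b V x y) (Δ := Δ) (W := W)
    (E₁ := C + b 0) hη hη1 (add_nonneg hC (hb0 0)) (h.surrogateGap_zero_le hk hσ hk1 hb0 y) hW0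
    (h.surrogateGap_succ_le hk hσ hk1 hη hb0 hbm) T
  -- the regret of the single steps
  have hstep : ∀ n ∈ Finset.range T, (⨆ z, (V n z + f z)) - (V n (x n) + f (x n)) ≤
      (if n < N then C else 0) + (surrogateGap k σ b V x y n + b n * s n +
        (s n * |ζ n| + logWeight n * |ζ n|) + C * (1 / ((n : ℝ) + 1)) + b n * logWeight n) :=
      fun n _ => by
    split_ifs with hn
    · have h1 := h.iSup_objective_sub_le n
      have h2 := h.surrogateGap_nonneg hk hσ hk1 hb0 y n
      have h3 := mul_nonneg (hb0 n) (hs0 n)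
      have h4 := mul_nonneg (hs0 n) (abs_nonneg (ζ n))
      have h5 := mul_nonneg (hw0 n).le (abs_nonneg (ζ n))
      have h6 : 0 ≤ C * (1 / ((n : ℝ) + 1)) := by positivity
      have h7 := mul_nonneg (hb0 n) (hw0 n).le
      linarith
    · have h1 := h.regret_step_le hk hσ hk1 hb0 (not_lt.1 hn)
      rw [add_mul, div_eq_mul_one_div C] at h1
      linarith
  refine (Finset.sum_le_sum hstep).trans ?_
  simp only [Finset.sum_add_distrib]
  have hN : (∑ n ∈ Finset.range T, if n < N then C else 0) ≤ C * N := by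
    rw [← Finset.sum_filter, Finset.sum_const, nsmul_eq_mul, mul_comm]
    refine mul_le_mul_of_nonneg_left ?_ hC
    have : ((Finset.range T).filter fun n => n < N) ⊆ Finset.range N := fun n hn =>
      Finset.mem_range.2 (Finset.mem_filter.1 hn).2
    exact_mod_cast (Finset.card_le_card this).trans_eq (Finset.card_range N)
  have hharm : ∑ n ∈ Finset.range T, C * (1 / ((n : ℝ) + 1)) ≤ C * (1 + Real.log T) := by
    rw [← Finset.mul_sum]
    exact mul_le_mul_of_nonneg_left (sum_one_div_le T) hC
  have hdiv : (C + b 0 + ∑ n ∈ Finset.range T, W n) / (1 - η) ≤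
      R * ((κ * (2 + h0) / σ ^ 2 + ρ ^ 2 / (2 * σ ^ 2)) / (1 - η)) +
        (C + b 0 + b T * M + b T) / (1 - η) := by
    rw [mul_div_assoc', ← add_div]
    refine div_le_div_of_nonneg_right ?_ hηpos.le
    linarith
  rw [hReq]
  linarith

/-- The regret bound along typical paths, with an error of logarithmic order that does not depend
on the path. -/
theorem exists_forall_isGoodPath_sum_regret_le [Nonempty E]
    (hk : ∀ x y, k x y = inner ℝ (Φ x) (Φ y)) (hσ : 0 < σ) (hk1 : ∀ x, k x x ≤ 1)
    (hΦ : TotallyBounded (Set.range Φ)) (hη : 0 ≤ η) (hη1 : η < 1) (hc : 0 < c) (hC : 0 ≤ C)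
    (hA : 0 ≤ A) (β₁ : ℝ) (N : ℕ) :
    ∃ K : ℝ, 0 ≤ K ∧ ∀ (V : ℕ → E → ℝ) (Δ : ℕ → ℝ) (f : E → ℝ) (x : ℕ → E) (e : ℕ → ℝ),
      IsGoodPath k σ η (exploration c β₁) V Δ f x e C A N → (∀ n, 0 ≤ Δ n) →
      ∀ T : ℕ, 1 ≤ T → ∀ γ : ℝ, infoGain k σ (fun i : Fin T => x i) ≤ γ →
        ∑ n ∈ Finset.range T, ((⨆ z, (V n z + f z)) - (V n (x n) + f (x n))) ≤
          √(C₁ σ * T * (c * Real.log T + β₁) * γ) + K * (1 + Real.log T) +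
            2 * ∑ n ∈ Finset.range T, discounted η Δ n := by
  have hηpos : 0 < 1 - η := by linarith
  have hl2 : 0 < Real.log 2 := Real.log_pos one_lt_two
  -- the constants are chosen so that the coefficient of the main term becomes `1`
  set ρ : ℝ := √(σ ^ 2 * (1 - η) / 2) with hρ
  have hρpos : 0 < ρ := Real.sqrt_pos.2 (by positivity)
  have hρsq : ρ ^ 2 = σ ^ 2 * (1 - η) / 2 := Real.sq_sqrt (by positivity)
  set a : ℝ := 1 / 2 + (2 + 1 / Real.log 2) / σ ^ 2 / (1 - η) with ha
  have hapos : 0 < a := by positivity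
  set κ : ℝ := 1 / (4 * a) with hκ
  have hκpos : 0 < κ := by positivity
  have hcoef : 1 / 2 + κ / 2 +
      (κ * (2 + 1 / Real.log 2) / σ ^ 2 + ρ ^ 2 / (2 * σ ^ 2)) / (1 - η) = 1 := by
    have h1 : κ / 2 + κ * (2 + 1 / Real.log 2) / σ ^ 2 / (1 - η) = 1 / 4 := by
      have : κ / 2 + κ * (2 + 1 / Real.log 2) / σ ^ 2 / (1 - η) = κ * a := by rw [ha]; ring
      rw [this, hκ]
      field_simp
    have h2 : ρ ^ 2 / (2 * σ ^ 2) / (1 - η) = 1 / 4 := by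
      rw [hρsq]
      field_simp
      norm_num
    rw [add_div]
    linarith
  obtain ⟨M, hM⟩ := exists_card_filter_lt_predSd_le hk hσ hΦ hρpos
  have hlog : Tendsto (fun T : ℕ => c * Real.log T + β₁) atTop atTop :=
    tendsto_atTop_add_const_right _ _
      ((Real.tendsto_log_atTop.comp tendsto_natCast_atTop_atTop).const_mul_atTop hc)
  obtain ⟨T₁, hT₁⟩ := eventually_atTop.1 ((eventually_sum_sq_le (A := A) (β₁ := β₁) hc
    (by positivity : 0 < κ ^ 2)).and (hlog.eventually_ge_atTop 0))
  set b := exploration c β₁ with hb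
  have hb0 : ∀ n, 0 ≤ b n := exploration_nonneg c β₁
  set Kb : ℝ := 1 + 2 * c + |β₁| with hKb
  have hKb0 : 0 ≤ Kb := by positivity
  set K : ℝ := C * T₁ + (C * N + 1 / Real.log 2 + A + C + Kb * (1 / Real.log 2) +
    (C + b 0 + Kb * M + Kb) / (1 - η)) with hK
  have hCT : 0 ≤ C * T₁ := by positivity
  have hCN : 0 ≤ C * N := by positivity
  have hrest : 0 ≤ (C + b 0 + Kb * M + Kb) / (1 - η) := by
    have := hb0 0
    positivity
  have hKl : 0 ≤ Kb * (1 / Real.log 2) := by positivity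
  have hl2' : 0 ≤ 1 / Real.log 2 := by positivity
  refine ⟨K, by linarith, fun V Δ f x e h hΔ T hT γ hγ => ?_⟩
  have hT' : (1 : ℝ) ≤ T := by exact_mod_cast hT
  have hlT : 0 ≤ Real.log T := Real.log_nonneg hT'
  have hdisc : 0 ≤ ∑ n ∈ Finset.range T, discounted η Δ n :=
    Finset.sum_nonneg fun n _ => discounted_nonneg hη hΔ n
  rcases lt_or_ge T T₁ with hlt | hge
  · have h1 : ∑ n ∈ Finset.range T, ((⨆ z, (V n z + f z)) - (V n (x n) + f (x n))) ≤ C * T := by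
      refine (Finset.sum_le_sum fun n _ => h.iSup_objective_sub_le n).trans_eq ?_
      simp [mul_comm]
    have h2 : C * T ≤ C * T₁ := by gcongr
    have h3 : K ≤ K * (1 + Real.log T) := le_mul_of_one_le_right (by linarith) (by linarith)
    have h4 := Real.sqrt_nonneg (C₁ σ * T * (c * Real.log T + β₁) * γ)
    linarith
  · obtain ⟨h1, h2⟩ := hT₁ T hge
    have h3 := h.sum_regret_le hk hσ hk1 hη hη1 hc hC hρpos hκpos.le hT (hM x T) h2 h1 hγ
    rw [hcoef, mul_one] at h3
    refine h3.trans ?_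
    have hbT : b T ≤ Kb * (1 + Real.log T) := exploration_le hc β₁ hT
    set l := 1 + Real.log T with hl
    have hl1 : 1 ≤ l := by linarith
    have h4 : C * N + 1 / Real.log 2 + A ≤ (C * N + 1 / Real.log 2 + A) * l :=
      le_mul_of_one_le_right (by linarith) hl1
    have h5 : b T * (1 / Real.log 2) ≤ Kb * l * (1 / Real.log 2) := by gcongr
    have h6 : (C + b 0 + b T * M + b T) / (1 - η) ≤
        (C + b 0 + Kb * M + Kb) / (1 - η) * l := by
      rw [div_mul_eq_mul_div]
      refine div_le_div_of_nonneg_right ?_ hηpos.le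
      have h7 : C + b 0 ≤ (C + b 0) * l :=
        le_mul_of_one_le_right (add_nonneg hC (hb0 0)) hl1
      have h8 : b T * M ≤ Kb * l * M := by gcongr
      linarith
    have h7 : 0 ≤ C * T₁ * l := by positivity
    rw [hK]
    linarith

end CumulativeRegret

/-! ### Lipschitz bounds from partial derivatives -/

section Lipschitz

variable {d : ℕ} {D : Set (EuclideanSpace ℝ (Fin d))}

lemma norm_fderiv_le_of_partialDeriv {f : EuclideanSpace ℝ (Fin d) → ℝ}
    {x : EuclideanSpace ℝ (Fin d)} {M : ℝ} (hM : 0 ≤ M) (h : ∀ j, |partialDeriv f j x| ≤ M) :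
    ‖fderiv ℝ f x‖ ≤ d * M := by
  refine ContinuousLinearMap.opNorm_le_bound _ (by positivity) fun v => ?_
  have hv : v = ∑ j, v j • EuclideanSpace.single j (1 : ℝ) := by
    ext i
    simp [Finset.sum_apply, Pi.single_apply]
  have h1 : fderiv ℝ f x v = ∑ j, v j * partialDeriv f j x := by
    conv_lhs => rw [hv]
    simp [partialDeriv]
  rw [h1, Real.norm_eq_abs]
  calc |∑ j, v j * partialDeriv f j x| ≤ ∑ j, |v j * partialDeriv f j x| :=
        Finset.abs_sum_le_sum_abs _ _
    _ ≤ ∑ _j : Fin d, ‖v‖ * M := by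
        refine Finset.sum_le_sum fun j _ => ?_
        rw [abs_mul]
        exact mul_le_mul (PiLp.norm_apply_le v j) (h j) (abs_nonneg _) (norm_nonneg _)
    _ = d * M * ‖v‖ := by simp; ring

lemma abs_sub_le_of_partialDeriv (hD : Convex ℝ D) {f : EuclideanSpace ℝ (Fin d) → ℝ}
    (hf : ∀ x ∈ D, DifferentiableAt ℝ f x) {M : ℝ} (hM : 0 ≤ M)
    (h : ∀ x ∈ D, ∀ j, |partialDeriv f j x| ≤ M) {x y : EuclideanSpace ℝ (Fin d)} (hx : x ∈ D)
    (hy : y ∈ D) : |f y - f x| ≤ d * M * ‖y - x‖ :=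
  hD.norm_image_sub_le_of_norm_hasFDerivWithin_le
    (fun z hz => (hf z hz).hasFDerivAt.hasFDerivWithinAt)
    (fun z hz => norm_fderiv_le_of_partialDeriv hM (h z hz)) hx hy

lemma norm_le_of_forall_abs_le {v : EuclideanSpace ℝ (Fin d)} {c : ℝ}
    (h : ∀ j, |v j| ≤ c) : ‖v‖ ≤ d * c := by
  have hv : v = ∑ j, EuclideanSpace.single j (v j) := by
    ext i
    simp [Finset.sum_apply, Pi.single_apply]
  rw [hv]
  refine (norm_sum_le _ _).trans ?_
  calc ∑ j, ‖EuclideanSpace.single j (v j)‖ ≤ ∑ _j : Fin d, c :=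
        Finset.sum_le_sum fun j _ => by simpa using h j
    _ = d * c := by simp

/-- A finite net of a subset of the cube `[0, r]ᵈ`, with at most one point in each cell of a grid
of width `r / n`. -/
lemma exists_net {r : ℝ} (hr : 0 < r) (hD : D.Nonempty)
    (hcube : ∀ x ∈ D, ∀ j : Fin d, 0 ≤ x j ∧ x j ≤ r) {n : ℕ} (hn : 0 < n) :
    ∃ q : (Fin d → Fin (n + 1)) → D, ∀ x : D, ∃ c, ‖(x : EuclideanSpace ℝ (Fin d)) - q c‖ ≤
      d * (r / n) := by
  classical
  have hn' : (0 : ℝ) < n := by exact_mod_cast hn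
  let cell : D → Fin d → Fin (n + 1) := fun x j =>
    ⟨min n ⌊(x : EuclideanSpace ℝ (Fin d)) j * n / r⌋₊, by omega⟩
  have hfloor : ∀ (x : D) j, ((cell x j : ℕ) : ℤ) = ⌊(x : EuclideanSpace ℝ (Fin d)) j * n / r⌋ :=
      fun x j => by
    obtain ⟨h0, h1⟩ := hcube x x.2 j
    have h2 : (x : EuclideanSpace ℝ (Fin d)) j * n / r ≤ n := by
      rw [div_le_iff₀ hr, mul_comm]
      exact mul_le_mul_of_nonneg_left h1 hn'.le
    have h3 : ⌊(x : EuclideanSpace ℝ (Fin d)) j * n / r⌋₊ ≤ n := by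
      have := Nat.floor_le_floor h2
      rwa [Nat.floor_natCast] at this
    have h4 : (cell x j : ℕ) = ⌊(x : EuclideanSpace ℝ (Fin d)) j * n / r⌋₊ := min_eq_right h3
    rw [h4]
    exact Int.natCast_floor_eq_floor (by positivity)
  let x₀ : D := ⟨hD.some, hD.some_mem⟩
  refine ⟨fun c => if h : ∃ x, cell x = c then h.choose else x₀, fun x => ⟨cell x, ?_⟩⟩
  have hex : ∃ z, cell z = cell x := ⟨x, rfl⟩
  simp only [dif_pos hex]
  set z := hex.choose with hz
  have hzx : cell z = cell x := hex.choose_spec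
  refine norm_le_of_forall_abs_le fun j => ?_
  have h1 : ⌊(x : EuclideanSpace ℝ (Fin d)) j * n / r⌋ =
      ⌊(z : EuclideanSpace ℝ (Fin d)) j * n / r⌋ := by
    rw [← hfloor, ← hfloor, hzx]
  have h2 := (Int.abs_sub_lt_one_of_floor_eq_floor h1).le
  have h3 : (x : EuclideanSpace ℝ (Fin d)) j * n / r - (z : EuclideanSpace ℝ (Fin d)) j * n / r =
      ((x : EuclideanSpace ℝ (Fin d)) j - (z : EuclideanSpace ℝ (Fin d)) j) * (n / r) := by ring
  rw [h3, abs_mul, abs_of_pos (by positivity : 0 < (n : ℝ) / r)] at h2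
  rw [PiLp.sub_apply, ← one_div_div, le_div_iff₀ (by positivity)]
  exact h2

end Lipschitz

/-! ### The Gaussian process on the decision set -/

section GaussianPaths

variable {d : ℕ} {Ω : Type*} [MeasurableSpace Ω] {P : Measure Ω}
  {D : Set (EuclideanSpace ℝ (Fin d))}
  {k : EuclideanSpace ℝ (Fin d) → EuclideanSpace ℝ (Fin d) → ℝ}
  {U : EuclideanSpace ℝ (Fin d) → Ω → ℝ} {a b : ℝ}

lemma HasDerivTails.continuous (hU' : HasDerivTails P D a b U) (ω : Ω) :
    Continuous fun x : D => U x ω :=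
  continuous_iff_continuousAt.2 fun x =>
    ((hU'.differentiable ω x x.2).continuousAt).comp continuous_subtype_val.continuousAt

lemma IsCenteredGP.memLp (hU : IsCenteredGP P D k U) (x : D) : MemLp (U x) 2 P :=
  (hU.gaussian.hasGaussianLaw_eval x).memLp_two

/-- The value of the process at `x` as an element of `L²`. -/
noncomputable def IsCenteredGP.feature (hU : IsCenteredGP P D k U) (x : D) : Lp ℝ 2 P :=
  (hU.memLp x).toLp

lemma IsCenteredGP.kernel_eq_inner (hU : IsCenteredGP P D k U) (x y : D) :
    k x y = inner ℝ (hU.feature x) (hU.feature y) := by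
  rw [← hU.cov_eq x x.2 y y.2, covariance, hU.mean_eq x x.2, hU.mean_eq y y.2, L2.inner_def]
  refine integral_congr_ae ?_
  filter_upwards [(hU.memLp x).coeFn_toLp, (hU.memLp y).coeFn_toLp] with ω h1 h2
  simp [IsCenteredGP.feature, h1, h2, mul_comm]

/-- Continuity of the sample paths implies mean square continuity, since for centred Gaussian
variables convergence in law entails convergence of the variances. -/
lemma IsCenteredGP.continuous_feature [IsProbabilityMeasure P] (hU : IsCenteredGP P D k U)
    (hU' : HasDerivTails P D a b U) : Continuous hU.feature := by
  refine continuous_iff_seqContinuous.2 fun s x hs => ?_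
  set v : ℕ → ℝ := fun n => Var[fun ω => U (s n) ω - U x ω; P] with hv
  have hlaw : ∀ n, HasGaussianLaw (fun ω => U (s n) ω - U x ω) P := fun n =>
    hU.gaussian.hasGaussianLaw_fun_sub
  have hmean : ∀ n, ∫ ω, (U (s n) ω - U x ω) ∂P = 0 := fun n => by
    rw [integral_sub ((hU.memLp _).integrable one_le_two) ((hU.memLp _).integrable one_le_two),
      hU.mean_eq _ (s n).2, hU.mean_eq _ x.2, sub_zero]
  have hmeas : ∀ n, Measurable fun ω => U (s n) ω - U x ω := fun n =>
    (hU.measurable _ (s n).2).sub (hU.measurable _ x.2)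
  have hv0 : ∀ n, 0 ≤ v n := fun n => variance_nonneg _ _
  have hnorm : ∀ n, ‖hU.feature (s n) - hU.feature x‖ ^ 2 = v n := fun n => by
    change _ = Var[fun ω => U (s n) ω - U x ω; P]
    rw [← real_inner_self_eq_norm_sq, ← covariance_self (hmeas n).aemeasurable, covariance,
      hmean, L2.inner_def]
    refine integral_congr_ae ?_
    filter_upwards [(hU.memLp (s n)).coeFn_toLp, (hU.memLp x).coeFn_toLp,
      Lp.coeFn_sub (hU.feature (s n)) (hU.feature x)] with ω h1 h2 h3
    rw [h3]
    simp [IsCenteredGP.feature, h1, h2]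
    ring
  have hcf : ∀ n, charFun (P.map fun ω => U (s n) ω - U x ω) 1 =
      ((Real.exp (-(v n) / 2) : ℝ) : ℂ) := fun n => by
    rw [(hlaw n).map_eq_gaussianReal, hmean, charFun_gaussianReal]
    simp [hv]
    ring_nf
  have hcf' : ∀ n, charFun (P.map fun ω => U (s n) ω - U x ω) 1 =
      ∫ ω, Complex.exp ((U (s n) ω - U x ω : ℝ) * Complex.I) ∂P := fun n => by
    rw [charFun_apply_real, integral_map (hmeas n).aemeasurable (by fun_prop)]
    simp
  have hlim : Tendsto (fun n => ∫ ω, Complex.exp ((U (s n) ω - U x ω : ℝ) * Complex.I) ∂P) atTop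
      (nhds (∫ _ω, (1 : ℂ) ∂P)) := by
    refine tendsto_integral_of_dominated_convergence (fun _ => 1) (fun n => ?_)
      (integrable_const _) (fun n => ae_of_all _ fun ω => ?_) (ae_of_all _ fun ω => ?_)
    · have := hmeas n
      exact Measurable.aestronglyMeasurable (by fun_prop)
    · rw [Complex.norm_exp_ofReal_mul_I]
    · have h1 : Tendsto (fun n => U (s n) ω - U x ω) atTop (nhds 0) := by
        have := ((hU'.continuous ω).tendsto x).comp hs
        simpa using this.sub_const (U x ω)
      have h2 : Continuous fun t : ℝ => Complex.exp ((t : ℂ) * Complex.I) := by fun_prop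
      have h3 := (h2.tendsto 0).comp h1
      simp only [Complex.ofReal_zero, zero_mul, Complex.exp_zero] at h3
      exact h3
  have hexp : Tendsto (fun n => Real.exp (-(v n) / 2)) atTop (nhds 1) := by
    have h1 : Tendsto (fun n => ((Real.exp (-(v n) / 2) : ℝ) : ℂ)) atTop (nhds ((1 : ℝ) : ℂ)) := by
      simp only [← hcf, hcf']
      simpa using hlim
    exact (Complex.continuous_re.tendsto _).comp h1
  have hvlim : Tendsto v atTop (nhds 0) := by
    have h1 := (hexp.log one_ne_zero).const_mul (-2)
    simp only [Real.log_exp, Real.log_one, mul_zero] at h1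
    refine h1.congr fun n => ?_
    ring
  rw [tendsto_iff_norm_sub_tendsto_zero]
  have h1 := hvlim.sqrt
  simp only [Real.sqrt_zero] at h1
  refine h1.congr fun n => ?_
  rw [← hnorm, Real.sqrt_sq (norm_nonneg _)]
  rfl

lemma IsCenteredGP.measurable_kernel [IsProbabilityMeasure P] (hU : IsCenteredGP P D k U)
    (hU' : HasDerivTails P D a b U) :
    Measurable (Function.uncurry fun x y : D => k x y) := by
  have h1 : (Function.uncurry fun x y : D => k x y) =
      fun q : D × D => inner ℝ (hU.feature q.1) (hU.feature q.2) :=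
    funext fun q => hU.kernel_eq_inner q.1 q.2
  have h2 := hU.continuous_feature hU'
  rw [h1]
  exact Continuous.measurable (by fun_prop)

lemma IsCenteredGP.totallyBounded_range_feature [IsProbabilityMeasure P] (hU : IsCenteredGP P D k U)
    (hU' : HasDerivTails P D a b U) (hD : IsCompact D) :
    TotallyBounded (Set.range hU.feature) := by
  have := isCompact_iff_compactSpace.1 hD
  exact (isCompact_range (hU.continuous_feature hU')).totallyBounded

end GaussianPaths

/-! ### Runs of the algorithm as adaptive designs -/

section Run

variable {d : ℕ} {Ω : Type*} [MeasurableSpace Ω] {P : Measure Ω}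
  {D : Set (EuclideanSpace ℝ (Fin d))} {V : EuclideanSpace ℝ (Fin d) → ℝ → ℝ} {t : ℕ → ℝ}
  {k : EuclideanSpace ℝ (Fin d) → EuclideanSpace ℝ (Fin d) → ℝ} {β : ℕ → ℝ}
  {U : EuclideanSpace ℝ (Fin d) → Ω → ℝ} {ε : ℕ → Ω → ℝ} {a b σ η : ℝ}
  {X : ℕ → Ω → EuclideanSpace ℝ (Fin d)}

/-- The continuous functions on `D`, with the `σ`-algebra generated by the evaluations. -/
abbrev ContinuousPath (D : Set (EuclideanSpace ℝ (Fin d))) := {f : D → ℝ // Continuous f}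

lemma measurable_eval_continuousPath :
    Measurable (Function.uncurry fun (f : ContinuousPath D) (x : D) => (f : D → ℝ) x) := by
  have h : Measurable (Function.uncurry fun (x : D) (f : ContinuousPath D) => (f : D → ℝ) x) :=
    measurable_uncurry_of_continuous_of_measurable (fun f => f.2)
      fun x => (measurable_pi_apply x).comp measurable_subtype_coe
  exact h.comp measurable_swap

/-- The restriction of a sample path to `D`. -/
def HasDerivTails.path (hU' : HasDerivTails P D a b U) (ω : Ω) : ContinuousPath D :=
  ⟨fun x => U x ω, hU'.continuous ω⟩

/-- The point of step `n`, counted from `0`. -/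
def IsRun.point (hX : IsRun P D V t k σ β η U ε X) (n : ℕ) (ω : Ω) : D :=
  ⟨X (n + 1) ω, hX.mem (n + 1) n.succ_pos ω⟩

lemma HasDerivTails.measurable_path (hU' : HasDerivTails P D a b U) (hU : IsCenteredGP P D k U) :
    Measurable hU'.path :=
  (measurable_pi_lambda _ fun x : D => hU.measurable x x.2).subtype_mk

lemma IsNoise.map_path_noise [IsProbabilityMeasure P] (hε : IsNoise P D σ U ε)
    (hU' : HasDerivTails P D a b U) (hU : IsCenteredGP P D k U) (m : ℕ) :
    P.map (fun ω => (hU'.path ω, fun i : Fin m => ε (i + 1) ω)) =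
      (P.map hU'.path).prod (Measure.pi fun _ : Fin m => gaussianReal 0 (σ ^ 2).toNNReal) := by
  have h1 : IndepFun hU'.path (fun ω (i : Fin m) => ε (i + 1) ω) P := by
    have h2 := hε.indep_U.comp (φ := id) (ψ := fun (v : ℕ → ℝ) (i : Fin m) => v (i + 1))
      measurable_id (measurable_pi_lambda _ fun i => measurable_pi_apply _)
    rw [IndepFun_iff_Indep] at h2 ⊢
    refine indep_of_indep_of_le_left h2 ?_
    change MeasurableSpace.comap hU'.path (MeasurableSpace.comap Subtype.val MeasurableSpace.pi) ≤ _
    rw [MeasurableSpace.comap_comp]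
    exact le_rfl
  have h3 : iIndepFun (fun (i : Fin m) => ε (i + 1)) P :=
    hε.indep.precomp (g := fun i : Fin m => (i : ℕ) + 1) fun i j hij => by
      simpa [Fin.ext_iff] using hij
  rw [(indepFun_iff_map_prod_eq_prod_map_map (hU'.measurable_path hU).aemeasurable
      (measurable_pi_lambda _ fun i => hε.measurable _).aemeasurable).1 h1,
    (iIndepFun_iff_map_fun_eq_pi_map fun i => (hε.measurable _).aemeasurable).1 h3]
  simp only [hε.law]

/-- A run of the algorithm, with steps counted from `0`, is an adaptive design. -/
lemma IsRun.exists_isAdaptiveDesign [IsProbabilityMeasure P] (hX : IsRun P D V t k σ β η U ε X)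
    (hD : IsCompact D) (hDne : D.Nonempty) (hU : IsCenteredGP P D k U)
    (hU' : HasDerivTails P D a b U) (hε : IsNoise P D σ U ε) :
    ∃ ξ : ∀ n : ℕ, (Fin n → ℝ) → D, IsAdaptiveDesign P hU'.path (fun f x => (f : D → ℝ) x) σ
      (fun n => ε (n + 1)) (fun n => feedback U ε X (n + 1)) hX.point ξ := by
  have : StandardBorelSpace D := hD.isClosed.measurableSet.standardBorel
  have : Nonempty D := hDne.to_subtype
  have hrule : ∀ n : ℕ, ∃ g : (Fin n → ℝ) → D, Measurable g ∧
      hX.point n = g ∘ fun ω (i : Fin n) => feedback U ε X (i + 1) ω := fun n => by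
    refine Measurable.exists_eq_measurable_comp ?_
    have h1 : Measurable[MeasurableSpace.comap
        (fun ω (i : Fin n) => feedback U ε X (i + 1) ω) MeasurableSpace.pi] (X (n + 1)) := by
      refine (hX.predictable (n + 1) n.succ_pos).mono (iSup₂_le fun i hi => ?_) le_rfl
      obtain ⟨h1, h2⟩ := Finset.mem_Icc.1 hi
      obtain ⟨j, rfl⟩ : ∃ j, i = j + 1 := ⟨i - 1, by omega⟩
      have h3 : feedback U ε X (j + 1) = (fun v : Fin n → ℝ => v ⟨j, by omega⟩) ∘
          fun ω (i : Fin n) => feedback U ε X (i + 1) ω := rfl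
      rw [h3, ← MeasurableSpace.comap_comp]
      exact MeasurableSpace.comap_mono (measurable_pi_apply _).comap_le
    exact h1.subtype_mk
  choose ξ hξ hpoint using hrule
  exact ⟨ξ,
    { measurable_source := hU'.measurable_path hU
      measurable_fun := measurable_eval_continuousPath
      measurable_noise := fun n => hε.measurable _
      measurable_rule := hξ
      law := hε.map_path_noise hU' hU
      point_eq := fun n ω => congrFun (hpoint n) ω
      observation_eq := fun n ω => rfl }⟩

end Run

/-! ### Moments and tails -/

section Tails

open scoped ENNReal

variable {Ω : Type*} [MeasurableSpace Ω] {P : Measure Ω}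

lemma pow_eight_le (x : ℝ) : x ^ 8 ≤ (Nat.factorial 8) * (Real.exp x + Real.exp (-x)) := by
  have h1 : ∀ z : ℝ, 0 ≤ z → z ^ 8 ≤ (Nat.factorial 8) * Real.exp z := fun z hz => by
    have := Real.pow_div_factorial_le_exp z hz 8
    rwa [div_le_iff₀ (by positivity), mul_comm] at this
  rcases le_total 0 x with hx | hx
  · refine (h1 x hx).trans ?_
    gcongr
    linarith [Real.exp_pos (-x)]
  · have h2 := h1 (-x) (by linarith)
    rw [Even.neg_pow (by decide)] at h2
    refine h2.trans ?_
    gcongr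
    linarith [Real.exp_pos x]

lemma lintegral_pow_eight_le {f : Ω → ℝ} (hf : Measurable f) {M : ℝ} (hM : 0 ≤ M)
    (h : ∀ θ : ℝ, |θ| = 1 → ∫⁻ ω, ENNReal.ofReal (Real.exp (θ * f ω)) ∂P ≤ ENNReal.ofReal M) :
    ∫⁻ ω, ENNReal.ofReal (f ω ^ 8) ∂P ≤ ENNReal.ofReal ((Nat.factorial 8) * (2 * M)) := by
  have h1 := h 1 (by simp)
  have h2 := h (-1) (by simp)
  calc ∫⁻ ω, ENNReal.ofReal (f ω ^ 8) ∂P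
      ≤ ∫⁻ ω, ENNReal.ofReal (Nat.factorial 8) * (ENNReal.ofReal (Real.exp (1 * f ω)) +
          ENNReal.ofReal (Real.exp (-1 * f ω))) ∂P := by
        refine lintegral_mono fun ω => ?_
        rw [← ENNReal.ofReal_add (Real.exp_pos _).le (Real.exp_pos _).le,
          ← ENNReal.ofReal_mul (by positivity)]
        refine ENNReal.ofReal_le_ofReal ?_
        simpa using pow_eight_le (f ω)
    _ = ENNReal.ofReal (Nat.factorial 8) * (∫⁻ ω, ENNReal.ofReal (Real.exp (1 * f ω)) ∂P +
          ∫⁻ ω, ENNReal.ofReal (Real.exp (-1 * f ω)) ∂P) := by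
        rw [lintegral_const_mul _ (by fun_prop), lintegral_add_left (by fun_prop)]
    _ ≤ ENNReal.ofReal (Nat.factorial 8) * (ENNReal.ofReal M + ENNReal.ofReal M) := by gcongr
    _ = _ := by
        rw [← ENNReal.ofReal_add hM hM, ← ENNReal.ofReal_mul (by positivity), two_mul]

/-- Chernoff's bound for a standardized sub-Gaussian variable. -/
lemma measure_lt_le_of_lintegral_exp {f : Ω → ℝ} (hf : Measurable f)
    (h : ∀ θ : ℝ, ∫⁻ ω, ENNReal.ofReal (Real.exp (θ * f ω)) ∂P ≤
      ENNReal.ofReal (Real.exp (θ ^ 2 / 2))) {s : ℝ} (hs : 0 ≤ s) :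
    P {ω | s < f ω} ≤ ENNReal.ofReal (Real.exp (-s ^ 2 / 2)) := by
  have h1 : P {ω | s < f ω} ≤
      P {ω | ENNReal.ofReal (Real.exp (s * s)) ≤ ENNReal.ofReal (Real.exp (s * f ω))} := by
    refine measure_mono fun ω hω => ENNReal.ofReal_le_ofReal (Real.exp_le_exp.2 ?_)
    exact mul_le_mul_of_nonneg_left (le_of_lt hω) hs
  refine h1.trans ((meas_ge_le_lintegral_div (by fun_prop) ?_ ENNReal.ofReal_ne_top).trans ?_)
  · exact (ENNReal.ofReal_pos.2 (Real.exp_pos _)).ne'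
  · refine (ENNReal.div_le_div_right (h s) _).trans_eq ?_
    rw [← ENNReal.ofReal_div_of_pos (Real.exp_pos _), ← Real.exp_sub]
    congr 2
    ring

/-- If the eighth moments of a sequence are bounded, then its weighted sums of eighth powers are
bounded, with high probability. -/
lemma measure_exists_lt_sum_logWeight_le {f : ℕ → Ω → ℝ} (hf : ∀ n, Measurable (f n)) {M A : ℝ}
    (hM : 0 ≤ M) (hA : 0 < A)
    (h : ∀ n, ∫⁻ ω, ENNReal.ofReal (f n ω ^ 8) ∂P ≤ ENNReal.ofReal M) :
    P {ω | ∃ T : ℕ, A < ∑ n ∈ Finset.range T, logWeight n * f n ω ^ 8} ≤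
      ENNReal.ofReal (M / Real.log 2 / A) := by
  have hnn : ∀ n ω, 0 ≤ logWeight n * f n ω ^ 8 := fun n ω =>
    mul_nonneg (logWeight_pos n).le (Even.pow_nonneg (by decide) _)
  set g : Ω → ℝ≥0∞ := fun ω => ∑' n, ENNReal.ofReal (logWeight n * f n ω ^ 8) with hg
  have h1 : P {ω | ∃ T : ℕ, A < ∑ n ∈ Finset.range T, logWeight n * f n ω ^ 8} ≤
      P {ω | ENNReal.ofReal A ≤ g ω} := by
    refine measure_mono fun ω ⟨T, hT⟩ => ?_
    refine (ENNReal.ofReal_le_ofReal hT.le).trans ?_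
    rw [ENNReal.ofReal_sum_of_nonneg fun n _ => hnn n ω]
    exact ENNReal.sum_le_tsum _
  have h2 : ∫⁻ ω, g ω ∂P ≤ ENNReal.ofReal (M / Real.log 2) := by
    rw [lintegral_tsum fun n => by have := hf n; fun_prop, ENNReal.tsum_eq_iSup_nat]
    refine iSup_le fun T => ?_
    calc ∑ n ∈ Finset.range T, ∫⁻ ω, ENNReal.ofReal (logWeight n * f n ω ^ 8) ∂P
        ≤ ∑ n ∈ Finset.range T, ENNReal.ofReal (logWeight n * M) := by
          refine Finset.sum_le_sum fun n _ => ?_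
          simp only [ENNReal.ofReal_mul (logWeight_pos n).le]
          rw [lintegral_const_mul _ (by have := hf n; fun_prop)]
          gcongr
          exact h n
      _ = ENNReal.ofReal (∑ n ∈ Finset.range T, logWeight n * M) :=
          (ENNReal.ofReal_sum_of_nonneg fun n _ => mul_nonneg (logWeight_pos n).le hM).symm
      _ ≤ _ := by
          refine ENNReal.ofReal_le_ofReal ?_
          rw [← Finset.sum_mul, div_eq_inv_mul, inv_eq_one_div]
          exact mul_le_mul_of_nonneg_right (sum_logWeight_le T) hM
  refine h1.trans ((meas_ge_le_lintegral_div ?_ (ENNReal.ofReal_pos.2 hA).ne'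
    ENNReal.ofReal_ne_top).trans ?_)
  · exact (Measurable.tsum fun n => by have := hf n; fun_prop).aemeasurable
  · rw [ENNReal.ofReal_div_of_pos hA]
    exact ENNReal.div_le_div_right h2 _

lemma lintegral_exp_mul_of_map_eq_gaussianReal {f : Ω → ℝ} (hf : Measurable f) {σ : ℝ}
    (h : P.map f = gaussianReal 0 (σ ^ 2).toNNReal) (θ : ℝ) :
    ∫⁻ ω, ENNReal.ofReal (Real.exp (θ * f ω)) ∂P =
      ENNReal.ofReal (Real.exp (σ ^ 2 * θ ^ 2 / 2)) := by
  have h1 : ∫⁻ ω, ENNReal.ofReal (Real.exp (θ * f ω)) ∂P =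
      ∫⁻ z, ENNReal.ofReal (Real.exp (θ * z)) ∂gaussianReal 0 (σ ^ 2).toNNReal := by
    rw [← h, lintegral_map (by fun_prop) hf]
  rw [h1, ← ofReal_integral_eq_lintegral_ofReal (integrable_exp_mul_gaussianReal θ)
    (ae_of_all _ fun z => (Real.exp_pos _).le)]
  have h2 := congrFun (mgf_id_gaussianReal (μ := 0) (v := (σ ^ 2).toNNReal)) θ
  rw [mgf] at h2
  simp only [id] at h2
  rw [h2]
  simp [sq_nonneg]

end Tails

/-! ### The confidence parameters -/

section Beta

variable {d : ℕ} {a b r δ : ℝ}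

lemma one_lt_of_lt_two_mul (hδ : 0 < δ) (hδa : δ < 2 * d * a) : 1 < 4 * d * a / δ := by
  rw [lt_div_iff₀ hδ]
  linarith

lemma pos_dim_of_lt (hδ : 0 < δ) (hδa : δ < 2 * d * a) : 0 < d := by
  rcases Nat.eq_zero_or_pos d with rfl | h
  · simp at hδa
    linarith
  · exact h

lemma beta_eq (hr : 0 < r) (hb : 0 < b) (hδ : 0 < δ) (hδa : δ < 2 * d * a) {n : ℕ} (hn : 1 ≤ n) :
    beta d a b r δ n = (4 + 4 * d) * Real.log n + beta d a b r δ 1 := by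
  have hn' : (0 : ℝ) < n := by exact_mod_cast hn
  have hd : (0 : ℝ) < d := by exact_mod_cast pos_dim_of_lt hδ hδa
  have hs : 0 < √(Real.log (4 * d * a / δ)) :=
    Real.sqrt_pos.2 (Real.log_pos (one_lt_of_lt_two_mul hδ hδa))
  have h1 : Real.log (2 * (n : ℝ) ^ 2 * Real.pi ^ 2 / (3 * δ)) =
      2 * Real.log n + Real.log (2 * (1 : ℝ) ^ 2 * Real.pi ^ 2 / (3 * δ)) := by
    have h : 2 * (n : ℝ) ^ 2 * Real.pi ^ 2 / (3 * δ) =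
        (n : ℝ) ^ 2 * (2 * (1 : ℝ) ^ 2 * Real.pi ^ 2 / (3 * δ)) := by ring
    rw [h, Real.log_mul (by positivity) (by positivity), Real.log_pow]
    norm_num
  have h2 : Real.log (d * (n : ℝ) ^ 2 * b * r * √(Real.log (4 * d * a / δ))) =
      2 * Real.log n + Real.log (d * (1 : ℝ) ^ 2 * b * r * √(Real.log (4 * d * a / δ))) := by
    have h : d * (n : ℝ) ^ 2 * b * r * √(Real.log (4 * d * a / δ)) =
        (n : ℝ) ^ 2 * (d * (1 : ℝ) ^ 2 * b * r * √(Real.log (4 * d * a / δ))) := by ring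
    rw [h, Real.log_mul (by positivity) (by positivity), Real.log_pow]
    norm_num
  rw [beta, beta, Nat.cast_one, h1, h2]
  ring

lemma sqrt_beta_succ (hr : 0 < r) (hb : 0 < b) (hδ : 0 < δ) (hδa : δ < 2 * d * a) (n : ℕ) :
    √(beta d a b r δ (n + 1)) = exploration (4 + 4 * d) (beta d a b r δ 1) n := by
  rw [beta_eq hr hb hδ hδa (Nat.le_add_left 1 n), exploration]

/-- The probabilities of violation at the points of the `n`-th net are summable. -/
lemma card_mul_exp_exploration_le (d : ℕ) (β₁ : ℝ) (n : ℕ) :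
    ((n + 2) ^ d : ℕ) * Real.exp (-exploration (4 + 4 * d) β₁ n ^ 2 / 2) ≤
      2 ^ d * Real.exp (-β₁ / 2) * (1 / ((n + 1 : ℕ) : ℝ) ^ 2) := by
  set m : ℝ := ((n + 1 : ℕ) : ℝ) with hm
  have hm1 : 1 ≤ m := by simp [hm]
  have hm0 : 0 < m := by linarith
  have h1 : (4 + 4 * d) * Real.log m + β₁ ≤ exploration (4 + 4 * d) β₁ n ^ 2 := by
    rcases le_total 0 ((4 + 4 * d) * Real.log m + β₁) with h | h
    · rw [exploration, Real.sq_sqrt h]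
    · exact h.trans (sq_nonneg _)
  have h2 : Real.exp (-exploration (4 + 4 * d) β₁ n ^ 2 / 2) ≤
      Real.exp (-β₁ / 2) * (1 / m ^ (2 + 2 * d)) := by
    have h3 : Real.exp (-(((2 + 2 * d : ℕ) : ℝ) * Real.log m)) = 1 / m ^ (2 + 2 * d) := by
      rw [Real.exp_neg, ← Real.log_pow, Real.exp_log (by positivity), one_div]
    rw [← h3, ← Real.exp_add]
    refine Real.exp_le_exp.2 ?_
    push_cast
    linarith
  have h4 : (((n + 2) ^ d : ℕ) : ℝ) ≤ 2 ^ d * m ^ d := by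
    rw [← mul_pow]
    push_cast
    gcongr
    rw [hm]
    push_cast
    linarith
  have h5 : 1 / m ^ (2 + 2 * d) ≤ 1 / m ^ (2 + d) :=
    one_div_le_one_div_of_le (by positivity) (pow_le_pow_right₀ hm1 (by omega))
  calc _ ≤ 2 ^ d * m ^ d * (Real.exp (-β₁ / 2) * (1 / m ^ (2 + d))) := by
        gcongr
        exact h2.trans (by gcongr)
    _ = _ := by
        rw [pow_add]
        field_simp

end Beta

/-! ### The good event -/

section GoodEvent

open scoped ENNReal

variable {d : ℕ} {Ω : Type*} [MeasurableSpace Ω] {P : Measure Ω}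
  {D : Set (EuclideanSpace ℝ (Fin d))} {V : EuclideanSpace ℝ (Fin d) → ℝ → ℝ} {t : ℕ → ℝ}
  {k : EuclideanSpace ℝ (Fin d) → EuclideanSpace ℝ (Fin d) → ℝ} {β : ℕ → ℝ}
  {U : EuclideanSpace ℝ (Fin d) → Ω → ℝ} {ε : ℕ → Ω → ℝ} {a b r L σ η δ : ℝ}
  {X : ℕ → Ω → EuclideanSpace ℝ (Fin d)}

/-- With probability `1 - δ / 4` the partial derivatives of the sample path are bounded by
`b √(log(4da/δ))`. -/
lemma HasDerivTails.measure_exists_lt_le (hU' : HasDerivTails P D a b U) (ha : 0 < a) (hb : 0 < b)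
    (hδ : 0 < δ) (hδa : δ < 2 * d * a) :
    P {ω | ∃ j, ∃ x ∈ D, b * √(Real.log (4 * d * a / δ)) <
      |partialDeriv (fun x' => U x' ω) j x|} ≤ ENNReal.ofReal (δ / 4) := by
  have hd : (0 : ℝ) < d := by exact_mod_cast pos_dim_of_lt hδ hδa
  have h1 := one_lt_of_lt_two_mul hδ hδa
  have hlog := Real.log_pos h1
  have hexp : a * Real.exp (-(b * √(Real.log (4 * d * a / δ)) / b) ^ 2) = δ / (4 * d) := by
    rw [mul_div_cancel_left₀ _ hb.ne', Real.sq_sqrt hlog.le, Real.exp_neg,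
      Real.exp_log (by linarith)]
    field_simp
  rw [Set.ofPred_exists]
  refine (measure_iUnion_fintype_le P _).trans ?_
  refine (Finset.sum_le_sum fun j _ => hU'.tail j _ (mul_pos hb (Real.sqrt_pos.2 hlog))).trans ?_
  rw [hexp, Finset.sum_const, Finset.card_univ, Fintype.card_fin, nsmul_eq_mul,
    ← ENNReal.ofReal_natCast, ← ENNReal.ofReal_mul (by positivity)]
  refine (congrArg ENNReal.ofReal ?_).le
  field_simp

lemma IsRun.surrogateAt_eq (hX : IsRun P D V t k σ β η U ε X) {e : ℕ → ℝ}
    (he : ∀ n, √(β (n + 1)) = e n) (n : ℕ) (ω : Ω) (z : D) :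
    surrogateAt (fun x y : D => k x y) σ e (fun n z => V z (t (n + 1)))
        (fun i => hX.point i ω) (fun i => U (hX.point i ω) ω + ε (i + 1) ω) n z =
      surrogate V t k σ β U ε X (n + 1) ω z := by
  rw [surrogate, ucb, he]
  rfl

/-- The standardized errors of the posterior mean along a run are sub-Gaussian at predictable
points. -/
lemma IsAdaptiveDesign.lintegral_exp_path_stdError_le [IsProbabilityMeasure P]
    {hU' : HasDerivTails P D a b U} {x : ℕ → Ω → D} {e y : ℕ → Ω → ℝ}
    {ξ : ∀ n : ℕ, (Fin n → ℝ) → D}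
    (hξ : IsAdaptiveDesign P hU'.path (fun f x => (f : D → ℝ) x) σ e y x ξ)
    (hU : IsCenteredGP P D k U) (hσ : 0 < σ) {m : ℕ} {c : ℝ} (hc : 0 < c)
    {g : (Fin m → ℝ) → D} (hg : Measurable g) (θ : ℝ) :
    ∫⁻ ω, ENNReal.ofReal (Real.exp (θ * IsAdaptiveDesign.stdError (fun x y : D => k x y) σ hU'.path
        (fun f x => (f : D → ℝ) x) y x m c (fun ω => g fun i => y i ω) ω)) ∂P ≤
      ENNReal.ofReal (Real.exp (θ ^ 2 / 2)) :=
  hξ.lintegral_exp_stdError_le hσ hU.kernel_eq_inner (hU.measurable_kernel hU') hU.gaussian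
    (fun x => hU.mean_eq x x.2) (fun x y => hU.cov_eq x x.2 y y.2) hc hg θ

/-- From some step on, the upper confidence bounds hold at all points of finer and finer finite
nets, with probability `1 - δ / 4`; the step does not depend on the run. -/
lemma exists_forall_measure_exists_lt_stdError_le [IsProbabilityMeasure P] (hσ : 0 < σ)
    (hδ : 0 < δ) (hU : IsCenteredGP P D k U) (hU' : HasDerivTails P D a b U) (β₁ : ℝ)
    (q : ∀ n : ℕ, (Fin d → Fin (n + 2)) → D) :
    ∃ N : ℕ, ∀ (x : ℕ → Ω → D) (e y : ℕ → Ω → ℝ) (ξ : ∀ n : ℕ, (Fin n → ℝ) → D),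
      IsAdaptiveDesign P hU'.path (fun f x => (f : D → ℝ) x) σ e y x ξ →
      P {ω | ∃ n, N ≤ n ∧ ∃ c, exploration (4 + 4 * d) β₁ n <
        IsAdaptiveDesign.stdError (fun x y : D => k x y) σ hU'.path
          (fun f x => (f : D → ℝ) x) y x n (logWeight n) (fun _ => q n c) ω} ≤
        ENNReal.ofReal (δ / 4) := by
  set g : ℕ → ℝ := fun n => 2 ^ d * Real.exp (-β₁ / 2) * (1 / ((n + 1 : ℕ) : ℝ) ^ 2) with hg
  have hg0 : ∀ n, 0 ≤ g n := fun n => by positivity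
  have hsum : Summable g :=
    ((summable_nat_add_iff 1).2 (Real.summable_one_div_nat_pow.2 one_lt_two)).mul_left _
  obtain ⟨N, hN⟩ := ((tendsto_sum_nat_add g).eventually (gt_mem_nhds (by positivity :
    0 < δ / 4))).exists
  refine ⟨N, fun x e y ξ hξ => ?_⟩
  have hsub : {ω | ∃ n, N ≤ n ∧ ∃ c, exploration (4 + 4 * d) β₁ n <
        IsAdaptiveDesign.stdError (fun x y : D => k x y) σ hU'.path
          (fun f x => (f : D → ℝ) x) y x n (logWeight n) (fun _ => q n c) ω} ⊆
      ⋃ n, ⋃ c, {ω | exploration (4 + 4 * d) β₁ (n + N) <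
        IsAdaptiveDesign.stdError (fun x y : D => k x y) σ hU'.path
          (fun f x => (f : D → ℝ) x) y x (n + N) (logWeight (n + N))
          (fun _ => q (n + N) c) ω} := by
    rintro ω ⟨n, hn, c, hc⟩
    obtain ⟨i, rfl⟩ := Nat.exists_eq_add_of_le' hn
    exact Set.mem_iUnion.2 ⟨i, Set.mem_iUnion.2 ⟨c, hc⟩⟩
  refine (measure_mono hsub).trans ((measure_iUnion_le _).trans ?_)
  have hterm : ∀ n, P (⋃ c, {ω | exploration (4 + 4 * d) β₁ n <
      IsAdaptiveDesign.stdError (fun x y : D => k x y) σ hU'.path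
        (fun f x => (f : D → ℝ) x) y x n (logWeight n) (fun _ => q n c) ω}) ≤
      ENNReal.ofReal (g n) := fun n => by
    refine (measure_iUnion_fintype_le P _).trans ?_
    refine (Finset.sum_le_sum fun c _ => measure_lt_le_of_lintegral_exp
      (hξ.measurable_stdError (hU.measurable_kernel hU') measurable_const)
      (fun θ => IsAdaptiveDesign.lintegral_exp_path_stdError_le hξ hU hσ (logWeight_pos n)
        (g := fun _ => q n c) measurable_const θ) (exploration_nonneg _ _ _)).trans ?_
    rw [Finset.sum_const, Finset.card_univ, Fintype.card_fun, Fintype.card_fin, Fintype.card_fin,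
      nsmul_eq_mul, ← ENNReal.ofReal_natCast, ← ENNReal.ofReal_mul (by positivity)]
    exact ENNReal.ofReal_le_ofReal (card_mul_exp_exploration_le d β₁ n)
  refine (ENNReal.tsum_le_tsum fun n => hterm (n + N)).trans ?_
  rw [← ENNReal.ofReal_tsum_of_nonneg (fun n => hg0 _) ((summable_nat_add_iff N).2 hsum)]
  exact ENNReal.ofReal_le_ofReal hN.le

/-- The weighted sums of the eighth powers of the standardized errors and of the noise are bounded
by a constant that does not depend on the run, each with probability `1 - δ / 4`. -/
lemma exists_forall_measure_exists_lt_sum_le [IsProbabilityMeasure P] (hσ : 0 < σ)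
    (hδ : 0 < δ) (hU : IsCenteredGP P D k U) (hU' : HasDerivTails P D a b U)
    (hε : IsNoise P D σ U ε) :
    ∃ A : ℝ, 0 < A ∧
      P {ω | ∃ T : ℕ, A < ∑ n ∈ Finset.range T, logWeight n * ε (n + 1) ω ^ 8} ≤
        ENNReal.ofReal (δ / 4) ∧
      ∀ (x : ℕ → Ω → D) (e y : ℕ → Ω → ℝ) (ξ : ∀ n : ℕ, (Fin n → ℝ) → D),
        IsAdaptiveDesign P hU'.path (fun f x => (f : D → ℝ) x) σ e y x ξ →
        P {ω | ∃ T : ℕ, A < ∑ n ∈ Finset.range T, logWeight n *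
          IsAdaptiveDesign.stdError (fun x y : D => k x y) σ hU'.path
            (fun f x => (f : D → ℝ) x) y x n (logWeight n) (x n) ω ^ 8} ≤
          ENNReal.ofReal (δ / 4) := by
  set M : ℝ := (Nat.factorial 8) * (2 * (Real.exp (1 / 2) + Real.exp (σ ^ 2 / 2))) with hM
  have hl2 : 0 < Real.log 2 := Real.log_pos one_lt_two
  have hMpos : 0 < M := by positivity
  have hA : 0 < M / Real.log 2 / (δ / 4) := by positivity
  have hMA : M / Real.log 2 / (M / Real.log 2 / (δ / 4)) = δ / 4 := by field_simp
  refine ⟨M / Real.log 2 / (δ / 4), hA, ?_, fun x e y ξ hξ => ?_⟩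
  · refine (measure_exists_lt_sum_logWeight_le (fun n => hε.measurable (n + 1)) hMpos.le hA
      fun n => lintegral_pow_eight_le (hε.measurable (n + 1)) (by positivity)
        fun θ hθ => ?_).trans_eq (by rw [hMA])
    rw [lintegral_exp_mul_of_map_eq_gaussianReal (hε.measurable _) (hε.law _)]
    refine ENNReal.ofReal_le_ofReal ?_
    rw [← sq_abs θ, hθ]
    have := Real.exp_pos (1 / 2)
    norm_num
    positivity
  · have hm : ∀ n, Measurable (IsAdaptiveDesign.stdError (fun x y : D => k x y) σ hU'.path
        (fun f x => (f : D → ℝ) x) y x n (logWeight n) (x n)) := fun n =>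
      hξ.measurable_stdError (hU.measurable_kernel hU') (hξ.measurable_point n)
    refine (measure_exists_lt_sum_logWeight_le hm hMpos.le hA
      fun n => lintegral_pow_eight_le (hm n) (by positivity)
        fun θ hθ => ?_).trans_eq (by rw [hMA])
    have h1 : x n = fun ω => ξ n fun i => y i ω := funext fun ω => hξ.point_eq n ω
    have h2 := IsAdaptiveDesign.lintegral_exp_path_stdError_le hξ hU hσ (logWeight_pos n)
      (hξ.measurable_rule n) θ
    rw [← h1] at h2
    refine h2.trans (ENNReal.ofReal_le_ofReal ?_)
    rw [← sq_abs θ, hθ]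
    norm_num
    positivity

end GoodEvent

section GoodRun

variable {d : ℕ} {Ω : Type*} [MeasurableSpace Ω] {P : Measure Ω}
  {D : Set (EuclideanSpace ℝ (Fin d))} {V : EuclideanSpace ℝ (Fin d) → ℝ → ℝ} {t : ℕ → ℝ}
  {k : EuclideanSpace ℝ (Fin d) → EuclideanSpace ℝ (Fin d) → ℝ}
  {U : EuclideanSpace ℝ (Fin d) → Ω → ℝ} {ε : ℕ → Ω → ℝ} {a b r L Δ σ η δ : ℝ}
  {X : ℕ → Ω → EuclideanSpace ℝ (Fin d)}

lemma gradBound_nonneg : 0 ≤ gradBound V t D :=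
  Real.sSup_nonneg fun _ ⟨_, _, _, _, _, h⟩ => h ▸ abs_nonneg _

lemma abs_partialDeriv_le_gradBound (hgrad : BddAbove (gradEntries V t D)) {n : ℕ} (hn : 1 ≤ n)
    {x : EuclideanSpace ℝ (Fin d)} (hx : x ∈ D) (j : Fin d) :
    |partialDeriv (fun x => V x (t n)) j x| ≤ gradBound V t D :=
  le_csSup hgrad ⟨n, hn, x, hx, j, rfl⟩

lemma drift_nonneg (n : ℕ) : 0 ≤ drift V t D n :=
  Real.iSup_nonneg fun _ => abs_nonneg _

lemma abs_sub_le_drift (hD : IsCompact D) (hV : ∀ n, 1 ≤ n → ConcaveSmoothOn L D fun x => V x (t n))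
    {n : ℕ} (hn : 2 ≤ n) (z : D) : |V z (t n) - V z (t (n - 1))| ≤ drift V t D n := by
  have := isCompact_iff_compactSpace.1 hD
  have hc : ∀ m, 1 ≤ m → Continuous fun x : D => V x (t m) := fun m hm =>
    continuous_iff_continuousAt.2 fun x =>
      (((hV m hm).differentiable x x.2).continuousAt).comp continuous_subtype_val.continuousAt
  have h1 := hc n (by omega)
  have h2 := hc (n - 1) (by omega)
  exact le_ciSup (isCompact_range (h1.sub h2).abs).bddAbove z

/-- With probability at least `1 - δ` a run is good, with constants that do not depend on the
run. -/
theorem exists_forall_isRun_le_measure_isGoodPath [IsProbabilityMeasure P] (hr : 0 < r)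
    (ha : 0 < a) (hb : 0 < b) (hσ : 0 < σ) (hδ : 0 < δ) (hδa : δ < 2 * d * a)
    (hDne : D.Nonempty) (hDcompact : IsCompact D) (hDconvex : Convex ℝ D)
    (hDcube : ∀ x ∈ D, ∀ j : Fin d, 0 ≤ x j ∧ x j ≤ r)
    (hV : ∀ n, 1 ≤ n → ConcaveSmoothOn L D fun x => V x (t n))
    (hgrad : BddAbove (gradEntries V t D)) (hU : IsCenteredGP P D k U)
    (hU' : HasDerivTails P D a b U) (hε : IsNoise P D σ U ε) :
    ∃ (C A : ℝ) (N : ℕ), 0 ≤ C ∧ 0 ≤ A ∧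
      ∀ (X : ℕ → Ω → EuclideanSpace ℝ (Fin d))
        (hX : IsRun P D V t k σ (beta d a b r δ) η U ε X),
        ENNReal.ofReal (1 - δ) ≤ P {ω | IsGoodPath (fun x y : D => k x y) σ η
          (exploration (4 + 4 * d) (beta d a b r δ 1)) (fun n z => V z (t (n + 1)))
          (fun n => drift V t D (n + 1)) (fun z => U z ω) (fun n => hX.point n ω)
          (fun n => ε (n + 1) ω) C A N} := by
  choose q hq using fun n : ℕ => exists_net (d := d) hr hDne hDcube (n := n + 1) n.succ_pos
  obtain ⟨N, hN⟩ := exists_forall_measure_exists_lt_stdError_le hσ hδ hU hU'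
    (beta d a b r δ 1) q
  obtain ⟨A, hA, hAε, hAe⟩ := exists_forall_measure_exists_lt_sum_le hσ hδ hU hU' hε
  set M := b * √(Real.log (4 * d * a / δ)) with hM
  have hM0 : 0 ≤ M := by positivity
  set G := gradBound V t D with hG
  have hG0 : 0 ≤ G := gradBound_nonneg
  set C := (d * G + d * M) * (d * r) with hC
  refine ⟨C, A, N, by positivity, hA.le, fun X hX => ?_⟩
  obtain ⟨ξ, hξ⟩ := hX.exists_isAdaptiveDesign hDcompact hDne hU hU' hε
  set ζ : (n : ℕ) → (Ω → D) → Ω → ℝ := fun n z =>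
    IsAdaptiveDesign.stdError (fun x y : D => k x y) σ hU'.path (fun f x => (f : D → ℝ) x)
      (fun n => feedback U ε X (n + 1)) hX.point n (logWeight n) z with hζ
  set b' := exploration (4 + 4 * d) (beta d a b r δ 1) with hb'
  set S := {ω | IsGoodPath (fun x y : D => k x y) σ η b' (fun n z => V z (t (n + 1)))
    (fun n => drift V t D (n + 1)) (fun z => U z ω) (fun n => hX.point n ω)
    (fun n => ε (n + 1) ω) C A N} with hS
  set B₁ := {ω | ∃ j, ∃ x ∈ D, M < |partialDeriv (fun x' => U x' ω) j x|} with hB₁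
  set B₂ := {ω | ∃ n, N ≤ n ∧ ∃ c, b' n < ζ n (fun _ => q n c) ω} with hB₂
  set B₃ := {ω | ∃ T : ℕ, A < ∑ n ∈ Finset.range T, logWeight n * ε (n + 1) ω ^ 8} with hB₃
  set B₄ := {ω | ∃ T : ℕ, A < ∑ n ∈ Finset.range T, logWeight n * ζ n (hX.point n) ω ^ 8}
    with hB₄
  set B₅ := {ω | ¬ ∀ n, 2 ≤ n →
    (⨆ x : D, surrogate V t k σ (beta d a b r δ) U ε X n ω x) -
        surrogate V t k σ (beta d a b r δ) U ε X n ω (X n ω) ≤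
      η * ((⨆ x : D, surrogate V t k σ (beta d a b r δ) U ε X n ω x) -
        surrogate V t k σ (beta d a b r δ) U ε X n ω (X (n - 1) ω))} with hB₅
  have hP₅ : P B₅ = 0 := ae_iff.1 hX.linear_convergence
  have hcompl : Sᶜ ⊆ B₁ ∪ B₂ ∪ B₃ ∪ B₄ ∪ B₅ := by
    intro ω hω
    by_contra hgood
    simp only [Set.mem_union, not_or] at hgood
    obtain ⟨⟨⟨⟨h₁, h₂⟩, h₃⟩, h₄⟩, h₅⟩ := hgood
    have h₁' : ∀ x ∈ D, ∀ j, |partialDeriv (fun x' => U x' ω) j x| ≤ M := fun x hx j =>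
      le_of_not_gt fun h => h₁ ⟨j, x, hx, h⟩
    have h₂' : ∀ n, N ≤ n → ∀ c, ζ n (fun _ => q n c) ω ≤ b' n := fun n hn c =>
      le_of_not_gt fun h => h₂ ⟨n, hn, c, h⟩
    have h₃' : ∀ T : ℕ, ∑ n ∈ Finset.range T, logWeight n * ε (n + 1) ω ^ 8 ≤ A := fun T =>
      le_of_not_gt fun h => h₃ ⟨T, h⟩
    have h₄' : ∀ T : ℕ, ∑ n ∈ Finset.range T, logWeight n * ζ n (hX.point n) ω ^ 8 ≤ A :=
      fun T => le_of_not_gt fun h => h₄ ⟨T, h⟩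
    have h₅' := not_not.1 h₅
    -- both summands of the objective are Lipschitz, with constants independent of time
    have hlipV : ∀ (n : ℕ) (z z' : D), V z (t (n + 1)) - V z' (t (n + 1)) ≤
        d * G * ‖(z : EuclideanSpace ℝ (Fin d)) - z'‖ := fun n z z' =>
      (le_abs_self _).trans (abs_sub_le_of_partialDeriv hDconvex
        (hV (n + 1) n.succ_pos).differentiable hG0
        (fun x hx j => abs_partialDeriv_le_gradBound hgrad n.succ_pos hx j) z'.2 z.2)
    have hlipU : ∀ z z' : D, U z ω - U z' ω ≤
        d * M * ‖(z : EuclideanSpace ℝ (Fin d)) - z'‖ := fun z z' =>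
      (le_abs_self _).trans (abs_sub_le_of_partialDeriv hDconvex
        (hU'.differentiable ω) hM0 h₁' z'.2 z.2)
    have hdiam : ∀ z z' : D, ‖(z : EuclideanSpace ℝ (Fin d)) - z'‖ ≤ d * r := fun z z' =>
      norm_le_of_forall_abs_le fun j => by
        obtain ⟨h1, h2⟩ := hDcube z z.2 j
        obtain ⟨h3, h4⟩ := hDcube z' z'.2 j
        rw [PiLp.sub_apply, abs_le]
        constructor <;> linarith
    have hsur := hX.surrogateAt_eq (e := b') (sqrt_beta_succ hr hb hδ hδa)
    refine hω
      { osc_objective := fun n z z' => ?_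
        osc_known := fun n z z' => ?_
        drift := fun n z => abs_sub_le_drift hDcompact hV (n := n + 2) (by omega) z
        linear_convergence := fun n => ?_
        confidence := fun n hn z => ?_
        mean_error := h₄'
        noise := h₃' }
    · have h1 := hlipV n z z'
      have h2 := hlipU z z'
      have h3 := mul_le_mul_of_nonneg_left (hdiam z z') (by positivity : 0 ≤ d * G + d * M)
      rw [hC]
      linarith
    · have h1 := hlipV n z z'
      have h2 := mul_le_mul_of_nonneg_left (hdiam z z') (by positivity : 0 ≤ d * G)
      have h3 : 0 ≤ d * M * (d * r) := by positivity
      rw [hC]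
      linarith
    · rw [surrogateGap]
      simp only [hsur]
      exact h₅' (n + 2) (by omega)
    · obtain ⟨c, hc⟩ := hq n z
      refine ⟨q n c, ?_⟩
      have h1 := hlipV n z (q n c)
      have h2 := hlipU z (q n c)
      have h3 := mul_le_mul_of_nonneg_left hc (by positivity : 0 ≤ d * G + d * M)
      have h4 : (d * G + d * M) * (d * (r / ((n + 1 : ℕ) : ℝ))) = C / (n + 1) := by
        rw [hC]
        push_cast
        ring
      have h5 := h₂' n hn c
      have h6 : 0 < sdAt (fun x y : D => k x y) σ (fun i => hX.point i ω) n (q n c) +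
          logWeight n := add_pos_of_nonneg_of_pos (sdAt_nonneg _ _ _) (logWeight_pos n)
      have h7 := (div_le_iff₀ h6).1 h5
      change U (q n c) ω - meanAt (fun x y : D => k x y) σ (fun i => hX.point i ω)
        (fun i => U (hX.point i ω) ω + ε (i + 1) ω) n (q n c) ≤ _ at h7
      linarith
  have hle : P Sᶜ ≤ ENNReal.ofReal δ := by
    calc P Sᶜ ≤ P (B₁ ∪ B₂ ∪ B₃ ∪ B₄ ∪ B₅) := measure_mono hcompl
      _ ≤ P B₁ + P B₂ + P B₃ + P B₄ + P B₅ := by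
          refine (measure_union_le _ _).trans ?_
          gcongr
          refine (measure_union_le _ _).trans ?_
          gcongr
          refine (measure_union_le _ _).trans ?_
          gcongr
          exact measure_union_le _ _
      _ ≤ ENNReal.ofReal (δ / 4) + ENNReal.ofReal (δ / 4) + ENNReal.ofReal (δ / 4) +
            ENNReal.ofReal (δ / 4) + 0 := by
          gcongr
          · exact hU'.measure_exists_lt_le ha hb hδ hδa
          · exact hN _ _ _ _ hξ
          · exact hAe _ _ _ _ hξ
          · exact hP₅.le
      _ = ENNReal.ofReal δ := by
          rw [add_zero, ← ENNReal.ofReal_add (by positivity) (by positivity),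
            ← ENNReal.ofReal_add (by positivity) (by positivity),
            ← ENNReal.ofReal_add (by positivity) (by positivity)]
          congr 1
          ring
  rw [ENNReal.ofReal_sub _ hδ.le, ENNReal.ofReal_one, tsub_le_iff_right]
  calc (1 : ENNReal) = P (S ∪ Sᶜ) := by rw [Set.union_compl_self, measure_univ]
    _ ≤ P S + P Sᶜ := measure_union_le _ _
    _ ≤ _ := by gcongr

end GoodRun

/-! ### The drift term and the orders of growth -/

section Drift

variable {d : ℕ} {D : Set (EuclideanSpace ℝ (Fin d))} {V : EuclideanSpace ℝ (Fin d) → ℝ → ℝ}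
  {t : ℕ → ℝ} {η Δ : ℝ}

lemma sum_Icc_one_eq_sum_range (f : ℕ → ℝ) (T : ℕ) :
    ∑ n ∈ Finset.Icc 1 T, f n = ∑ n ∈ Finset.range T, f (n + 1) := by
  rw [Finset.sum_bij' (fun n _ => n - 1) (fun n _ => n + 1)]
  all_goals simp
  all_goals grind

lemma discounted_eq_sum (η : ℝ) (Δ : ℕ → ℝ) (n : ℕ) :
    discounted η Δ n = ∑ z ∈ Finset.Icc 1 n, η ^ z * Δ (n + 1 - z) := by
  induction n with
  | zero => simp [discounted]
  | succ n ih =>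
    rw [discounted, ih, sum_Icc_one_eq_sum_range, sum_Icc_one_eq_sum_range,
      Finset.sum_range_succ', mul_add, Finset.mul_sum]
    congr 1
    · refine Finset.sum_congr rfl fun z _ => ?_
      rw [show n + 1 + 1 - (z + 1 + 1) = n + 1 - (z + 1) by omega]
      ring
    · simp

lemma driftTerm_eq (T : ℕ) : driftTerm V t D η T =
    2 * ∑ n ∈ Finset.range T, discounted η (fun n => drift V t D (n + 1)) n := by
  rw [driftTerm, sum_Icc_one_eq_sum_range]
  congr 1
  refine Finset.sum_congr rfl fun n _ => ?_
  rw [discounted_eq_sum]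
  exact Finset.sum_congr (by simp) fun z _ => rfl

lemma discounted_le (hη : 0 ≤ η) (hη1 : η < 1) {u : ℕ → ℝ}
    (hΔ : ∀ n, 1 ≤ n → u n ≤ Δ) (hΔ0 : 0 ≤ Δ) : ∀ n, discounted η u n ≤ η * Δ / (1 - η)
  | 0 => by
    have : 0 < 1 - η := by linarith
    rw [discounted]
    positivity
  | n + 1 => by
    have h0 : 0 < 1 - η := by linarith
    have h1 : η * (discounted η u n + u (n + 1)) ≤ η * (η * Δ / (1 - η) + Δ) :=
      mul_le_mul_of_nonneg_left (add_le_add (discounted_le hη hη1 hΔ hΔ0 n)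
        (hΔ _ n.succ_pos)) hη
    refine h1.trans_eq ?_
    field_simp
    ring

lemma driftTerm_nonneg (hη : 0 ≤ η) (T : ℕ) : 0 ≤ driftTerm V t D η T := by
  rw [driftTerm_eq]
  exact mul_nonneg zero_le_two (Finset.sum_nonneg fun n _ =>
    discounted_nonneg hη (fun n => drift_nonneg (n + 1)) n)

lemma driftTerm_le (hη : 0 ≤ η) (hη1 : η < 1) (hΔ : ∀ n, 2 ≤ n → drift V t D n ≤ Δ) (T : ℕ) :
    driftTerm V t D η T ≤ 2 * Δ * η * T / (1 - η) := by
  have hΔ0 : 0 ≤ Δ := (drift_nonneg 2).trans (hΔ 2 le_rfl)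
  rw [driftTerm_eq]
  have h1 : ∑ n ∈ Finset.range T, discounted η (fun n => drift V t D (n + 1)) n ≤
      ∑ _n ∈ Finset.range T, η * Δ / (1 - η) :=
    Finset.sum_le_sum fun n _ => discounted_le hη hη1 (fun n hn => hΔ _ (by omega)) hΔ0 n
  rw [Finset.sum_const, Finset.card_range, nsmul_eq_mul] at h1
  calc _ ≤ 2 * (T * (η * Δ / (1 - η))) := by gcongr
    _ = _ := by ring

lemma eventually_one_le_log : ∀ᶠ T : ℕ in atTop, 1 ≤ Real.log T :=
  (Real.tendsto_log_atTop.comp tendsto_natCast_atTop_atTop).eventually_ge_atTop 1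

lemma isBigO_one_add_log : (fun T : ℕ => 1 + Real.log T) =O[atTop] fun T : ℕ => Real.log T := by
  refine Asymptotics.IsBigO.of_bound 2 ?_
  filter_upwards [eventually_one_le_log] with T hT
  rw [Real.norm_of_nonneg (by linarith), Real.norm_of_nonneg (by linarith)]
  linarith

lemma isBigOStar_mul_one_add_log_sub (K c : ℝ) :
    IsBigOStar (fun T => K * (1 + Real.log T) - c) fun _ => 1 := by
  refine ⟨1, ?_⟩
  simp only [one_mul, pow_one]
  refine (isBigO_one_add_log.const_mul_left K).sub (Asymptotics.IsBigO.of_bound |c| ?_)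
  filter_upwards [eventually_one_le_log] with T hT
  rw [Real.norm_of_nonneg (by linarith : 0 ≤ Real.log T), Real.norm_eq_abs]
  exact le_mul_of_one_le_right (abs_nonneg c) hT

lemma isBigOStar_sqrt {C c β₁ : ℝ} {β γ : ℕ → ℝ} (hd : 0 < d) (hC : 0 ≤ C) (hc : 0 ≤ c)
    (hβ : ∀ n, 1 ≤ n → β n = c * Real.log n + β₁) (hγ : ∀ T, 0 ≤ γ T) :
    IsBigOStar (fun T => √(C * T * β T * γ T)) fun T => √(d * T * γ T) := by
  refine ⟨1, Asymptotics.IsBigO.of_bound √(C * (c + |β₁|)) ?_⟩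
  have hd1 : (1 : ℝ) ≤ d := by exact_mod_cast hd
  filter_upwards [eventually_one_le_log, eventually_ge_atTop 1] with T hT hT1
  have hlog : 0 ≤ Real.log T := by linarith
  have h1 : β T ≤ (c + |β₁|) * Real.log T ^ 2 := by
    have h2 : Real.log T ≤ Real.log T ^ 2 := by nlinarith
    have h3 : c * Real.log T ≤ c * Real.log T ^ 2 := mul_le_mul_of_nonneg_left h2 hc
    have h4 : |β₁| ≤ |β₁| * Real.log T ^ 2 :=
      le_mul_of_one_le_right (abs_nonneg _) (by nlinarith)
    rw [hβ T hT1]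
    linarith [le_abs_self β₁]
  have hγT := hγ T
  rw [Real.norm_of_nonneg (Real.sqrt_nonneg _), norm_mul, Real.norm_of_nonneg (Real.sqrt_nonneg _),
    pow_one, Real.norm_of_nonneg hlog]
  calc √(C * T * β T * γ T) ≤ √(C * (c + |β₁|) * (d * T * γ T) * Real.log T ^ 2) := by
        refine Real.sqrt_le_sqrt ?_
        have h2 : C * T * γ T * β T ≤ C * T * γ T * ((c + |β₁|) * Real.log T ^ 2) :=
          mul_le_mul_of_nonneg_left h1 (by positivity)
        have h3 : C * T * γ T * ((c + |β₁|) * Real.log T ^ 2) ≤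
            d * (C * T * γ T * ((c + |β₁|) * Real.log T ^ 2)) :=
          le_mul_of_one_le_left (by positivity) hd1
        linarith
    _ = √(C * (c + |β₁|)) * (√(d * T * γ T) * Real.log T) := by
        rw [Real.sqrt_mul (by positivity), Real.sqrt_mul (by positivity), Real.sqrt_sq hlog,
          mul_assoc]

lemma isBigO_one_add_log_add_driftTerm (hη : 0 ≤ η) (hη1 : η < 1)
    (hΔ : ∀ n, 2 ≤ n → drift V t D n ≤ Δ) (K : ℝ) :
    (fun T : ℕ => K * (1 + Real.log T) + driftTerm V t D η T) =O[atTop] fun T : ℕ => (T : ℝ) := by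
  have h1 : (fun T : ℕ => Real.log T) =O[atTop] fun T : ℕ => (T : ℝ) :=
    Real.isLittleO_log_id_atTop.isBigO.comp_tendsto tendsto_natCast_atTop_atTop
  refine ((isBigO_one_add_log.trans h1).const_mul_left K).add
    (Asymptotics.IsBigO.of_bound (2 * Δ * η / (1 - η)) (Eventually.of_forall fun T => ?_))
  rw [Real.norm_of_nonneg (driftTerm_nonneg hη T), Real.norm_natCast]
  refine (driftTerm_le hη hη1 hΔ T).trans_eq ?_
  ring

end Drift

end AGPUCB

theorem theorem1 {d : ℕ} {Ω : Type*} [MeasurableSpace Ω] (P : Measure Ω) [IsProbabilityMeasure P]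
    (D : Set (EuclideanSpace ℝ (Fin d))) (V : EuclideanSpace ℝ (Fin d) → ℝ → ℝ) (t : ℕ → ℝ)
    (k : EuclideanSpace ℝ (Fin d) → EuclideanSpace ℝ (Fin d) → ℝ)
    (U : EuclideanSpace ℝ (Fin d) → Ω → ℝ) (ε : ℕ → Ω → ℝ)
    (r a b L Δ η σ δ : ℝ) (hr : 0 < r) (ha : 0 < a) (hb : 0 < b) (hσ : 0 < σ)
    (hη : 0 ≤ η ∧ η < 1) (hδ : 0 < δ ∧ δ < 1) (hδa : δ < 2 * d * a)
    -- the decision set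
    (hDne : D.Nonempty) (hDcompact : IsCompact D) (hDconvex : Convex ℝ D)
    (hDcube : ∀ x ∈ D, ∀ j : Fin d, 0 ≤ x j ∧ x j ≤ r)
    -- the known function
    (hV : ∀ n, 1 ≤ n → AGPUCB.ConcaveSmoothOn L D (fun x => V x (t n)))
    (hgrad : BddAbove (AGPUCB.gradEntries V t D))
    (hΔ : ∀ n, 2 ≤ n → AGPUCB.drift V t D n ≤ Δ)
    -- the unknown function and the noise
    (hk : ∀ x ∈ D, k x x ≤ 1)
    (hU : AGPUCB.IsCenteredGP P D k U) (hU' : AGPUCB.HasDerivTails P D a b U)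
    (hε : AGPUCB.IsNoise P D σ U ε) :
    (∃ Err : ℕ → ℝ,
      AGPUCB.IsBigOStar Err (fun _ => 1) ∧
      AGPUCB.IsBigOStar
        (fun T => √(AGPUCB.C₁ σ * T * AGPUCB.beta d a b r δ T * AGPUCB.maxInfoGain k σ D T))
        (fun T => √(d * T * AGPUCB.maxInfoGain k σ D T)) ∧
      ((fun T => AGPUCB.C₂ d a b δ L (AGPUCB.gradBound V t D) + Err T +
        AGPUCB.driftTerm V t D η T) =O[atTop] fun T : ℕ => (T : ℝ)) ∧
      ∀ X : ℕ → Ω → EuclideanSpace ℝ (Fin d),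
        AGPUCB.IsRun P D V t k σ (AGPUCB.beta d a b r δ) η U ε X →
        ENNReal.ofReal (1 - δ) ≤
          P {ω | ∀ T : ℕ, 1 ≤ T →
            AGPUCB.regret D V t U X T ω ≤
              √(AGPUCB.C₁ σ * T * AGPUCB.beta d a b r δ T * AGPUCB.maxInfoGain k σ D T) +
                AGPUCB.C₂ d a b δ L (AGPUCB.gradBound V t D) + Err T +
                AGPUCB.driftTerm V t D η T}) ∧
    ∀ T : ℕ, 1 ≤ T → AGPUCB.driftTerm V t D η T ≤ 2 * Δ * η * T / (1 - η) := by
  obtain ⟨hη0, hη1⟩ := hη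
  obtain ⟨hδ0, -⟩ := hδ
  have hd := AGPUCB.pos_dim_of_lt hδ0 hδa
  have hc : (0 : ℝ) < 4 + 4 * d := by positivity
  have : Nonempty D := hDne.to_subtype
  obtain ⟨C, A, N, hC, hA, hgood⟩ := AGPUCB.exists_forall_isRun_le_measure_isGoodPath (η := η) hr ha
    hb hσ hδ0 hδa hDne hDcompact hDconvex hDcube hV hgrad hU hU' hε
  obtain ⟨K, -, hK⟩ := AGPUCB.exists_forall_isGoodPath_sum_regret_le hU.kernel_eq_inner hσ
    (fun x : D => hk x x.2) (hU.totallyBounded_range_feature hU' hDcompact) hη0 hη1 hc hC hA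
    (AGPUCB.beta d a b r δ 1) N
  refine ⟨⟨fun T => K * (1 + Real.log T) - AGPUCB.C₂ d a b δ L (AGPUCB.gradBound V t D),
    AGPUCB.isBigOStar_mul_one_add_log_sub K _,
    AGPUCB.isBigOStar_sqrt hd (AGPUCB.C₁_pos hσ).le hc.le
      (fun n hn => AGPUCB.beta_eq hr hb hδ0 hδa hn)
      (fun T => AGPUCB.maxInfoGain_nonneg hU.kernel_eq_inner hσ T), ?_, fun X hX => ?_⟩,
    fun T _ => AGPUCB.driftTerm_le hη0 hη1 hΔ T⟩
  · simpa using AGPUCB.isBigO_one_add_log_add_driftTerm hη0 hη1 hΔ K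
  · refine (hgood X hX).trans (measure_mono fun ω hω T hT => ?_)
    have h1 := hK _ _ _ _ _ hω (fun n => AGPUCB.drift_nonneg (n + 1)) T hT
      (AGPUCB.maxInfoGain k σ D T) (AGPUCB.infoGain_le_maxInfoGain hU.kernel_eq_inner hσ
        (fun x : D => hk x x.2) fun i => hX.point i ω)
    rw [← AGPUCB.beta_eq hr hb hδ0 hδa hT, ← AGPUCB.driftTerm_eq] at h1
    have h2 : AGPUCB.regret D V t U X T ω = ∑ n ∈ Finset.range T,
        ((⨆ z : D, (V z (t (n + 1)) + U z ω)) -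
          (V (hX.point n ω) (t (n + 1)) + U (hX.point n ω) ω)) :=
      AGPUCB.sum_Icc_one_eq_sum_range _ T
    rw [h2]
    linarith
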